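/- There are a deterministic combinatorial algorithm and a constant $C$ such that the following holds for every finite connected simple graph $G=(V,E)$ with $n$ vertices, $m$ edges and maximum degree $\Delta\ge 2$. Given $G$ by its adjacency lists (in any order), the algorithm halts after at most $C\,n\,m$ steps and outputs a partition of $V$ into $A$ and $B$ such that the number of edges between $A$ and $B$ is at least $\left(\frac12+\frac1\Delta\right)\mathrm{mc}(G)$, where $\mathrm{mc}(G)$ is the maximum size of a cut of $G$. That is, there is an $O(nm)$-time combinatorial $\left(\frac12+\frac1\Delta\right)$-approximation algorithm for Max-Cut. Here a combinatorial algorithm is a program for a random access machine that uses no numerical subroutines: its only operations on numbers are copying, adding or subtracting $1$, comparing two numbers, and reading and writing array cells, each of which counts as one step. -/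

import Mathlib

/-! ### Cuts of a graph -/

namespace MaxCut

/-- The size of the cut `C(A, B)` with `B = V \ A`: the number of edges of `G` with one endpoint
in `A` and the other one outside `A`. -/
def cutSize {V : Type*} [Fintype V] [DecidableEq V] (G : SimpleGraph V) [DecidableRel G.Adj]
    (A : Finset V) : ℕ :=
  (G.edgeFinset.filter (fun e => ∃ u ∈ A, ∃ v ∈ Aᶜ, e = s(u, v))).card

/-- The size of a maximum cut of `G`. -/
def mc {V : Type*} [Fintype V] [DecidableEq V] (G : SimpleGraph V) [DecidableRel G.Adj] : ℕ :=
  (Finset.univ : Finset (Finset V)).sup (cutSize G)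

/-! ### A random access machine

Programs are deterministic structured programs for a random access machine. The memory consists of
scalar registers and of one-dimensional arrays, all holding natural numbers; a program, being a
finite piece of syntax, names only finitely many registers and arrays. The only operations on numbers
are copying, adding or subtracting one, comparing, and using them as array indices. In
particular there is no multiplication and no operation on reals or matrices, and in `t` steps no
number grows by more than `t` beyond the input and the constants of the program, so that unit cost
per instruction is a fair measure of time. -/

/-- The memory of the machine. -/
structure Memory where
  /-- the scalar registers -/
  reg : ℕ → ℕ
  /-- the arrays: `arr a i` is the cell with index `i` of the array `a` -/
  arr : ℕ → ℕ → ℕ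

/-- `M.setReg x k` is `M` after the assignment of the number `k` to the register `x`. -/
def Memory.setReg (M : Memory) (x k : ℕ) : Memory :=
  { M with reg := Function.update M.reg x k }

/-- `M.setArr a i k` is `M` after the assignment of the number `k` to the cell `i` of the
array `a`. -/
def Memory.setArr (M : Memory) (a i k : ℕ) : Memory :=
  { M with arr := Function.update M.arr a (Function.update (M.arr a) i k) }

/-- The tests: comparisons of two registers. -/
inductive Test where
  | eq (x y : ℕ)
  | lt (x y : ℕ)

/-- The truth value of a test. -/
def Test.holds (M : Memory) : Test → Prop
  | .eq x y => M.reg x = M.reg y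
  | .lt x y => M.reg x < M.reg y

/-- The elementary instructions, where `x`, `y` are names of registers and `a` is the name of an
array. -/
inductive Instr where
  /-- `x := k` -/
  | const (x k : ℕ)
  /-- `x := y` -/
  | copy (x y : ℕ)
  /-- `x := y + 1` -/
  | succ (x y : ℕ)
  /-- `x := y - 1` (and `x := 0` if `y` holds `0`) -/
  | pred (x y : ℕ)
  /-- `x := a[y]` -/
  | load (x a y : ℕ)
  /-- `a[x] := y` -/
  | store (a x y : ℕ)

/-- The effect of an elementary instruction. -/
def Instr.exec (M : Memory) : Instr → Memory
  | .const x k => M.setReg x k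
  | .copy x y => M.setReg x (M.reg y)
  | .succ x y => M.setReg x (M.reg y + 1)
  | .pred x y => M.setReg x (M.reg y - 1)
  | .load x a y => M.setReg x (M.arr a (M.reg y))
  | .store a x y => M.setArr a (M.reg x) (M.reg y)

/-- The programs. -/
inductive Program where
  | skip
  | instr (i : Instr)
  | seq (P Q : Program)
  /-- if `b` then `P` else `Q` -/
  | cond (b : Test) (P Q : Program)
  /-- while `b` do `P` -/
  | loop (b : Test) (P : Program)

/-- `Runs P M t M'`: the program `P`, started with the memory `M`, halts after `t` steps with the
memory `M'`. Every execution of an elementary instruction and every evaluation of a test is one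
step. -/
inductive Runs : Program → Memory → ℕ → Memory → Prop
  | skip (M : Memory) : Runs .skip M 0 M
  | instr (i : Instr) (M : Memory) : Runs (.instr i) M 1 (i.exec M)
  | seq {P Q : Program} {M₀ M₁ M₂ : Memory} {t₁ t₂ : ℕ} :
      Runs P M₀ t₁ M₁ → Runs Q M₁ t₂ M₂ → Runs (.seq P Q) M₀ (t₁ + t₂) M₂
  | condTrue {b : Test} {P Q : Program} {M M' : Memory} {t : ℕ} :
      b.holds M → Runs P M t M' → Runs (.cond b P Q) M (t + 1) M'
  | condFalse {b : Test} {P Q : Program} {M M' : Memory} {t : ℕ} :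
      ¬ b.holds M → Runs Q M t M' → Runs (.cond b P Q) M (t + 1) M'
  | loopFalse {b : Test} {P : Program} {M : Memory} :
      ¬ b.holds M → Runs (.loop b P) M 1 M
  | loopTrue {b : Test} {P : Program} {M₀ M₁ M₂ : Memory} {t₁ t₂ : ℕ} :
      b.holds M₀ → Runs P M₀ t₁ M₁ → Runs (.loop b P) M₁ t₂ M₂ →
      Runs (.loop b P) M₀ (t₁ + t₂ + 1) M₂

/-- The machine is deterministic: the halting time and the final memory are determined by the
program and the initial memory. -/
theorem Runs.deterministic {P : Program} {M M₁ : Memory} {t₁ : ℕ} (h₁ : Runs P M t₁ M₁) :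
    ∀ {t₂ : ℕ} {M₂ : Memory}, Runs P M t₂ M₂ → t₁ = t₂ ∧ M₁ = M₂ := by
  induction h₁ with
  | skip M => intro _ _ h; cases h; exact ⟨rfl, rfl⟩
  | instr i M => intro _ _ h; cases h; exact ⟨rfl, rfl⟩
  | seq _ _ ih₁ ih₂ =>
    intro _ _ h
    cases h with
    | seq k₁ k₂ =>
      obtain ⟨rfl, rfl⟩ := ih₁ k₁
      obtain ⟨rfl, rfl⟩ := ih₂ k₂
      exact ⟨rfl, rfl⟩
  | condTrue hb _ ih =>
    intro _ _ h
    cases h with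
    | condTrue _ k => obtain ⟨rfl, rfl⟩ := ih k; exact ⟨rfl, rfl⟩
    | condFalse hn _ => exact absurd hb hn
  | condFalse hb _ ih =>
    intro _ _ h
    cases h with
    | condTrue hn _ => exact absurd hn hb
    | condFalse _ k => obtain ⟨rfl, rfl⟩ := ih k; exact ⟨rfl, rfl⟩
  | loopFalse hb =>
    intro _ _ h
    cases h with
    | loopFalse _ => exact ⟨rfl, rfl⟩
    | loopTrue hn _ _ => exact absurd hn hb
  | loopTrue hb _ _ ih₁ ih₂ =>
    intro _ _ h
    cases h with
    | loopFalse hn => exact absurd hb hn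
    | loopTrue _ k₁ k₂ =>
      obtain ⟨rfl, rfl⟩ := ih₁ k₁
      obtain ⟨rfl, rfl⟩ := ih₂ k₂
      exact ⟨rfl, rfl⟩

/-! ### Input and output -/

/-- `off` and `nbr` are adjacency lists of `G`, stored one after the other: the cells
`off v, …, off (v + 1) - 1` of `nbr` list the neighbours of the vertex `v`, each of them once and in
an arbitrary order. -/
structure IsAdjacencyLists {n : ℕ} (G : SimpleGraph (Fin n)) (off nbr : ℕ → ℕ) : Prop where
  off_zero : off 0 = 0
  off_le : ∀ v : Fin n, off (v : ℕ) ≤ off ((v : ℕ) + 1)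
  bijOn : ∀ v : Fin n, Set.BijOn nbr (Set.Ico (off (v : ℕ)) (off ((v : ℕ) + 1)))
    {k | ∃ w : Fin n, G.Adj v w ∧ (w : ℕ) = k}

/-- The initial memory: the number of vertices is in register `0`, the adjacency lists are in the
arrays `0` and `1`, and all other cells hold `0`. -/
def inputMemory (n : ℕ) (off nbr : ℕ → ℕ) : Memory where
  reg := Function.update (fun _ => 0) 0 n
  arr := Function.update (Function.update (fun _ _ => 0) 0 off) 1 nbr

/-- The final memory describes the cut `C(A, V \ A)`: the array `2` holds the indicator function
of `A`. -/
def OutputsCut {n : ℕ} (M : Memory) (A : Finset (Fin n)) : Prop :=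
  ∀ v : Fin n, M.arr 2 (v : ℕ) = if v ∈ A then 1 else 0

end MaxCut

/-! Count every edge as two darts, one for each direction. If an output cut has excess `D` (cut
darts minus uncut darts) and a competing cut `σ` has `b` cut and `a` uncut darts, then both totals
agree, and the desired ratio for `σ` is equivalent to `2 * b ≤ Δ * (D + a)`. So it suffices to make
`D` large wherever `σ` is forced to leave few edges uncut.

A depth-first search tree has no cross edges. It is decomposed from the leaves upwards into
connected subtrees ("pieces"), each properly 2-coloured by depth parity: the pieces hanging at `u`
are joined to `u`, except those that would create an odd cycle with `u`. Let `τ` be the number of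
pieces other than the one of the root. The edges inside the pieces are all cut and include `n - 1 -
τ` tree edges, so the pieces have excess at least `2 * (n - 1 - τ)`. On the other hand every cut `σ`
misses an edge of each of the `τ` odd cycles, and these missed edges can be chosen distinct by
charging an edge to the piece of its later discovered end (`IsPieces.exists_uncut`). Pieces can be
merged with the root piece without loss, because a piece may be flipped as a whole. Hence `D + a ≥ 2
* (n - 1)`.

There are at most `Δ * n` darts, so `D + a ≥ 2 * n` is enough. A single gain of `2` anywhere
achieves this: a non-tree edge inside a piece, a further edge missed by `σ`, or a profitable
merging. The first merging pass therefore looks for a profit, also trying for each vertex `y` the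
recolouring of its piece that leaves only the tree edge above `y` uncut. If there is no gain of any
kind, then inside each piece `σ` is, up to a global swap, one of the recolourings that were tried,
and its failure shows that at most two edges join the piece to the root piece
(`IsPieces.card_crossDarts_le`). The graph is then so sparse that `b ≤ Δ * (n - 1)`
(`IsPieces.card_le`), and `D + a ≥ 2 * (n - 1)` suffices. `IsPieces.approx` combines the two cases.

The time bound holds because each of the `n` rounds of every phase scans the vertices and the darts
a bounded number of times, and connectivity bounds `n` by the number of darts. -/

namespace MaxCut

/-! ### Total correctness with a time bound -/

/-- Started with the memory `M`, the program `P` halts after at most `T` steps with a memory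
satisfying `Q`. -/
def Wp (P : Program) (T : ℕ) (M : Memory) (Q : Memory → Prop) : Prop :=
  ∃ t M', Runs P M t M' ∧ t ≤ T ∧ Q M'

theorem Wp.mono {P : Program} {T T' : ℕ} {M : Memory} {Q Q' : Memory → Prop}
    (h : Wp P T M Q) (hT : T ≤ T') (hQ : ∀ M', Q M' → Q' M') : Wp P T' M Q' := by
  obtain ⟨t, M', r, ht, hq⟩ := h
  exact ⟨t, M', r, ht.trans hT, hQ _ hq⟩

theorem Wp.seq {P P' : Program} {T T' : ℕ} {M : Memory} {Q : Memory → Prop}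
    (h : Wp P T M (fun M₁ => Wp P' T' M₁ Q)) : Wp (.seq P P') (T + T') M Q := by
  obtain ⟨t, M₁, r, ht, t', M₂, r', ht', hq⟩ := h
  exact ⟨t + t', M₂, .seq r r', by omega, hq⟩

theorem Wp.cond {b : Test} {P P' : Program} {T T' : ℕ} {M : Memory} {Q : Memory → Prop}
    (h : b.holds M → Wp P T M Q) (h' : ¬ b.holds M → Wp P' T' M Q) :
    Wp (.cond b P P') (max T T' + 1) M Q := by
  by_cases hb : b.holds M
  · obtain ⟨t, M₁, r, ht, hq⟩ := h hb
    exact ⟨t + 1, M₁, .condTrue hb r, by omega, hq⟩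
  · obtain ⟨t, M₁, r, ht, hq⟩ := h' hb
    exact ⟨t + 1, M₁, .condFalse hb r, by omega, hq⟩

/-- The weakest precondition of a program without loops. -/
def Program.wlp : Program → (Memory → Prop) → Memory → Prop
  | .skip, Q, M => Q M
  | .instr i, Q, M => Q (i.exec M)
  | .seq P P', Q, M => P.wlp (P'.wlp Q) M
  | .cond b P P', Q, M => (b.holds M → P.wlp Q M) ∧ (¬ b.holds M → P'.wlp Q M)
  -- Loops get an unsatisfiable precondition, so the value `0` of `Program.size` on loops does no
  -- harm in `Wp.of_wlp`.
  | .loop _ _, _, _ => False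

/-- A bound for the number of steps of a program without loops. -/
def Program.size : Program → ℕ
  | .skip => 0
  | .instr _ => 1
  | .seq P P' => P.size + P'.size
  | .cond _ P P' => max P.size P'.size + 1
  | .loop _ _ => 0

theorem Program.wlp_mono {P : Program} {Q Q' : Memory → Prop} {M : Memory}
    (h : P.wlp Q M) (hQ : ∀ M', Q M' → Q' M') : P.wlp Q' M := by
  induction P generalizing Q Q' M with
  | skip => exact hQ _ h
  | instr i => exact hQ _ h
  | seq P P' ih ih' => exact ih h fun _ h₁ => ih' h₁ hQ
  | cond b P P' ih ih' => exact ⟨fun hb => ih (h.1 hb) hQ, fun hb => ih' (h.2 hb) hQ⟩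
  | loop b P ih => exact h

theorem Wp.of_wlp {P : Program} {M : Memory} {Q : Memory → Prop} (h : P.wlp Q M) :
    Wp P P.size M Q := by
  induction P generalizing Q M with
  | skip => exact ⟨0, M, .skip M, le_rfl, h⟩
  | instr i => exact ⟨1, _, .instr i M, le_rfl, h⟩
  | seq P P' ih ih' => exact Wp.seq (ih (Program.wlp_mono h fun _ h₁ => ih' h₁))
  | cond b P P' ih ih' => exact Wp.cond (fun hb => ih (h.1 hb)) fun hb => ih' (h.2 hb)
  | loop b P ih => exact h.elim

/-- A loop-free program `P` followed by `P'`. -/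
theorem Wp.straight_seq {P P' : Program} {T' : ℕ} {M : Memory} {Q : Memory → Prop}
    (h : P.wlp (fun M₁ => Wp P' T' M₁ Q) M) : Wp (.seq P P') (P.size + T') M Q :=
  Wp.seq (Wp.of_wlp h)

/-- Counting up: the register `i` runs from `lo` to `hi`. -/
theorem Wp.loopUp {i h : ℕ} {P : Program} {T lo hi : ℕ} {M : Memory} {Q : Memory → Prop}
    (I : ℕ → Memory → Prop) (hle : lo ≤ hi) (h₀ : I lo M)
    (hreg : ∀ k M, I k M → M.reg i = k ∧ M.reg h = hi)
    (hstep : ∀ k M, lo ≤ k → k < hi → I k M → Wp P T M (I (k + 1)))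
    (hQ : ∀ M, I hi M → Q M) : Wp (.loop (.lt i h) P) ((hi - lo) * (T + 1) + 1) M Q := by
  obtain ⟨d, rfl⟩ := Nat.exists_eq_add_of_le hle
  rw [Nat.add_sub_cancel_left]
  induction d generalizing lo M with
  | zero =>
    refine ⟨1, M, .loopFalse ?_, by omega, hQ _ h₀⟩
    have := hreg _ _ h₀
    simp only [Test.holds]; omega
  | succ d ih =>
    obtain ⟨t, M₁, r, ht, h₁⟩ := hstep lo M le_rfl (by omega) h₀
    obtain ⟨t', M₂, r', ht', h₂⟩ := ih (lo := lo + 1) (M := M₁) (hle := by omega) (h₀ := h₁)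
      (hreg := fun k M hk => ⟨(hreg k M hk).1, by rw [(hreg k M hk).2]; omega⟩)
      (hstep := fun k M h1 h2 h3 => hstep k M (by omega) (by omega) h3)
      (hQ := fun M hM => hQ M (by rwa [show lo + (d + 1) = lo + 1 + d by omega]))
    refine ⟨t + t' + 1, M₂, .loopTrue ?_ r r', ?_, h₂⟩
    · have := hreg _ _ h₀
      simp only [Test.holds]; omega
    · rw [Nat.succ_mul]; omega

/-- Counting down: the register `i` runs from `hi` to `0`. -/
theorem Wp.loopDown {i z : ℕ} {P : Program} {T hi : ℕ} {M : Memory} {Q : Memory → Prop}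
    (I : ℕ → Memory → Prop) (h₀ : I hi M)
    (hreg : ∀ k M, I k M → M.reg i = k ∧ M.reg z = 0)
    (hstep : ∀ k M, k < hi → I (k + 1) M → Wp P T M (I k))
    (hQ : ∀ M, I 0 M → Q M) : Wp (.loop (.lt z i) P) (hi * (T + 1) + 1) M Q := by
  induction hi generalizing M with
  | zero =>
    refine ⟨1, M, .loopFalse ?_, by omega, hQ _ h₀⟩
    have := hreg _ _ h₀
    simp only [Test.holds]; omega
  | succ d ih =>
    obtain ⟨t, M₁, r, ht, h₁⟩ := hstep d M (by omega) h₀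
    obtain ⟨t', M₂, r', ht', h₂⟩ := ih (M := M₁) h₁ (fun k M h1 h2 => hstep k M (by omega) h2)
    refine ⟨t + t' + 1, M₂, .loopTrue ?_ r r', ?_, h₂⟩
    · have := hreg _ _ h₀
      simp only [Test.holds]; omega
    · rw [Nat.succ_mul]; omega

@[simp] theorem Memory.setReg_reg (M : Memory) (x k y : ℕ) :
    (M.setReg x k).reg y = if y = x then k else M.reg y := by
  simp [Memory.setReg, Function.update_apply]

@[simp] theorem Memory.setReg_arr (M : Memory) (x k : ℕ) : (M.setReg x k).arr = M.arr := rfl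

@[simp] theorem Memory.setArr_reg (M : Memory) (a i k : ℕ) : (M.setArr a i k).reg = M.reg := rfl

@[simp] theorem Memory.setArr_arr (M : Memory) (a i k b : ℕ) :
    (M.setArr a i k).arr b = if b = a then Function.update (M.arr a) i k else M.arr b := by
  simp [Memory.setArr, Function.update_apply]

/-- The programs of a list, one after the other. -/
def block : List Program → Program
  | [] => .skip
  | P :: l => .seq P (block l)

/-- The instructions of a list, one after the other. -/
def ins : List Instr → Program
  | [] => .skip
  | i :: l => .seq (.instr i) (ins l)

/-- The unfolding rules for programs without loops. -/
theorem wlp_skip (Q : Memory → Prop) (M : Memory) : Program.skip.wlp Q M = Q M := rfl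
theorem wlp_block_nil (Q : Memory → Prop) (M : Memory) : (block []).wlp Q M = Q M := rfl
theorem wlp_block_cons (P : Program) (l : List Program) (Q : Memory → Prop) (M : Memory) :
    (block (P :: l)).wlp Q M = P.wlp ((block l).wlp Q) M := rfl
theorem wlp_ins_nil (Q : Memory → Prop) (M : Memory) : (ins []).wlp Q M = Q M := rfl
theorem wlp_ins_cons (i : Instr) (l : List Instr) (Q : Memory → Prop) (M : Memory) :
    (ins (i :: l)).wlp Q M = (ins l).wlp Q (i.exec M) := rfl
theorem wlp_cond (b : Test) (P P' : Program) (Q : Memory → Prop) (M : Memory) :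
    (Program.cond b P P').wlp Q M = ((b.holds M → P.wlp Q M) ∧ (¬ b.holds M → P'.wlp Q M)) := rfl


/-! ### Preparation of the input -/

/-- Store the source of every entry of the adjacency lists in array `3`, and the number of entries
in register `1`. -/
def srcProg : Program := block [
  .loop (.lt 4 0) (block [
    ins [.succ 5 4, .load 6 0 5],
    .loop (.lt 1 6) (ins [.store 3 1 4, .succ 1 1]),
    ins [.succ 4 4]]),
  ins [.const 3 1]]

/-- The counter in register `1` runs through the consecutive blocks of the adjacency lists, so no
entry is overwritten later. The time bound charges a scan of the whole list to each vertex, which is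
crude but affordable. -/
theorem srcProg_spec {n : ℕ} {off nbr : ℕ → ℕ} (h0 : off 0 = 0)
    (hoff : ∀ v < n, off v ≤ off (v + 1)) :
    Wp srcProg (n * (off n * 3 + 5 + 1) + 2) (inputMemory n off nbr) (fun M =>
      M.reg 0 = n ∧ M.reg 1 = off n ∧ M.reg 2 = 0 ∧ M.reg 3 = 1 ∧ M.arr 1 = nbr ∧
      (∀ v < n, ∀ i, off v ≤ i → i < off (v + 1) → M.arr 3 i = v) ∧
      ∀ a, a ≠ 0 → a ≠ 1 → a ≠ 3 → M.arr a = fun _ => 0) := by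
  have hmono : ∀ v ≤ n, ∀ u ≤ v, off u ≤ off v := by
    intro v
    induction v with
    | zero => intro _ u hu; rw [Nat.le_zero.1 hu]
    | succ v ih =>
      intro hv u hu
      rcases Nat.lt_or_ge u (v + 1) with h | h
      · exact (ih (by omega) u (by omega)).trans (hoff v (by omega))
      · rw [le_antisymm hu h]
  refine Wp.mono (Wp.seq (T := n * (off n * 3 + 5 + 1) + 1) (T' := 1) ?_) (by omega)
    (fun _ h => h)
  refine Wp.mono (Wp.loopUp (lo := 0) (hi := n) (T := off n * 3 + 5) (fun v M =>
      M.reg 0 = n ∧ M.reg 1 = off v ∧ M.reg 2 = 0 ∧ M.reg 4 = v ∧ M.arr 0 = off ∧ M.arr 1 = nbr ∧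
      (∀ u < v, ∀ i, off u ≤ i → i < off (u + 1) → M.arr 3 i = u) ∧
      ∀ a, a ≠ 0 → a ≠ 1 → a ≠ 3 → M.arr a = fun _ => 0) (Nat.zero_le n) ?_ ?_ ?_
      (fun _ h => h)) (by simp) ?_
  · refine ⟨rfl, h0.symm, rfl, rfl, rfl, rfl, fun u hu => by omega, ?_⟩
    intro a h0 h1 _
    simp [inputMemory, h0, h1]
  · exact fun k M h => ⟨h.2.2.2.1, h.1⟩
  · rintro v M - hv ⟨g0, g1, g2, g4, ga0, ga1, ga3, gz⟩
    have hv1 := hmono n le_rfl (v + 1) hv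
    refine Wp.mono (Wp.straight_seq (T' := (off (v + 1) - off v) * 3 + 2) ?_)
      (show 2 + ((off (v + 1) - off v) * 3 + 2) ≤ _ by omega) (fun _ h => h)
    simp only [wlp_ins_cons, wlp_ins_nil, Instr.exec]
    refine Wp.mono (Wp.seq (T := (off (v + 1) - off v) * (2 + 1) + 1) (T' := 1) ?_)
      (by omega) (fun _ h => h)
    refine Wp.loopUp (fun i M =>
      M.reg 0 = n ∧ M.reg 1 = i ∧ M.reg 2 = 0 ∧ M.reg 4 = v ∧ M.reg 6 = off (v + 1) ∧
      M.arr 0 = off ∧ M.arr 1 = nbr ∧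
      (∀ u < v, ∀ i, off u ≤ i → i < off (u + 1) → M.arr 3 i = u) ∧
      (∀ j, off v ≤ j → j < i → M.arr 3 j = v) ∧
      ∀ a, a ≠ 0 → a ≠ 1 → a ≠ 3 → M.arr a = fun _ => 0) (hoff v hv) ?_ ?_ ?_ ?_
    · refine ⟨by simpa, by simpa, by simpa, by simpa, by simp [ga0, g4], ga0, ga1, ga3,
        fun j => by omega, gz⟩
    · exact fun k M h => ⟨h.2.1, h.2.2.2.2.1⟩
    · rintro i M hi hi' ⟨g0, g1, g2, g4, g6, ga0, ga1, ga3, ga3', gz⟩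
      refine Wp.mono (Wp.of_wlp ?_) le_rfl (fun _ h => h)
      simp only [wlp_ins_cons, wlp_ins_nil, Instr.exec]
      refine ⟨by simpa, by simpa, by simpa, by simpa, by simpa, by simpa, by simpa, ?_, ?_, ?_⟩
      · intro u hu j h1 h2
        have := hmono v hv.le (u + 1) hu
        simp [g1, g4, show j ≠ i by omega, ga3 u hu j h1 h2]
      · intro j h1 h2
        by_cases hj : j = i
        · simp [g1, g4, hj]
        · simp [g1, hj, ga3' j h1 (by omega)]
      · intro a h0 h1 h3
        simp [h3, gz a h0 h1 h3]
    · rintro M ⟨g0, g1, g2, g4, g6, ga0, ga1, ga3, ga3', gz⟩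
      refine Wp.mono (Wp.of_wlp ?_) le_rfl (fun _ h => h)
      simp only [wlp_block_cons, wlp_block_nil, wlp_ins_cons, wlp_ins_nil, Instr.exec]
      refine ⟨by simpa, by simpa, by simpa, by simpa, by simpa, by simpa, ?_, ?_⟩
      · intro u hu j h1 h2
        rcases Nat.lt_or_ge u v with h | h
        · simp [ga3 u h j h1 h2]
        · obtain rfl : u = v := by omega
          simp [ga3' j h1 h2]
      · intro a h0 h1 h3
        simp [gz a h0 h1 h3]
  · rintro M ⟨g0, g1, g2, g4, ga0, ga1, ga3, gz⟩
    refine Wp.mono (Wp.of_wlp ?_) le_rfl (fun _ h => h)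
    simp only [wlp_block_cons, wlp_block_nil, wlp_ins_cons, wlp_ins_nil, Instr.exec]
    exact ⟨by simpa, by simpa, by simpa, by simp, by simpa, ga3, gz⟩


/-! ### Depth-first search -/

/-- A connected simple graph with the vertices `0, …, n - 1`. -/
structure IsConn (n : ℕ) (adj : ℕ → ℕ → Prop) : Prop where
  pos : 0 < n
  lt : ∀ {u v}, adj u v → u < n
  symm : ∀ {u v}, adj u v → adj v u
  irrefl : ∀ u, ¬ adj u u
  conn : ∀ S : ℕ → Prop, S 0 → (∀ u v, adj u v → S u → S v) → ∀ v < n, S v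

/-- The pairs `(src i, nbr i)` with `i < N` are the ordered pairs of adjacent vertices. -/
structure IsDarts (adj : ℕ → ℕ → Prop) (N : ℕ) (src nbr : ℕ → ℕ) : Prop where
  adj_of : ∀ i < N, adj (src i) (nbr i)
  surj : ∀ {u v}, adj u v → ∃ i < N, src i = u ∧ nbr i = v
  inj : ∀ i < N, ∀ j < N, src i = src j → nbr i = nbr j → i = j

/-- `x` is an ancestor of `y` (or equal to `y`). -/
def Anc (par : ℕ → ℕ) (x y : ℕ) : Prop := ∃ j, par^[j] y = x

theorem Anc.refl (par : ℕ → ℕ) (x : ℕ) : Anc par x x := ⟨0, rfl⟩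

theorem Anc.of_par {par : ℕ → ℕ} {x y : ℕ} (h : Anc par x (par y)) : Anc par x y := by
  obtain ⟨j, hj⟩ := h
  exact ⟨j + 1, hj⟩

theorem Anc.eq_or_par {par : ℕ → ℕ} {x y : ℕ} (h : Anc par x y) : x = y ∨ Anc par x (par y) := by
  obtain ⟨_ | j, hj⟩ := h
  · exact .inl hj.symm
  · exact .inr ⟨j, hj⟩

theorem Anc.trans {par : ℕ → ℕ} {x y z : ℕ} (h : Anc par x y) (h' : Anc par y z) :
    Anc par x z := by
  obtain ⟨j, rfl⟩ := h
  obtain ⟨k, rfl⟩ := h'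
  exact ⟨j + k, by rw [Function.iterate_add_apply]⟩

/-- The ancestors of a vertex form a chain because `par` is a function: the one reached in fewer
steps lies below the other. -/
theorem Anc.total {par : ℕ → ℕ} {x y z : ℕ} (h : Anc par x z) (h' : Anc par y z) :
    Anc par x y ∨ Anc par y x := by
  obtain ⟨j, rfl⟩ := h
  obtain ⟨k, rfl⟩ := h'
  rcases le_total j k with hjk | hjk
  · right
    exact ⟨k - j, by rw [← Function.iterate_add_apply, Nat.sub_add_cancel hjk]⟩
  · left
    exact ⟨j - k, by rw [← Function.iterate_add_apply, Nat.sub_add_cancel hjk]⟩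

/-- A depth-first search from `0` has discovered `c` vertices: `num v` is the number of `v` in the
order of discovery (`0` if `v` has not been discovered), `Q` is inverse to `num`, `par` is the
parent in the search tree, and `col` is the parity of the depth. -/
structure IsSearch (n : ℕ) (adj : ℕ → ℕ → Prop) (c : ℕ) (par num Q col : ℕ → ℕ) : Prop where
  num_zero : num 0 = 1
  par_zero : par 0 = 0
  card : ((Finset.range n).filter (fun v => num v ≠ 0)).card = c
  num_le : ∀ v < n, num v ≤ c
  Q_spec : ∀ k, 1 ≤ k → k ≤ c → Q k < n ∧ num (Q k) = k
  Q_num : ∀ v < n, num v ≠ 0 → Q (num v) = v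
  tree : ∀ v < n, v ≠ 0 → num v ≠ 0 → adj (par v) v ∧ num (par v) ≠ 0 ∧ num (par v) < num v ∧
    col v = 1 - col (par v)
  col_le : ∀ v, col v ≤ 1
  -- There are no cross edges: adjacent discovered vertices are comparable in the tree.
  anc : ∀ x y, adj x y → num x ≠ 0 → num x < num y → Anc par x y
  -- A vertex that still has an undiscovered neighbour lies on the current search path, so
  -- everything discovered after it lies below it. This is what preserves `anc`.
  active : ∀ y w z, adj y w → num y ≠ 0 → num w = 0 → z < n → num y ≤ num z → Anc par y z

theorem IsSearch.init {n : ℕ} {adj : ℕ → ℕ → Prop} (hG : IsConn n adj) :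
    IsSearch n adj 1 (fun _ => 0) (Function.update (fun _ => 0) 0 1)
      (Function.update (fun _ => 0) 1 0) (fun _ => 0) := by
  have key : ∀ v, Function.update (fun _ => 0) 0 1 v ≠ 0 → v = 0 := by
    intro v hv
    by_contra h
    simp [h] at hv
  have le : ∀ v, Function.update (fun _ => 0) 0 1 v ≤ 1 := by
    intro v
    rw [Function.update_apply]
    split_ifs <;> omega
  refine ⟨by simp, rfl, ?_, fun v _ => le v, ?_, ?_, ?_, by simp, ?_, ?_⟩
  · rw [Finset.card_eq_one]
    refine ⟨0, Finset.ext fun v => ?_⟩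
    simp only [Finset.mem_filter, Finset.mem_range, Finset.mem_singleton]
    exact ⟨fun h => key v h.2, by rintro rfl; exact ⟨hG.pos, by simp⟩⟩
  · intro k h1 h2
    obtain rfl : k = 1 := by omega
    simpa using hG.pos
  · intro v _ hv
    simp [key v hv]
  · intro v _ h0 hv
    exact absurd (key v hv) h0
  · intro x y _ hx hxy
    have := le y
    have := Nat.pos_of_ne_zero hx
    omega
  · intro y w z _ hy _ _ hyz
    have h1 := key y hy
    have h2 := key z (by omega)
    rw [h1, h2]
    exact .refl _ _

/-- Extending the tree at the last discovered vertex `v` that has an undiscovered neighbour is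
exactly depth-first search. Every other vertex with an undiscovered neighbour was discovered before
`v`, hence is an ancestor of `v` by `active`, and so becomes an ancestor of the new vertex `w`. -/
theorem IsSearch.step {n : ℕ} {adj : ℕ → ℕ → Prop} {c : ℕ} {par num Q col : ℕ → ℕ} {v w : ℕ}
    (hG : IsConn n adj) (h : IsSearch n adj c par num Q col) (hvw : adj v w) (hv : num v ≠ 0)
    (hw : num w = 0) (hmax : ∀ x y, adj x y → num y = 0 → num x ≤ num v) :
    IsSearch n adj (c + 1) (Function.update par w v) (Function.update num w (c + 1))
      (Function.update Q (c + 1) w) (Function.update col w (1 - col v)) := by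
  have hvn := hG.lt hvw
  have hwn := hG.lt (hG.symm hvw)
  have hw0 : w ≠ 0 := by rintro rfl; rw [h.num_zero] at hw; omega
  have ne_w : ∀ {x}, num x ≠ 0 → x ≠ w := by rintro x hx rfl; exact hx hw
  have par_vis : ∀ x < n, num x ≠ 0 → par x < n ∧ num (par x) ≠ 0 := by
    intro x hx hx'
    by_cases h0 : x = 0
    · subst h0; rw [h.par_zero]; exact ⟨hx, hx'⟩
    · obtain ⟨h1, h2, -⟩ := h.tree x hx h0 hx'
      exact ⟨hG.lt h1, h2⟩
  -- Only the parent of the undiscovered vertex `w` changes, so the ancestor chains of discovered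
  -- vertices stay the same.
  have iter : ∀ j z, z < n → num z ≠ 0 → (Function.update par w v)^[j] z = par^[j] z := by
    intro j
    induction j with
    | zero => intro z _ _; rfl
    | succ j ih =>
      intro z hz hz'
      rw [Function.iterate_succ_apply, Function.iterate_succ_apply,
        Function.update_of_ne (ne_w hz')]
      exact ih _ (par_vis z hz hz').1 (par_vis z hz hz').2
  have anc' : ∀ x z, z < n → num z ≠ 0 → Anc par x z → Anc (Function.update par w v) x z := by
    rintro x z hz hz' ⟨j, hj⟩
    exact ⟨j, by rw [iter j z hz hz', hj]⟩
  have anc_w : ∀ x, Anc par x v → Anc (Function.update par w v) x w := by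
    intro x hx
    apply Anc.of_par
    rw [Function.update_self]
    exact anc' x v hvn hv hx
  refine ⟨?_, ?_, ?_, ?_, ?_, ?_, ?_, ?_, ?_, ?_⟩
  · rw [Function.update_of_ne hw0.symm, h.num_zero]
  · rw [Function.update_of_ne hw0.symm, h.par_zero]
  · have : (Finset.range n).filter (fun x => Function.update num w (c + 1) x ≠ 0) =
        insert w ((Finset.range n).filter (fun x => num x ≠ 0)) := by
      ext x
      simp only [Finset.mem_filter, Finset.mem_range, Finset.mem_insert, Function.update_apply]
      split_ifs with hx
      · simp [hx, hwn]
      · simp [hx]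
    rw [this, Finset.card_insert_of_notMem (by simp [hw]), h.card]
  · intro x hx
    rw [Function.update_apply]
    split_ifs
    · exact le_rfl
    · have := h.num_le x hx; omega
  · intro k h1 h2
    rcases Nat.lt_or_ge c k with hk | hk
    · obtain rfl : k = c + 1 := by omega
      simpa using hwn
    · rw [Function.update_of_ne (show k ≠ c + 1 by omega)]
      obtain ⟨h3, h4⟩ := h.Q_spec k h1 hk
      exact ⟨h3, by rw [Function.update_of_ne (ne_w (by omega)), h4]⟩
  · intro x hx hx'
    by_cases hxw : x = w
    · subst hxw; simp
    · rw [Function.update_of_ne hxw] at hx' ⊢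
      have := h.num_le x hx
      rw [Function.update_of_ne (show num x ≠ c + 1 by omega), h.Q_num x hx hx']
  · intro x hx h0 hx'
    by_cases hxw : x = w
    · subst hxw
      have := h.num_le v hvn
      simp only [Function.update_self, Function.update_of_ne (ne_w hv)]
      exact ⟨hvw, hv, by omega, trivial⟩
    · rw [Function.update_of_ne hxw] at hx'
      obtain ⟨h1, h2, h3, h4⟩ := h.tree x hx h0 hx'
      simp only [Function.update_of_ne hxw, Function.update_of_ne (ne_w h2)]
      exact ⟨h1, h2, h3, h4⟩
  · intro x
    rw [Function.update_apply]
    split_ifs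
    · omega
    · exact h.col_le x
  · intro x y hxy hx hlt
    have hxn := hG.lt hxy
    have hyn := hG.lt (hG.symm hxy)
    by_cases hyw : y = w
    · subst hyw
      have hxy' : x ≠ y := by rintro rfl; exact hG.irrefl _ hxy
      rw [Function.update_of_ne hxy'] at hx
      exact anc_w x (h.active x y v hxy hx hw hvn (hmax x y hxy hw))
    · by_cases hxw : x = w
      · subst hxw
        rw [Function.update_self, Function.update_of_ne hyw] at hlt
        have := h.num_le y hyn
        omega
      · rw [Function.update_of_ne hxw] at hx hlt
        rw [Function.update_of_ne hyw] at hlt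
        exact anc' x y hyn (by omega) (h.anc x y hxy hx hlt)
  · intro y u z hyu hy hu hz hyz
    have hyn := hG.lt hyu
    have huw : u ≠ w := by rintro rfl; simp at hu
    rw [Function.update_of_ne huw] at hu
    by_cases hyw : y = w
    · subst hyw
      rw [Function.update_self] at hyz
      by_cases hzy : z = y
      · rw [hzy]; exact .refl _ _
      · rw [Function.update_of_ne hzy] at hyz
        have := h.num_le z hz
        omega
    · rw [Function.update_of_ne hyw] at hy hyz
      by_cases hzw : z = w
      · subst hzw
        exact anc_w y (h.active y u v hyu hy hu hvn (hmax y u hyu hu))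
      · rw [Function.update_of_ne hzw] at hyz
        exact anc' y z hz (by omega) (h.active y u z hyu hy hu hz hyz)

theorem IsSearch.exists_adj {n : ℕ} {adj : ℕ → ℕ → Prop} {c : ℕ} {par num Q col : ℕ → ℕ}
    (hG : IsConn n adj) (h : IsSearch n adj c par num Q col) (hc : c < n) :
    ∃ v w, adj v w ∧ num v ≠ 0 ∧ num w = 0 := by
  by_contra! hcon
  have all := hG.conn (fun v => num v ≠ 0) (by simp [h.num_zero])
    (fun u v huv hu => hcon u v huv hu)
  have := h.card
  rw [Finset.filter_true_of_mem (fun v hv => all v (Finset.mem_range.1 hv)),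
    Finset.card_range] at this
  omega

theorem IsSearch.num_ne_zero {n : ℕ} {adj : ℕ → ℕ → Prop} {par num Q col : ℕ → ℕ}
    (h : IsSearch n adj n par num Q col) {v : ℕ} (hv : v < n) : num v ≠ 0 := by
  have := Finset.filter_card_eq (s := Finset.range n) (p := fun v => num v ≠ 0)
    (by rw [h.card, Finset.card_range])
  exact this v (Finset.mem_range.2 hv)

/-- Depth-first search from the vertex `0`: arrays `4`, `5`, `6`, `2` receive the parents, the
numbers, the list of vertices in the order of discovery, and the parities of the depths. -/
def searchProg : Program := block [
  ins [.store 5 2 3, .store 6 3 2, .copy 7 3],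
  .loop (.lt 7 0) (block [
    ins [.const 8 0, .const 4 0],
    .loop (.lt 4 1) (block [
      ins [.load 5 3 4, .load 6 1 4, .load 11 5 5, .load 12 5 6],
      .cond (.eq 12 2) (.cond (.lt 8 11) (ins [.copy 8 11, .copy 9 5, .copy 10 6]) .skip) .skip,
      ins [.succ 4 4]]),
    ins [.succ 7 7, .store 5 10 7, .store 6 7 10, .store 4 10 9, .load 11 2 9],
    .cond (.eq 11 2) (ins [.store 2 10 3]) (ins [.store 2 10 2])])]

/-- The registers and arrays that are constant after the preparation of the input. -/
structure Input (n N : ℕ) (src nbr : ℕ → ℕ) (M : Memory) : Prop where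
  r0 : M.reg 0 = n
  r1 : M.reg 1 = N
  r2 : M.reg 2 = 0
  r3 : M.reg 3 = 1
  a1 : M.arr 1 = nbr
  a3 : M.arr 3 = src

/-- No stack is needed: each round scans all darts for one from a discovered to an undiscovered
vertex whose source has the largest number. Register `8` holds that number, with `0` for "none so
far", and registers `9` and `10` hold the dart. -/
theorem searchProg_spec {n N : ℕ} {adj : ℕ → ℕ → Prop} {src nbr : ℕ → ℕ} (hG : IsConn n adj)
    (hD : IsDarts adj N src nbr) {M : Memory} (hM : Input n N src nbr M)
    (hz : ∀ a, a ≠ 0 → a ≠ 1 → a ≠ 3 → M.arr a = fun _ => 0) :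
    Wp searchProg ((n - 1) * (N * 11 + 10 + 1) + 4) M (fun M => Input n N src nbr M ∧
      IsSearch n adj n (M.arr 4) (M.arr 5) (M.arr 6) (M.arr 2) ∧ M.arr 7 = (fun _ => 0) ∧
      M.arr 8 = (fun _ => 0) ∧ M.arr 9 = fun _ => 0) := by
  refine Wp.mono (Wp.straight_seq (T' := (n - 1) * (N * 11 + 10 + 1) + 1) ?_)
    (by simp only [Program.size, ins]; omega) (fun _ h => h)
  simp only [wlp_ins_cons, wlp_ins_nil, Instr.exec]
  refine Wp.mono (Wp.seq (T' := 0) (Wp.loopUp (lo := 1) (hi := n) (T := N * 11 + 10) (fun c M =>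
      Input n N src nbr M ∧ M.reg 7 = c ∧
      IsSearch n adj c (M.arr 4) (M.arr 5) (M.arr 6) (M.arr 2) ∧ M.arr 7 = (fun _ => 0) ∧
      M.arr 8 = (fun _ => 0) ∧ M.arr 9 = fun _ => 0) hG.pos ?_ ?_ ?_
      ?_)) (by omega) (fun _ h => h)
  · obtain ⟨g0, g1, g2, g3, ga1, ga3⟩ := hM
    refine ⟨⟨by simpa, by simpa, by simpa, by simpa, by simpa, by simpa⟩, by simpa, ?_,
      by simp [hz],
      by simp [hz], by simp [hz]⟩
    simpa [hz, g2, g3] using IsSearch.init hG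
  · exact fun k M h => ⟨h.2.1, h.1.r0⟩
  · rintro c M hc1 hcn ⟨⟨g0, g1, g2, g3, ga1, ga3⟩, g7, hS, z7, z8, z9⟩
    refine Wp.mono (Wp.straight_seq (T' := N * 11 + 8) ?_)
      (by simp only [Program.size, ins]; omega) (fun _ h => h)
    simp only [wlp_ins_cons, wlp_ins_nil, Instr.exec]
    generalize hp : M.arr 4 = par at hS
    generalize hnum : M.arr 5 = num at hS
    generalize hQ : M.arr 6 = Q at hS
    generalize hcol : M.arr 2 = col at hS
    refine Wp.mono (Wp.seq (T := (N - 0) * (10 + 1) + 1) (T' := 7)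
      (Wp.loopUp (lo := 0) (hi := N) (fun i M =>
        Input n N src nbr M ∧ M.reg 7 = c ∧ M.reg 4 = i ∧ M.arr 4 = par ∧ M.arr 5 = num ∧
        M.arr 6 = Q ∧ M.arr 2 = col ∧ M.arr 7 = (fun _ => 0) ∧
        M.arr 8 = (fun _ => 0) ∧ M.arr 9 = (fun _ => 0) ∧
        (∀ j < i, num (nbr j) = 0 → num (src j) ≤ M.reg 8) ∧
        (M.reg 8 = 0 ∨ ∃ j < i, src j = M.reg 9 ∧ nbr j = M.reg 10 ∧ num (M.reg 10) = 0 ∧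
          num (M.reg 9) = M.reg 8)) (Nat.zero_le N) ?_ ?_ ?_ ?_))
      (by omega) (fun _ h => h)
    · refine ⟨⟨by simpa, by simpa, by simpa, by simpa, by simpa, by simpa⟩, by simpa, by simp,
        by simpa, by simpa, by simpa, by simpa, by simpa, by simpa, by simpa, by simp, by simp⟩
    · exact fun k M h => ⟨h.2.2.1, h.1.r1⟩
    · rintro i M - hi ⟨⟨g0, g1, g2, g3, ga1, ga3⟩, g7, g4, hp, hnum, hQ, hcol, z7, z8, z9, hb, hb'⟩
      refine Wp.mono (Wp.of_wlp ?_) (by simp [Program.size, ins, block]) (fun _ h => h)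
      simp only [wlp_block_cons, wlp_block_nil, wlp_ins_cons, wlp_ins_nil, wlp_cond, wlp_skip,
        Instr.exec, Test.holds, Memory.setReg_reg, Memory.setReg_arr]
      simp only [Nat.reduceEqDiff, if_true, if_false, g2, g4, ga1, ga3, hnum]
      refine ⟨fun h1 => ⟨fun h2 => ?_, fun h2 => ?_⟩, fun h1 => ?_⟩
      · refine ⟨⟨by simpa, by simpa, by simpa, by simpa, by simpa, by simpa⟩, by simpa, by simp,
          by simpa, by simp, by simpa, by simpa, by simpa, by simpa, by simpa, ?_, ?_⟩
        · intro j hj hj'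
          rcases Nat.lt_succ_iff_lt_or_eq.1 hj with hji | rfl
          · simpa using (hb j hji hj').trans h2.le
          · simp
        · right
          exact ⟨i, by omega, by simp, by simp, by simpa, by simp⟩
      · refine ⟨⟨by simpa, by simpa, by simpa, by simpa, by simpa, by simpa⟩, by simpa, by simp,
          by simpa, by simp, by simpa, by simpa, by simpa, by simpa, by simpa, ?_, ?_⟩
        · intro j hj hj'
          rcases Nat.lt_succ_iff_lt_or_eq.1 hj with hji | rfl
          · simpa using hb j hji hj'
          · simpa using h2
        · rcases hb' with hb' | ⟨j, hj, hj'⟩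
          · exact .inl hb'
          · exact .inr ⟨j, by omega, hj'⟩
      · refine ⟨⟨by simpa, by simpa, by simpa, by simpa, by simpa, by simpa⟩, by simpa, by simp,
          by simpa, by simp, by simpa, by simpa, by simpa, by simpa, by simpa, ?_, ?_⟩
        · intro j hj hj'
          rcases Nat.lt_succ_iff_lt_or_eq.1 hj with hji | rfl
          · simpa using hb j hji hj'
          · exact absurd hj' h1
        · rcases hb' with hb' | ⟨j, hj, hj'⟩
          · exact .inl hb'
          · exact .inr ⟨j, by omega, hj'⟩
    · rintro M ⟨⟨g0, g1, g2, g3, ga1, ga3⟩, g7, g4, hp, hnum, hQ, hcol, z7, z8, z9, hb, hb'⟩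
      have hmax : ∀ x y, adj x y → num y = 0 → num x ≤ M.reg 8 := by
        intro x y hxy hy
        obtain ⟨i, hi, rfl, rfl⟩ := hD.surj hxy
        exact hb i hi hy
      obtain ⟨x, y, hxy, hx, hy⟩ := hS.exists_adj hG hcn
      -- By connectivity a suitable dart exists, so the scan did not come back empty.
      have h8 : M.reg 8 ≠ 0 := by
        have := hmax x y hxy hy
        omega
      obtain ⟨j, hj, hj1, hj2, hj3, hj4⟩ := hb'.resolve_left h8
      have hvw := hD.adj_of j hj
      rw [hj1, hj2] at hvw
      have hS' := hS.step hG hvw (by omega) hj3 (by simpa only [hj4] using hmax)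
      refine Wp.mono (Wp.of_wlp ?_) (by simp [Program.size, ins, block]) (fun _ h => h)
      simp only [wlp_block_cons, wlp_block_nil, wlp_ins_cons, wlp_ins_nil, wlp_cond,
        Instr.exec, Test.holds]
      have hne : M.reg 10 ≠ M.reg 9 := by
        intro h; rw [h] at hvw; exact hG.irrefl _ hvw
      refine ⟨fun h1 => ?_, fun h1 => ?_⟩
      · have : col (M.reg 9) = 0 := by simpa [g2, hcol] using h1
        rw [this] at hS'
        refine ⟨⟨by simpa, by simpa, by simpa, by simpa, by simpa, by simpa⟩, by simp [g7], ?_,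
          by simpa, by simpa, by simpa⟩
        simpa [g7, hp, hnum, hQ, hcol, g3] using hS'
      · have : col (M.reg 9) = 1 := by
          have := hS.col_le (M.reg 9)
          have : col (M.reg 9) ≠ 0 := by simpa [g2, hcol] using h1
          omega
        rw [this] at hS'
        refine ⟨⟨by simpa, by simpa, by simpa, by simpa, by simpa, by simpa⟩, by simp [g7], ?_,
          by simpa, by simpa, by simpa⟩
        simpa [g7, hp, hnum, hQ, hcol, g2] using hS'
  · rintro M ⟨hM, -, h⟩
    exact Wp.of_wlp (P := .skip) (show _ ∧ _ from ⟨hM, h⟩)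


/-! ### Decomposition of the tree into bipartite pieces -/

theorem IsSearch.par_lt {n c : ℕ} {adj : ℕ → ℕ → Prop} {par num Q col : ℕ → ℕ}
    (hG : IsConn n adj) (h : IsSearch n adj c par num Q col) {v : ℕ} (hv : v < n)
    (hv' : num v ≠ 0) : par v < n ∧ num (par v) ≤ num v := by
  by_cases h0 : v = 0
  · subst h0; rw [h.par_zero]; exact ⟨hv, le_rfl⟩
  · obtain ⟨h1, -, h2, -⟩ := h.tree v hv h0 hv'
    exact ⟨hG.lt h1, h2.le⟩

theorem IsSearch.anc_le {n : ℕ} {adj : ℕ → ℕ → Prop} {par num Q col : ℕ → ℕ}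
    (hG : IsConn n adj) (h : IsSearch n adj n par num Q col) {x y : ℕ} (hy : y < n)
    (hxy : Anc par x y) : x < n ∧ num x ≤ num y := by
  obtain ⟨j, rfl⟩ := hxy
  induction j generalizing y with
  | zero => exact ⟨hy, le_rfl⟩
  | succ j ih =>
    obtain ⟨h1, h2⟩ := h.par_lt hG hy (h.num_ne_zero hy)
    exact ⟨(ih h1).1, (ih h1).2.trans h2⟩

theorem IsSearch.num_inj {n c : ℕ} {adj : ℕ → ℕ → Prop} {par num Q col : ℕ → ℕ}
    (h : IsSearch n adj c par num Q col) {x y : ℕ} (hx : x < n) (hy : y < n) (hx' : num x ≠ 0)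
    (hxy : num x = num y) : x = y := by
  rw [← h.Q_num x hx hx', ← h.Q_num y hy (by omega), hxy]

/-- The search tree has been decomposed, down to the vertices with numbers larger than `k`, into
connected pieces that are bipartite by `col`: the piece of `v` is named by its vertex `lab v` that
is closest to the root, and `cut t = 1` means that the piece of `t` has been completed, since
together with the parent of `t` it contains an odd cycle. -/
structure IsPieces (n : ℕ) (adj : ℕ → ℕ → Prop) (k : ℕ) (par num col lab cut : ℕ → ℕ) :
    Prop where
  lab_of_le : ∀ v < n, num v ≤ k → lab v = v ∧ cut v = 0
  lab_lt : ∀ v < n, lab v < n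
  lab_lab : ∀ v < n, lab (lab v) = lab v
  num_lab : ∀ v < n, k < num v → k < num (lab v)
  anc : ∀ v < n, Anc par (lab v) v
  lab_par : ∀ v < n, lab v ≠ v → lab (par v) = lab v
  -- A top that is not yet completed waits below a vertex still to be processed. For `k = 0` no such
  -- vertex is left, so every top other than `0` has been completed.
  num_par : ∀ v < n, v ≠ 0 → k < num v → lab v = v → cut v = 0 → num (par v) ≤ k
  cut_le : ∀ v, cut v ≤ 1
  -- The tree path from `w` through the piece to `par v` has even length, and the edge from `par v`
  -- to `w` closes it to an odd cycle.
  odd : ∀ v < n, cut v = 1 → lab v = v ∧ v ≠ 0 ∧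
    ∃ w, lab w = v ∧ adj (par v) w ∧ col w = col (par v)
  col_ne : ∀ v w, adj v w → lab v = lab w → col v ≠ col w

theorem IsPieces.init {n : ℕ} {adj : ℕ → ℕ → Prop} {par num Q col lab : ℕ → ℕ}
    (hG : IsConn n adj) (h : IsSearch n adj n par num Q col) (hlab : ∀ v < n, lab v = v) :
    IsPieces n adj n par num col lab (fun _ => 0) := by
  refine ⟨fun v hv _ => ⟨hlab v hv, rfl⟩, fun v hv => by rwa [hlab v hv],
    fun v hv => by rw [hlab v hv, hlab v hv], ?_, ?_, ?_, ?_, by simp, by simp, ?_⟩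
  · intro v hv hv'
    have := h.num_le v hv
    omega
  · intro v hv
    rw [hlab v hv]; exact .refl _ _
  · intro v hv hv'
    exact absurd (hlab v hv) hv'
  · intro v hv _ hv'
    have := h.num_le v hv
    omega
  · intro v w hvw hl
    rw [hlab v (hG.lt hvw), hlab w (hG.lt (hG.symm hvw))] at hl
    subst hl
    exact absurd hvw (hG.irrefl v)

/-- Processing `u` completes the pieces hanging at `u` that contain a neighbour of `u` of the same
parity, and joins the others to `u`. The joined piece is properly coloured: edges at `u` passed the
test, and different pieces hanging at `u` are not adjacent because there are no cross edges. -/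
theorem IsPieces.step {n k u : ℕ} {adj : ℕ → ℕ → Prop} {par num Q col lab cut lab' cut' : ℕ → ℕ}
    (hG : IsConn n adj) (hS : IsSearch n adj n par num Q col)
    (h : IsPieces n adj (k + 1) par num col lab cut) (hu : u < n) (hk : num u = k + 1)
    (hcut : ∀ x, (cut' x = 1 ↔ cut x = 1 ∨
      ∃ w, adj u w ∧ num u < num w ∧ col w = col u ∧ lab w = x) ∧ cut' x ≤ 1)
    (hlab : ∀ v < n, lab' v = if cut' (lab v) = 0 ∧ par (lab v) = u then u else lab v) :
    IsPieces n adj k par num col lab' cut' := by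
  have hne := fun v hv => hS.num_ne_zero (v := v) hv
  have par_lt : ∀ v < n, par v < n := fun v hv => (hS.par_lt hG hv (hne v hv)).1
  have cut_zero : ∀ x, cut' x = 0 → cut x = 0 := by
    intro x hx
    have := h.cut_le x
    by_contra hc
    have := (hcut x).1.2 (.inl (by omega))
    omega
  have lab_u : lab u = u := (h.lab_of_le u hu hk.le).1
  have lab_u' : lab' u = u := by rw [hlab u hu, lab_u]; simp
  have par_ne : ∀ v < n, num v ≤ k → par v ≠ u := by
    rintro v hv hv' rfl
    have := (hS.par_lt hG hv (hne v hv)).2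
    omega
  -- Both `u` and the top of `w` are ancestors of `w`, and the top has the larger number, so its
  -- parent is `u` or lies below `u`. If the piece is not completed, `num_par` leaves only `u`.
  have key : ∀ w, adj u w → num u < num w → cut (lab w) = 1 ∨ par (lab w) = u := by
    intro w huw hlt
    have hw := hG.lt (hG.symm huw)
    have h1 := hS.anc u w huw (hne u hu) hlt
    have h2 := h.anc w hw
    have h3 := h.num_lab w hw (by omega)
    have hl := h.lab_lt w hw
    rcases h1.total h2 with h4 | h4
    · rcases h4.eq_or_par with h5 | h5
      · rw [← h5] at h3; omega
      · have h6 := (hS.anc_le hG (par_lt _ hl) h5).2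
        by_contra! hc
        have h7 := h.cut_le (lab w)
        have h0 : lab w ≠ 0 := by
          intro h0
          rw [h0, hS.num_zero] at h3; omega
        have h8 := h.num_par _ hl h0 h3 (h.lab_lab w hw) (by omega)
        exact hc.2 (hS.num_inj (par_lt _ hl) hu (hne _ (par_lt _ hl)) (by omega))
    · have := (hS.anc_le hG hu h4).2
      omega
  have merged : ∀ v < n, v ≠ u → lab' v = u → cut' (lab v) = 0 ∧ par (lab v) = u ∧
      k + 1 < num v := by
    intro v hv hvu hl
    rw [hlab v hv] at hl
    split_ifs at hl with hc
    · refine ⟨hc.1, hc.2, ?_⟩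
      by_contra hlt
      rcases Nat.lt_or_ge (num v) (k + 1) with h1 | h1
      · rw [(h.lab_of_le v hv (by omega)).1] at hc
        exact par_ne v hv (by omega) hc.2
      · exact hvu (hS.num_inj hv hu (hne v hv) (by omega))
    · exfalso
      by_cases hlt : k + 1 < num v
      · have := h.num_lab v hv hlt
        rw [hl] at this; omega
      · rw [(h.lab_of_le v hv (by omega)).1] at hl
        exact hvu hl
  refine ⟨?_, ?_, ?_, ?_, ?_, ?_, ?_, fun v => (hcut v).2, ?_, ?_⟩
  · intro v hv hvk
    obtain ⟨h1, h2⟩ := h.lab_of_le v hv (by omega)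
    constructor
    · rw [hlab v hv, h1, if_neg]
      exact fun hc => par_ne v hv hvk hc.2
    · have := (hcut v).2
      by_contra hc
      rcases (hcut v).1.1 (by omega) with h3 | ⟨w, h3, h4, -, h5⟩
      · omega
      · have := h.num_lab w (hG.lt (hG.symm h3)) (by omega)
        rw [h5] at this; omega
  · intro v hv
    rw [hlab v hv]
    split_ifs
    · exact hu
    · exact h.lab_lt v hv
  · intro v hv
    rw [hlab v hv]
    split_ifs with hc
    · exact lab_u'
    · rw [hlab _ (h.lab_lt v hv), h.lab_lab v hv, if_neg hc]
  · intro v hv hvk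
    rw [hlab v hv]
    split_ifs
    · omega
    · rcases Nat.lt_or_ge (k + 1) (num v) with h1 | h1
      · have := h.num_lab v hv h1; omega
      · rw [(h.lab_of_le v hv h1).1]; exact hvk
  · intro v hv
    rw [hlab v hv]
    split_ifs with hc
    · rw [← hc.2]
      exact (Anc.of_par (.refl _ _)).trans (h.anc v hv)
    · exact h.anc v hv
  · intro v hv hl
    by_cases h1 : lab v = v
    · rw [hlab v hv, h1] at hl ⊢
      split_ifs at hl ⊢ with hc
      · rw [hc.2, lab_u']
      · exact absurd rfl hl
    · rw [hlab _ (par_lt v hv), hlab v hv, h.lab_par v hv h1]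
  · intro v hv h0 hvk hl hc
    by_cases hvu : v = u
    · subst hvu
      have := (hS.tree v hv h0 (hne v hv)).2.2.1
      omega
    · rw [hlab v hv] at hl
      split_ifs at hl with hc'
      · exact absurd hl.symm hvu
      · have hvk' : k + 1 < num v := by
          rcases Nat.lt_or_ge (k + 1) (num v) with h1 | h1
          · exact h1
          · exact absurd (hS.num_inj hv hu (hne v hv) (by omega)) hvu
        have h1 := h.num_par v hv h0 hvk' hl (cut_zero v hc)
        rw [hl] at hc'
        have h2 : par v ≠ u := fun h2 => hc' ⟨hc, h2⟩
        by_contra h3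
        exact h2 (hS.num_inj (par_lt v hv) hu (hne _ (par_lt v hv)) (by omega))
  · intro v hv hc
    rcases (hcut v).1.1 hc with h1 | ⟨w, h1, h2, h3, h4⟩
    · obtain ⟨h2, h3, w, h4, h5, h6⟩ := h.odd v hv h1
      refine ⟨by rw [hlab v hv, h2, if_neg (by omega)], h3, w, ?_, h5, h6⟩
      rw [hlab w (hG.lt (hG.symm h5)), h4, if_neg (by omega)]
    · have hw := hG.lt (hG.symm h1)
      have h5 : lab v = v := by rw [← h4]; exact h.lab_lab w hw
      rcases key w h1 h2 with h6 | h6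
      · rw [h4] at h6
        obtain ⟨h2, h3, w, h4, h5, h6⟩ := h.odd v hv h6
        refine ⟨by rw [hlab v hv, h2, if_neg (by omega)], h3, w, ?_, h5, h6⟩
        rw [hlab w (hG.lt (hG.symm h5)), h4, if_neg (by omega)]
      · rw [h4] at h6
        refine ⟨by rw [hlab v hv, h5, if_neg (by omega)], ?_, w, ?_, by rwa [h6], by rwa [h6]⟩
        · rintro rfl
          have := h.num_lab w hw (by omega)
          rw [h4, hS.num_zero] at this; omega
        · rw [hlab w hw, h4, if_neg (by omega)]
  · have main : ∀ v w, adj v w → lab' v = lab' w → num v < num w → col v ≠ col w := by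
      intro v w hvw hl hlt
      have hv := hG.lt hvw
      have hw := hG.lt (hG.symm hvw)
      by_cases hl' : lab v = lab w
      · exact h.col_ne v w hvw hl'
      have hlu : lab' v = u := by
        by_contra hc
        have hc' : lab' w ≠ u := hl ▸ hc
        rw [hlab v hv] at hc
        rw [hlab w hw] at hc'
        rw [hlab v hv, hlab w hw] at hl
        split_ifs at hc hc' hl <;> simp_all
      by_cases hvu : v = u
      · subst hvu
        obtain ⟨h1, h2, h3⟩ := merged w hw (by rintro rfl; omega) (by rw [← hl, hlu])
        intro hcol
        have := (hcut (lab w)).1.2 (.inr ⟨w, hvw, hlt, hcol.symm, rfl⟩)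
        omega
      · obtain ⟨h1, h2, h3⟩ := merged v hv hvu hlu
        obtain ⟨h4, h5, h6⟩ := merged w hw (by rintro rfl; omega) (by rw [← hl, hlu])
        -- The tops of `v` and `w` are both ancestors of `w`, hence comparable. Being distinct with
        -- the same parent `u`, one of them would be an ancestor of `u`, against the numbering.
        exfalso
        have h7 := (h.anc v hv).trans (hS.anc v w hvw (hne v hv) hlt)
        have h8 := h.num_lab v hv h3
        have h9 := h.num_lab w hw h6
        rcases h7.total (h.anc w hw) with h10 | h10 <;> rcases h10.eq_or_par with h11 | h11
        · exact hl' h11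
        · rw [h5] at h11
          have := (hS.anc_le hG hu h11).2; omega
        · exact hl' h11.symm
        · rw [h2] at h11
          have := (hS.anc_le hG hu h11).2; omega
    intro v w hvw hl
    have hv := hG.lt hvw
    have hw := hG.lt (hG.symm hvw)
    rcases lt_trichotomy (num v) (num w) with h1 | h1 | h1
    · exact main v w hvw hl h1
    · rw [hS.num_inj hv hw (hne v hv) h1] at hvw
      exact absurd hvw (hG.irrefl w)
    · exact (main w v (hG.symm hvw) hl.symm h1).symm


/-- Decompose the search tree into pieces: arrays `7` and `8` receive the functions `lab` and
`cut` of `IsPieces`. -/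
def labelProg : Program := block [
  ins [.const 4 0],
  .loop (.lt 4 0) (ins [.store 7 4 4, .succ 4 4]),
  ins [.copy 7 0],
  .loop (.lt 2 7) (block [
    ins [.load 8 6 7, .load 9 2 8, .load 10 5 8, .const 4 0],
    .loop (.lt 4 1) (block [
      ins [.load 5 3 4],
      .cond (.eq 5 8) (block [
        ins [.load 6 1 4, .load 11 5 6, .load 12 2 6, .load 13 7 6],
        .cond (.lt 10 11) (.cond (.eq 12 9) (ins [.store 8 13 3]) .skip) .skip]) .skip,
      ins [.succ 4 4]]),
    ins [.const 4 0],
    .loop (.lt 4 0) (block [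
      ins [.load 5 7 4, .load 6 8 5, .load 11 4 5],
      .cond (.eq 6 2) (.cond (.eq 11 8) (ins [.store 7 4 8]) .skip) .skip,
      ins [.succ 4 4]]),
    ins [.pred 7 7]])]

/-- The arrays of the search tree. -/
structure Tree (par num Q : ℕ → ℕ) (M : Memory) : Prop where
  a4 : M.arr 4 = par
  a5 : M.arr 5 = num
  a6 : M.arr 6 = Q
  a9 : M.arr 9 0 = 0

theorem Input.of_eq {n N : ℕ} {src nbr : ℕ → ℕ} {M M' : Memory} (h : Input n N src nbr M)
    (hr : ∀ x < 4, M'.reg x = M.reg x) (h1 : M'.arr 1 = M.arr 1) (h3 : M'.arr 3 = M.arr 3) :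
    Input n N src nbr M' :=
  ⟨by rw [hr 0 (by omega), h.r0], by rw [hr 1 (by omega), h.r1], by rw [hr 2 (by omega), h.r2],
    by rw [hr 3 (by omega), h.r3], by rw [h1, h.a1], by rw [h3, h.a3]⟩

theorem Tree.of_eq {par num Q : ℕ → ℕ} {M M' : Memory} (h : Tree par num Q M)
    (h4 : M'.arr 4 = M.arr 4) (h5 : M'.arr 5 = M.arr 5) (h6 : M'.arr 6 = M.arr 6)
    (h9 : M'.arr 9 0 = M.arr 9 0) : Tree par num Q M' :=
  ⟨by rw [h4, h.a4], by rw [h5, h.a5], by rw [h6, h.a6], by rw [h9, h.a9]⟩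

/-- The vertices are processed in the reverse order of discovery. For each, one scan of the darts
finds the odd cycles and one scan of the vertices relabels. Marking a piece that was completed
earlier once more is harmless. -/
theorem labelProg_spec {n N : ℕ} {adj : ℕ → ℕ → Prop} {src nbr par num Q col : ℕ → ℕ}
    (hG : IsConn n adj) (hD : IsDarts adj N src nbr) (hS : IsSearch n adj n par num Q col)
    {M : Memory} (hM : Input n N src nbr M) (hT : Tree par num Q M) (h2 : M.arr 2 = col)
    (h8 : M.arr 8 = fun _ => 0) :
    Wp labelProg (n * (2 + 1) + n * (N * 11 + n * 8 + 8 + 1) + 4) M (fun M =>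
      Input n N src nbr M ∧ Tree par num Q M ∧ M.arr 2 = col ∧
      IsPieces n adj 0 par num col (M.arr 7) (M.arr 8)) := by
  refine Wp.mono (Wp.straight_seq (T' := n * (2 + 1) + n * (N * 11 + n * 8 + 8 + 1) + 3) ?_)
    (by simp only [Program.size, ins]; omega) (fun _ h => h)
  simp only [wlp_ins_cons, wlp_ins_nil, Instr.exec]
  refine Wp.mono (Wp.seq (T := (n - 0) * (2 + 1) + 1)
    (T' := n * (N * 11 + n * 8 + 8 + 1) + 2) (Wp.loopUp (lo := 0) (hi := n) (T := 2)
    (fun i M => Input n N src nbr M ∧ Tree par num Q M ∧ M.arr 2 = col ∧ M.arr 8 = (fun _ => 0) ∧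
      M.reg 4 = i ∧ ∀ v < i, M.arr 7 v = v) (Nat.zero_le n) ?_ ?_ ?_ ?_)) (by simp; omega)
    (fun _ h => h)
  · refine ⟨hM.of_eq ?_ rfl rfl, hT.of_eq rfl rfl rfl rfl, by simpa, by simpa, by simp, by simp⟩
    intro x hx
    simp; omega
  · exact fun k M h => ⟨h.2.2.2.2.1, h.1.r0⟩
  · rintro i M - hi ⟨hM, hT, h2, h8, h4, h7⟩
    refine Wp.mono (Wp.of_wlp ?_) (by simp [Program.size, ins]) (fun _ h => h)
    simp only [wlp_ins_cons, wlp_ins_nil, Instr.exec]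
    refine ⟨hM.of_eq ?_ (by simp) (by simp), hT.of_eq (by simp) (by simp) (by simp) (by simp),
      by simpa, by simpa, by simpa, ?_⟩
    · intro x hx
      simp; omega
    · intro v hv
      by_cases h : v = i
      · simp [h, h4]
      · simp [h4, h, h7 v (by omega)]
  rintro M ⟨hM, hT, h2, h8, -, h7⟩
  refine Wp.mono (Wp.straight_seq (T' := n * (N * 11 + n * 8 + 8 + 1) + 1) ?_)
    (by simp only [Program.size, ins]; omega) (fun _ h => h)
  simp only [wlp_ins_cons, wlp_ins_nil, Instr.exec]
  refine Wp.mono (Wp.seq (T' := 0) (Wp.loopDown (hi := n) (T := N * 11 + n * 8 + 8) (fun k M =>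
    Input n N src nbr M ∧ Tree par num Q M ∧ M.arr 2 = col ∧ M.reg 7 = k ∧
    IsPieces n adj k par num col (M.arr 7) (M.arr 8)) ?_ ?_ ?_ ?_)) (by omega) (fun _ h => h)
  · refine ⟨hM.of_eq ?_ rfl rfl, hT.of_eq rfl rfl rfl rfl, by simpa, by simp [hM.r0], ?_⟩
    · intro x hx
      simp; omega
    · simpa [h8] using IsPieces.init hG hS h7
  · exact fun k M h => ⟨h.2.2.2.1, h.1.r2⟩
  · rintro k M hk ⟨hM, hT, h2, hr7, hP⟩
    obtain ⟨hu, hnu⟩ := hS.Q_spec (k + 1) (by omega) (by omega)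
    refine Wp.mono (Wp.straight_seq (T' := N * 11 + n * 8 + 4) ?_)
      (by simp only [Program.size, ins]; omega) (fun _ h => h)
    simp only [wlp_ins_cons, wlp_ins_nil, Instr.exec]
    generalize hQu : Q (k + 1) = u at hu hnu
    generalize hlab : M.arr 7 = lab at hP
    generalize hcut : M.arr 8 = cut at hP
    refine Wp.mono (Wp.seq (T := (N - 0) * (10 + 1) + 1) (T' := n * 8 + 3)
      (Wp.loopUp (lo := 0) (hi := N) (fun i M =>
        Input n N src nbr M ∧ Tree par num Q M ∧ M.arr 2 = col ∧ M.reg 7 = k + 1 ∧ M.reg 8 = u ∧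
        M.reg 9 = col u ∧ M.reg 10 = num u ∧ M.reg 4 = i ∧ M.arr 7 = lab ∧
        ∀ x, (M.arr 8 x = 1 ↔ cut x = 1 ∨ ∃ j < i, src j = u ∧ num u < num (nbr j) ∧
          col (nbr j) = col u ∧ lab (nbr j) = x) ∧ M.arr 8 x ≤ 1) (Nat.zero_le N) ?_ ?_ ?_ ?_))
      (by omega) (fun _ h => h)
    · refine ⟨hM.of_eq ?_ rfl rfl, hT.of_eq rfl rfl rfl rfl, by simpa, by simpa, ?_, ?_, ?_,
        by simp, by simpa, ?_⟩
      · intro x hx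
        interval_cases x <;> simp
      · simp [hT.a6, hr7, hQu]
      · simp [hT.a6, hr7, hQu, h2]
      · simp [hT.a6, hT.a5, hr7, hQu]
      · intro x
        simpa [hcut] using hP.cut_le x
    · exact fun k M h => ⟨h.2.2.2.2.2.2.2.1, h.1.r1⟩
    · rintro i M - hi ⟨hM, hT, h2, hr7, hr8, hr9, hr10, hr4, hlab, hcut⟩
      have frame : ∀ M' : Memory, (∀ x, x ≠ 4 → x ≠ 5 → x ≠ 6 → x ≠ 11 → x ≠ 12 → x ≠ 13 →
          M'.reg x = M.reg x) → M'.reg 4 = i + 1 → (∀ a, a ≠ 8 → M'.arr a = M.arr a) →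
          (∀ x, (M'.arr 8 x = 1 ↔ cut x = 1 ∨ ∃ j < i + 1, src j = u ∧ num u < num (nbr j) ∧
          col (nbr j) = col u ∧ lab (nbr j) = x) ∧ M'.arr 8 x ≤ 1) →
          Input n N src nbr M' ∧ Tree par num Q M' ∧ M'.arr 2 = col ∧ M'.reg 7 = k + 1 ∧
          M'.reg 8 = u ∧ M'.reg 9 = col u ∧ M'.reg 10 = num u ∧ M'.reg 4 = i + 1 ∧
          M'.arr 7 = lab ∧ ∀ x, (M'.arr 8 x = 1 ↔ cut x = 1 ∨ ∃ j < i + 1, src j = u ∧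
          num u < num (nbr j) ∧ col (nbr j) = col u ∧ lab (nbr j) = x) ∧ M'.arr 8 x ≤ 1 := by
        intro M' h1 h4 ha h8
        refine ⟨hM.of_eq (fun x hx => h1 x (by omega) (by omega) (by omega) (by omega) (by omega)
          (by omega)) (ha _ (by omega)) (ha _ (by omega)), hT.of_eq (ha _ (by omega))
          (ha _ (by omega)) (ha _ (by omega)) (by rw [ha 9 (by omega)]), ?_, ?_, ?_, ?_, ?_, h4, ?_,
          h8⟩
        · rw [ha 2 (by omega), h2]
        · rw [h1 7 (by omega) (by omega) (by omega) (by omega) (by omega) (by omega), hr7]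
        · rw [h1 8 (by omega) (by omega) (by omega) (by omega) (by omega) (by omega), hr8]
        · rw [h1 9 (by omega) (by omega) (by omega) (by omega) (by omega) (by omega), hr9]
        · rw [h1 10 (by omega) (by omega) (by omega) (by omega) (by omega) (by omega), hr10]
        · rw [ha 7 (by omega), hlab]
      have same : ¬ (src i = u ∧ num u < num (nbr i) ∧ col (nbr i) = col u) →
          ∀ x, (M.arr 8 x = 1 ↔ cut x = 1 ∨ ∃ j < i + 1, src j = u ∧ num u < num (nbr j) ∧
          col (nbr j) = col u ∧ lab (nbr j) = x) ∧ M.arr 8 x ≤ 1 := by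
        intro hn x
        refine ⟨(hcut x).1.trans (or_congr_right ?_), (hcut x).2⟩
        constructor
        · rintro ⟨j, hj, h⟩
          exact ⟨j, by omega, h⟩
        · rintro ⟨j, hj, h⟩
          rcases Nat.lt_succ_iff_lt_or_eq.1 hj with hji | rfl
          · exact ⟨j, hji, h⟩
          · exact absurd ⟨h.1, h.2.1, h.2.2.1⟩ hn
      refine Wp.mono (Wp.of_wlp (Program.wlp_mono (Q := fun M' => (∀ x, x ≠ 4 → x ≠ 5 → x ≠ 6 →
          x ≠ 11 → x ≠ 12 → x ≠ 13 → M'.reg x = M.reg x) ∧ M'.reg 4 = i + 1 ∧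
          (∀ a, a ≠ 8 → M'.arr a = M.arr a) ∧ M'.arr 8 = if src i = u ∧ num u < num (nbr i) ∧
          col (nbr i) = col u then Function.update (M.arr 8) (lab (nbr i)) 1 else M.arr 8) ?_
          fun M' h => frame M' h.1 h.2.1 h.2.2.1 ?_)) (by simp [Program.size, ins, block])
          (fun _ h => h)
      · simp only [wlp_block_cons, wlp_block_nil, wlp_ins_cons, wlp_ins_nil, wlp_cond, wlp_skip,
          Instr.exec, Test.holds, Memory.setReg_reg, Memory.setReg_arr, Memory.setArr_reg,
          Memory.setArr_arr]
        simp only [Nat.reduceEqDiff, if_true, if_false, hr4, hM.a3, hM.a1, hT.a5, h2, hlab, hr8,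
          hr9, hr10, hM.r3]
        clear frame same hcut hnu
        refine ⟨fun h1 => ⟨fun h3 => ⟨fun h4 => ?_, fun h4 => ?_⟩, fun h3 => ?_⟩, fun h1 => ?_⟩ <;>
        · refine ⟨fun x _ _ _ _ _ _ => by simp [*], by simp, fun a ha => by simp [ha], ?_⟩
          simp [*]
      · rw [h.2.2.2]
        split_ifs with hc
        · intro x
          simp only [Function.update_apply]
          split_ifs with hx
          · simp only [le_refl, and_true, true_iff]
            exact .inr ⟨i, by omega, hc.1, hc.2.1, hc.2.2, hx.symm⟩
          · refine ⟨(hcut x).1.trans (or_congr_right ?_), (hcut x).2⟩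
            constructor
            · rintro ⟨j, hj, hj'⟩
              exact ⟨j, by omega, hj'⟩
            · rintro ⟨j, hj, hj'⟩
              rcases Nat.lt_succ_iff_lt_or_eq.1 hj with hji | rfl
              · exact ⟨j, hji, hj'⟩
              · exact absurd hj'.2.2.2.symm hx
        · exact same hc
    · rintro M ⟨hM, hT, h2, hr7, hr8, -, -, -, hlab, hcut⟩
      replace hcut : ∀ x, (M.arr 8 x = 1 ↔ cut x = 1 ∨
          ∃ w, adj u w ∧ num u < num w ∧ col w = col u ∧ lab w = x) ∧ M.arr 8 x ≤ 1 := by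
        intro x
        refine ⟨(hcut x).1.trans (or_congr_right ?_), (hcut x).2⟩
        constructor
        · rintro ⟨j, hj, rfl, h⟩
          exact ⟨nbr j, hD.adj_of j hj, h⟩
        · rintro ⟨w, hw, h⟩
          obtain ⟨j, hj, h5, rfl⟩ := hD.surj hw
          exact ⟨j, hj, h5, h⟩
      generalize hcut' : M.arr 8 = cut' at hcut
      refine Wp.mono (Wp.straight_seq (T' := n * 8 + 2) ?_)
        (by simp only [Program.size, ins]; omega) (fun _ h => h)
      simp only [wlp_ins_cons, wlp_ins_nil, Instr.exec]
      -- Relabelling in place is safe, since the label of a vertex is read only at its own turn.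
      refine Wp.mono (Wp.seq (T := (n - 0) * (7 + 1) + 1) (T' := 1)
        (Wp.loopUp (lo := 0) (hi := n) (fun i M =>
          Input n N src nbr M ∧ Tree par num Q M ∧ M.arr 2 = col ∧ M.reg 7 = k + 1 ∧ M.reg 8 = u ∧
          M.reg 4 = i ∧ M.arr 8 = cut' ∧ (∀ v < i, M.arr 7 v =
            if cut' (lab v) = 0 ∧ par (lab v) = u then u else lab v) ∧
          ∀ v, i ≤ v → M.arr 7 v = lab v) (Nat.zero_le n) ?_ ?_ ?_ ?_))
        (by omega) (fun _ h => h)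
      · refine ⟨hM.of_eq ?_ rfl rfl, hT.of_eq rfl rfl rfl rfl, by simpa, by simpa, by simpa,
          by simp, by simpa, by simp, by simp [hlab]⟩
        intro x hx
        simp; omega
      · exact fun k M h => ⟨h.2.2.2.2.2.1, h.1.r0⟩
      · rintro i M - hi ⟨hM, hT, h2, hr7, hr8, hr4, hcut', hlab1, hlab2⟩
        refine Wp.mono (Wp.of_wlp (Program.wlp_mono (Q := fun M' => (∀ x, x ≠ 4 → x ≠ 5 → x ≠ 6 →
          x ≠ 11 → M'.reg x = M.reg x) ∧ M'.reg 4 = i + 1 ∧ (∀ a, a ≠ 7 → M'.arr a = M.arr a) ∧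
          M'.arr 7 = if cut' (lab i) = 0 ∧ par (lab i) = u then Function.update (M.arr 7) i u
            else M.arr 7) ?_ ?_)) (by simp [Program.size, ins, block]) (fun _ h => h)
        · simp only [wlp_block_cons, wlp_block_nil, wlp_ins_cons, wlp_ins_nil, wlp_cond, wlp_skip,
            Instr.exec, Test.holds, Memory.setReg_reg, Memory.setReg_arr, Memory.setArr_reg,
            Memory.setArr_arr]
          simp only [Nat.reduceEqDiff, if_true, if_false, hr4, hT.a4, hlab2 i le_rfl, hr8, hcut',
            hM.r2]
          refine ⟨fun h1 => ⟨fun h3 => ?_, fun h3 => ?_⟩, fun h1 => ?_⟩ <;>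
          · refine ⟨fun x _ _ _ _ => by simp [*], by simp, fun a ha => by simp [ha], ?_⟩
            simp [*]
        · rintro M' ⟨h1, h4, ha, h7⟩
          refine ⟨hM.of_eq (fun x hx => h1 x (by omega) (by omega) (by omega) (by omega))
            (ha _ (by omega)) (ha _ (by omega)), hT.of_eq (ha _ (by omega))
            (ha _ (by omega)) (ha _ (by omega)) (by rw [ha 9 (by omega)]), ?_, ?_, ?_, h4, ?_, ?_,
            ?_⟩
          · rw [ha 2 (by omega), h2]
          · rw [h1 7 (by omega) (by omega) (by omega) (by omega), hr7]
          · rw [h1 8 (by omega) (by omega) (by omega) (by omega), hr8]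
          · rw [ha 8 (by omega), hcut']
          · intro v hv
            rw [h7]
            rcases Nat.lt_succ_iff_lt_or_eq.1 hv with hvi | rfl
            · rw [← hlab1 v hvi]
              split_ifs
              · rw [Function.update_of_ne (by omega)]
              · rfl
            · split_ifs
              · simp
              · exact hlab2 v le_rfl
          · intro v hv
            rw [h7]
            split_ifs
            · rw [Function.update_of_ne (by omega), hlab2 v (by omega)]
            · exact hlab2 v (by omega)
      · rintro M ⟨hM, hT, h2, hr7, hr8, -, hcut', hlab, -⟩
        refine Wp.mono (Wp.of_wlp ?_) (by simp [Program.size, ins, block]) (fun _ h => h)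
        simp only [wlp_block_cons, wlp_block_nil, wlp_ins_cons, wlp_ins_nil, Instr.exec]
        refine ⟨hM.of_eq ?_ rfl rfl, hT.of_eq rfl rfl rfl rfl, by simpa, by simp [hr7], ?_⟩
        · intro x hx
          simp; omega
        · simp only [Memory.setReg_arr, hcut']
          exact hP.step hG hS hu hnu hcut hlab
  · rintro M ⟨hM, hT, h2, -, h⟩
    exact Wp.of_wlp (P := .skip) (show _ ∧ _ from ⟨hM, hT, h2, h⟩)


/-! ### Merging pieces with the piece of the root: the program -/

/-- Recolour the search tree so that the edge from `y` to its parent is monochromatic, and merge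
the piece of `y` with the piece of `0` in the better one of the two possible ways, provided that
this is good enough; the vertex `y` is in register `7`, and its label in register `8`. -/
def mergeBody (c : ℕ) : Program := block [
  ins [.const 4 2, .succ 14 0],
  .loop (.lt 4 14) (block [
    ins [.load 5 6 4, .load 6 4 5, .load 9 9 6],
    .cond (.eq 5 7) .skip (.cond (.eq 9 2) (ins [.const 9 1]) (ins [.const 9 0])),
    ins [.store 9 5 9, .succ 4 4]]),
  ins [.const 9 c, .const 10 c, .const 11 0, .const 12 0, .const 4 0],
  .loop (.lt 4 1) (block [
    ins [.load 5 3 4, .load 6 1 4, .load 13 7 5],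
    .cond (.eq 13 8) (block [
      ins [.load 13 7 6, .load 5 9 5],
      .cond (.eq 13 2)
        (block [ins [.load 6 2 6],
          .cond (.eq 5 6) (ins [.succ 10 10, .succ 12 12]) (ins [.succ 9 9, .succ 11 11])])
        (.cond (.eq 13 8) (block [ins [.load 6 9 6],
          .cond (.eq 5 6) (ins [.succ 11 11, .succ 12 12]) .skip]) .skip)]) .skip,
    ins [.succ 4 4]]),
  ins [.const 13 0],
  .cond (.lt 12 9) (ins [.const 13 1]) (.cond (.lt 11 10) (ins [.const 13 2]) .skip),
  ins [.const 4 0],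
  .cond (.lt 2 13) (.loop (.lt 4 0) (block [
    ins [.load 5 7 4],
    .cond (.eq 5 8) (block [
      ins [.load 5 9 4],
      .cond (.eq 13 3) .skip (.cond (.eq 5 2) (ins [.const 5 1]) (ins [.const 5 0])),
      ins [.store 2 4 5, .store 7 4 2]]) .skip,
    ins [.succ 4 4]])) .skip]

/-- Try to merge the piece of `y` with the piece of `0`, for all `y`. -/
def mergeProg (c : ℕ) : Program := block [
  ins [.const 7 0],
  .loop (.lt 7 0) (block [
    ins [.load 8 7 7],
    .cond (.lt 2 8) (mergeBody c) .skip,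
    ins [.succ 7 7]])]

/-- `nc` is the colouring of the search tree such that the edge from `y` to its parent is the only
monochromatic one. -/
structure IsRecol (n : ℕ) (par : ℕ → ℕ) (y : ℕ) (nc : ℕ → ℕ) : Prop where
  zero : nc 0 = 0
  succ : ∀ v < n, v ≠ 0 → nc v = if v = y then nc (par v) else if nc (par v) = 0 then 1 else 0

section Counts
variable (N : ℕ) (src nbr lab col nc : ℕ → ℕ) (t : ℕ)

/-- The number of edges between the pieces of `t` and `0` that are cut. -/
def cutCount : ℕ := ∑ i ∈ Finset.range N,
  if lab (src i) = t ∧ lab (nbr i) = 0 ∧ nc (src i) ≠ col (nbr i) then 1 else 0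

/-- The number of edges between the pieces of `t` and `0` that are not cut. -/
def uncutCount : ℕ := ∑ i ∈ Finset.range N,
  if lab (src i) = t ∧ lab (nbr i) = 0 ∧ nc (src i) = col (nbr i) then 1 else 0

/-- Twice the number of edges in the piece of `t` that are not cut. -/
def monoCount : ℕ := ∑ i ∈ Finset.range N,
  if lab (src i) = t ∧ lab (nbr i) = t ∧ nc (src i) = nc (nbr i) then 1 else 0

end Counts

/-- The effect of `mergeBody`. -/
def MergeStep (n N : ℕ) (src nbr : ℕ → ℕ) (c t : ℕ) (nc lab col lab' col' : ℕ → ℕ) : Prop :=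
  (lab' = lab ∧ col' = col ∧
    cutCount N src nbr lab col nc t + c ≤
      uncutCount N src nbr lab col nc t + monoCount N src nbr lab nc t ∧
    uncutCount N src nbr lab col nc t + c ≤
      cutCount N src nbr lab col nc t + monoCount N src nbr lab nc t) ∨
  ∃ flip : Bool, (∀ v < n, lab' v = if lab v = t then 0 else lab v) ∧
    (∀ v < n, col' v = if lab v = t then
      (if flip then (if nc v = 0 then 1 else 0) else nc v) else col v) ∧
    (flip = false → uncutCount N src nbr lab col nc t + monoCount N src nbr lab nc t <
      cutCount N src nbr lab col nc t + c) ∧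
    (flip = true → cutCount N src nbr lab col nc t + monoCount N src nbr lab nc t <
      uncutCount N src nbr lab col nc t + c)

/-- Merging with `nc` raises the excess by twice (cut - uncut - mono), and merging with its opposite
by twice (uncut - cut - mono). Registers `9` to `12` accumulate the two sides of both tests, so no
arithmetic beyond counting is needed. -/
theorem mergeBody_spec {n N : ℕ} {adj : ℕ → ℕ → Prop} {src nbr par num Q lab col : ℕ → ℕ}
    {col₀ : ℕ → ℕ} (hG : IsConn n adj) (hS : IsSearch n adj n par num Q col₀) {c y : ℕ}
    {M : Memory} (hM : Input n N src nbr M) (hT : Tree par num Q M) (h2 : M.arr 2 = col)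
    (h7 : M.arr 7 = lab) (hr7 : M.reg 7 = y) (hr8 : M.reg 8 = lab y) (hy : lab y ≠ 0) :
    Wp (mergeBody c) (n * 19 + N * 14 + 20) M (fun M' =>
      Input n N src nbr M' ∧ Tree par num Q M' ∧ M'.reg 7 = y ∧ ∃ nc, IsRecol n par y nc ∧
      MergeStep n N src nbr c (lab y) nc lab col (M'.arr 7) (M'.arr 2)) := by
  have hn := hG.pos
  refine Wp.mono (Wp.straight_seq (T' := (n - 1) * 9 + n * 10 + N * 14 + 18) ?_)
    (by simp only [Program.size, ins]; omega) (fun _ h => h)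
  simp only [wlp_ins_cons, wlp_ins_nil, Instr.exec]
  -- Vertices are coloured in the order of discovery, so the parent always comes first. The loop
  -- starts at `2` because number `1` is the root, whose cell in array `9` keeps the value `0`
  -- throughout.
  refine Wp.mono (Wp.seq (T := (n + 1 - 2) * (8 + 1) + 1)
    (T' := n * 10 + N * 14 + 16) (Wp.loopUp (lo := 2) (hi := n + 1) (T := 8)
    (fun k M => Input n N src nbr M ∧ Tree par num Q M ∧ M.arr 2 = col ∧ M.arr 7 = lab ∧
      M.reg 7 = y ∧ M.reg 8 = lab y ∧ M.reg 14 = n + 1 ∧ M.reg 4 = k ∧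
      ∀ j, 2 ≤ j → j < k → M.arr 9 (Q j) = if Q j = y then M.arr 9 (par (Q j)) else
        if M.arr 9 (par (Q j)) = 0 then 1 else 0) (by omega) ?_ ?_ ?_ ?_)) (by omega)
    (fun _ h => h)
  · refine ⟨hM.of_eq ?_ rfl rfl, hT.of_eq rfl rfl rfl rfl, by simpa, by simpa, by simpa, by simpa,
      by simp [hM.r0], by simp, fun j _ _ => by omega⟩
    intro x hx
    interval_cases x <;> simp
  · exact fun k M h => ⟨h.2.2.2.2.2.2.2.1, h.2.2.2.2.2.2.1⟩
  · rintro k M hk2 hkn ⟨hM, hT, h2, h7, hr7, hr8, hr14, hr4, hQ⟩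
    obtain ⟨hv, hvk⟩ := hS.Q_spec k (by omega) (by omega)
    have hv0 : Q k ≠ 0 := by
      intro h0
      rw [h0, hS.num_zero] at hvk; omega
    refine Wp.mono (Wp.of_wlp (Program.wlp_mono (Q := fun M' => (∀ x, x ≠ 4 → x ≠ 5 → x ≠ 6 →
      x ≠ 9 → M'.reg x = M.reg x) ∧ M'.reg 4 = k + 1 ∧ (∀ a, a ≠ 9 → M'.arr a = M.arr a) ∧
      M'.arr 9 = Function.update (M.arr 9) (Q k) (if Q k = y then M.arr 9 (par (Q k)) else
        if M.arr 9 (par (Q k)) = 0 then 1 else 0)) ?_ ?_)) (by simp [Program.size, ins, block])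
        (fun _ h => h)
    · simp only [wlp_block_cons, wlp_block_nil, wlp_ins_cons, wlp_ins_nil, wlp_cond, wlp_skip,
        Instr.exec, Test.holds, Memory.setReg_reg, Memory.setReg_arr, Memory.setArr_reg,
        Memory.setArr_arr]
      simp only [Nat.reduceEqDiff, if_true, if_false, hr4, hT.a4, hT.a6, hr7, hM.r2]
      clear hQ hvk hv
      refine ⟨fun h1 => ?_, fun h1 => ⟨fun h3 => ?_, fun h3 => ?_⟩⟩ <;>
      · refine ⟨fun x _ _ _ _ => by simp [*], by simp, fun a ha => by simp [ha], ?_⟩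
        simp only [h1, if_true, if_false]
        try simp only [h3, if_true, if_false]
    · rintro M' ⟨h1, h4, ha, h9⟩
      refine ⟨hM.of_eq (fun x hx => h1 x (by omega) (by omega) (by omega) (by omega))
        (ha _ (by omega)) (ha _ (by omega)), hT.of_eq (ha _ (by omega))
        (ha _ (by omega)) (ha _ (by omega)) ?_, ?_, ?_, ?_, ?_, ?_, h4, ?_⟩
      · rw [h9, Function.update_of_ne hv0.symm]
      · rw [ha 2 (by omega), h2]
      · rw [ha 7 (by omega), h7]
      · rw [h1 7 (by omega) (by omega) (by omega) (by omega), hr7]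
      · rw [h1 8 (by omega) (by omega) (by omega) (by omega), hr8]
      · rw [h1 14 (by omega) (by omega) (by omega) (by omega), hr14]
      · intro j hj hj'
        obtain ⟨hw, hwj⟩ := hS.Q_spec j (by omega) (by omega)
        have hw0 : Q j ≠ 0 := by
          intro h0
          rw [h0, hS.num_zero] at hwj; omega
        have hlt := (hS.tree _ hw hw0 (by omega)).2.2.1
        have hpar : par (Q j) ≠ Q k := by
          intro h0; rw [h0] at hlt; omega
        rw [h9, Function.update_of_ne hpar]
        rcases Nat.lt_succ_iff_lt_or_eq.1 hj' with hjk | rfl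
        · rw [Function.update_of_ne, hQ j hj hjk]
          intro h0; rw [h0] at hwj; omega
        · rw [Function.update_self]
  rintro M ⟨hM, hT, h2, h7, hr7, hr8, -, -, hQ⟩
  have hrec : IsRecol n par y (M.arr 9) := by
    refine ⟨hT.a9, fun v hv hv0 => ?_⟩
    have h1 := hS.num_ne_zero hv
    have h3 := (hS.tree v hv hv0 h1)
    have h4 := hQ (num v) (by omega) (by have := hS.num_le v hv; omega)
    rwa [hS.Q_num v hv h1] at h4
  generalize hnc : M.arr 9 = nc at hrec
  refine Wp.mono (Wp.straight_seq (T' := n * 10 + N * 14 + 11) ?_)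
    (by simp only [Program.size, ins]; omega) (fun _ h => h)
  simp only [wlp_ins_cons, wlp_ins_nil, Instr.exec]
  refine Wp.mono (Wp.seq (T := (N - 0) * (13 + 1) + 1)
    (T' := n * 10 + 10) (Wp.loopUp (lo := 0) (hi := N) (T := 13)
    (fun k M => Input n N src nbr M ∧ Tree par num Q M ∧ M.arr 2 = col ∧ M.arr 7 = lab ∧
      M.arr 9 = nc ∧ M.reg 7 = y ∧ M.reg 8 = lab y ∧ M.reg 4 = k ∧
      M.reg 9 = c + cutCount k src nbr lab col nc (lab y) ∧
      M.reg 10 = c + uncutCount k src nbr lab col nc (lab y) ∧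
      M.reg 11 = cutCount k src nbr lab col nc (lab y) + monoCount k src nbr lab nc (lab y) ∧
      M.reg 12 = uncutCount k src nbr lab col nc (lab y) + monoCount k src nbr lab nc (lab y))
      (by omega) ?_ ?_ ?_ ?_)) (by omega)
    (fun _ h => h)
  · refine ⟨hM.of_eq ?_ rfl rfl, hT.of_eq rfl rfl rfl rfl, by simpa, by simpa, by simpa, by simpa,
      by simpa, by simp, by simp [cutCount], by simp [uncutCount], by simp [cutCount, monoCount],
      by simp [uncutCount, monoCount]⟩
    intro x hx
    interval_cases x <;> simp
  · exact fun k M h => ⟨h.2.2.2.2.2.2.2.1, h.1.r1⟩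
  · rintro k M - hk ⟨hM, hT, h2, h7, h9, hr7, hr8, hr4, hr9, hr10, hr11, hr12⟩
    have e1 : cutCount (k + 1) src nbr lab col nc (lab y) = cutCount k src nbr lab col nc (lab y) +
      if lab (src k) = lab y ∧ lab (nbr k) = 0 ∧ nc (src k) ≠ col (nbr k) then 1 else 0 :=
      Finset.sum_range_succ _ _
    have e2 : uncutCount (k + 1) src nbr lab col nc (lab y) =
      uncutCount k src nbr lab col nc (lab y) +
      if lab (src k) = lab y ∧ lab (nbr k) = 0 ∧ nc (src k) = col (nbr k) then 1 else 0 :=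
      Finset.sum_range_succ _ _
    have e3 : monoCount (k + 1) src nbr lab nc (lab y) = monoCount k src nbr lab nc (lab y) +
      if lab (src k) = lab y ∧ lab (nbr k) = lab y ∧ nc (src k) = nc (nbr k) then 1 else 0 :=
      Finset.sum_range_succ _ _
    refine Wp.mono (Wp.of_wlp (Program.wlp_mono (Q := fun M' => (∀ x, x ≠ 4 → x ≠ 5 → x ≠ 6 →
      x ≠ 9 → x ≠ 10 → x ≠ 11 → x ≠ 12 → x ≠ 13 → M'.reg x = M.reg x) ∧ M'.reg 4 = k + 1 ∧
      M'.arr = M.arr ∧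
      M'.reg 9 = c + cutCount (k + 1) src nbr lab col nc (lab y) ∧
      M'.reg 10 = c + uncutCount (k + 1) src nbr lab col nc (lab y) ∧
      M'.reg 11 =
        cutCount (k + 1) src nbr lab col nc (lab y) + monoCount (k + 1) src nbr lab nc (lab y) ∧
      M'.reg 12 =
        uncutCount (k + 1) src nbr lab col nc (lab y) + monoCount (k + 1) src nbr lab nc (lab y))
      ?_ ?_)) (by simp [Program.size, ins, block]) (fun _ h => h)
    · rw [e1, e2, e3]
      simp only [wlp_block_cons, wlp_block_nil, wlp_ins_cons, wlp_ins_nil, wlp_cond, wlp_skip,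
        Instr.exec, Test.holds, Memory.setReg_reg, Memory.setReg_arr]
      simp only [Nat.reduceEqDiff, if_true, if_false, hr4, hM.a1, hM.a3, h2, h7, h9, hr8, hr9,
        hr10, hr11, hr12, hM.r2]
      generalize cutCount k src nbr lab col nc (lab y) = x1
      generalize uncutCount k src nbr lab col nc (lab y) = x2
      generalize monoCount k src nbr lab nc (lab y) = x3
      clear e1 e2 e3
      have hy' : ¬ 0 = lab y := fun h => hy h.symm
      refine ⟨fun h1 => ⟨fun h3 => ⟨fun h4 => ?_, fun h4 => ?_⟩,
        fun h3 => ⟨fun h4 => ⟨fun h5 => ?_, fun h5 => ?_⟩, fun h4 => ?_⟩⟩, fun h1 => ?_⟩ <;>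
      · refine ⟨fun x _ _ _ _ _ _ _ _ => by simp [*], by simp, trivial, ?_, ?_, ?_, ?_⟩ <;>
        simp [*] <;> omega
    · rintro M' ⟨h1, h4, ha, h5⟩
      exact ⟨hM.of_eq (fun x hx => h1 x (by omega) (by omega) (by omega) (by omega) (by omega)
        (by omega) (by omega) (by omega)) (by rw [ha]) (by rw [ha]), hT.of_eq (by rw [ha])
        (by rw [ha]) (by rw [ha]) (by rw [ha]), by rw [ha, h2], by rw [ha, h7], by rw [ha, h9],
        by rw [h1 7, hr7] <;> omega, by rw [h1 8, hr8] <;> omega, h4, h5⟩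
  rintro M ⟨hM, hT, h2, h7, h9, hr7, hr8, -, hr9, hr10, hr11, hr12⟩
  refine Wp.mono (Wp.straight_seq (T' := n * 10 + 9) (Program.wlp_mono (Q := fun M' =>
    (∀ x, x ≠ 13 → M'.reg x = M.reg x) ∧ M'.arr = M.arr ∧ M'.reg 13 = 0) ?_ ?_))
    (by simp only [Program.size, ins]; omega) (fun _ h => h)
  · simp only [wlp_ins_cons, wlp_ins_nil, Instr.exec]
    exact ⟨fun x hx => by simp [hx], rfl, by simp⟩
  rintro M₁ ⟨h1r, h1a, h113⟩
  -- Register `13` receives the decision: `0` for no merging, `1` for merging with `nc`, `2` for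
  -- merging with the opposite of `nc`.
  refine Wp.mono (Wp.straight_seq (T' := n * 10 + 5) (Program.wlp_mono (Q := fun M' =>
    (∀ x, x ≠ 13 → M'.reg x = M.reg x) ∧ M'.arr = M.arr ∧
    (M'.reg 13 = 0 ∧ M.reg 9 ≤ M.reg 12 ∧ M.reg 10 ≤ M.reg 11 ∨
      M'.reg 13 = 1 ∧ M.reg 12 < M.reg 9 ∨ M'.reg 13 = 2 ∧ M.reg 11 < M.reg 10)) ?_ ?_))
    (by simp [Program.size, ins]; omega) (fun _ h => h)
  · simp only [wlp_ins_cons, wlp_ins_nil, wlp_cond, wlp_skip, Instr.exec, Test.holds]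
    rw [h1r 9 (by omega), h1r 10 (by omega), h1r 11 (by omega), h1r 12 (by omega)]
    refine ⟨fun h1 => ?_, fun h1 => ⟨fun h3 => ?_, fun h3 => ?_⟩⟩
    · exact ⟨fun x hx => by simp [hx, h1r], h1a, by simp [h1]⟩
    · exact ⟨fun x hx => by simp [hx, h1r], h1a, by simp [h3]⟩
    · exact ⟨h1r, h1a, .inl ⟨h113, by omega, by omega⟩⟩
  clear h1r h1a h113 M₁
  rintro M₁ ⟨h1r, h1a, hgo⟩
  refine Wp.mono (Wp.straight_seq (T' := n * 10 + 3) (Program.wlp_mono (Q := fun M' =>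
    (∀ x, x ≠ 4 → M'.reg x = M₁.reg x) ∧ M'.arr = M₁.arr ∧ M'.reg 4 = 0) ?_ ?_))
    (by simp only [Program.size, ins]; omega) (fun _ h => h)
  · simp only [wlp_ins_cons, wlp_ins_nil, Instr.exec]
    exact ⟨fun x hx => by simp [hx], rfl, by simp⟩
  rintro M₂ ⟨h2r, h2a, h24⟩
  have hM₂ : Input n N src nbr M₂ := hM.of_eq
    (fun x hx => by
      by_cases h4 : x = 4
      · omega
      · rw [h2r x h4, h1r x (by omega)]) (by rw [h2a, h1a]) (by rw [h2a, h1a])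
  have hT₂ : Tree par num Q M₂ := hT.of_eq (by rw [h2a, h1a]) (by rw [h2a, h1a]) (by rw [h2a, h1a])
    (by rw [h2a, h1a])
  have e7 : M₂.reg 7 = y := by rw [h2r 7 (by omega), h1r 7 (by omega), hr7]
  have e8 : M₂.reg 8 = lab y := by rw [h2r 8 (by omega), h1r 8 (by omega), hr8]
  have e13 := h2r 13 (by omega)
  have a2 : M₂.arr 2 = col := by rw [h2a, h1a, h2]
  have a7 : M₂.arr 7 = lab := by rw [h2a, h1a, h7]
  have a9 : M₂.arr 9 = nc := by rw [h2a, h1a, h9]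
  rw [← e13] at hgo
  clear h1r h2r h1a h2a e13
  refine Wp.mono (Wp.seq (T' := 0) (Wp.mono (Wp.cond (T := (n - 0) * (9 + 1) + 1) (T' := 0)
    (Q := fun M' => Input n N src nbr M' ∧ Tree par num Q M' ∧ M'.reg 7 = y ∧ ∃ nc,
      IsRecol n par y nc ∧ MergeStep n N src nbr c (lab y) nc lab col (M'.arr 7) (M'.arr 2))
    (fun hgo' => ?_) (fun hgo' => ?_)) le_rfl
    (fun M' h => Wp.of_wlp (P := .skip) h))) (by simp) (fun _ h => h)
  · have hgo' : 0 < M₂.reg 13 := by simpa only [Test.holds, hM₂.r2] using hgo'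
    refine Wp.loopUp (lo := 0) (hi := n) (T := 9) (fun i M => Input n N src nbr M ∧
      Tree par num Q M ∧ M.reg 7 = y ∧ M.reg 8 = lab y ∧ M.reg 13 = M₂.reg 13 ∧ M.reg 4 = i ∧
      M.arr 9 = nc ∧ (∀ v < i, M.arr 7 v = (if lab v = lab y then 0 else lab v) ∧
        M.arr 2 v = if lab v = lab y then
          (if M₂.reg 13 = 1 then nc v else if nc v = 0 then 1 else 0) else col v) ∧
      ∀ v, i ≤ v → M.arr 7 v = lab v ∧ M.arr 2 v = col v) (Nat.zero_le n) ?_ ?_ ?_ ?_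
    · exact ⟨hM₂, hT₂, e7, e8, rfl, h24, a9, by simp, fun v _ => ⟨by rw [a7], by rw [a2]⟩⟩
    · exact fun k M h => ⟨h.2.2.2.2.2.1, h.1.r0⟩
    · rintro i M - hi ⟨hM, hT, hr7, hr8, hr13, hr4, ha9, hlt, hge⟩
      refine Wp.mono (Wp.of_wlp (Program.wlp_mono (Q := fun M' => (∀ x, x ≠ 4 → x ≠ 5 →
        M'.reg x = M.reg x) ∧ M'.reg 4 = i + 1 ∧ (∀ a, a ≠ 2 → a ≠ 7 → M'.arr a = M.arr a) ∧
        M'.arr 7 = (if lab i = lab y then Function.update (M.arr 7) i 0 else M.arr 7) ∧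
        M'.arr 2 = if lab i = lab y then Function.update (M.arr 2) i
          (if M₂.reg 13 = 1 then nc i else if nc i = 0 then 1 else 0) else M.arr 2) ?_ ?_))
          (by simp [Program.size, ins, block]) (fun _ h => h)
      · simp only [wlp_block_cons, wlp_block_nil, wlp_ins_cons, wlp_ins_nil, wlp_cond, wlp_skip,
          Instr.exec, Test.holds, Memory.setReg_reg, Memory.setReg_arr, Memory.setArr_reg,
          Memory.setArr_arr]
        simp only [Nat.reduceEqDiff, if_true, if_false, hr4, ha9, hr8, hr13, hM.r2, hM.r3,
          (hge i le_rfl).1]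
        refine ⟨fun h1 => ⟨fun h3 => ?_, fun h3 => ⟨fun h4 => ?_, fun h4 => ?_⟩⟩, fun h1 => ?_⟩
        · exact ⟨fun x h4 h5 => by simp [h4, h5], trivial,
            fun a h2 h7 => by simp [h2, h7], by simp [h1], by simp [h1, h3]⟩
        · exact ⟨fun x h4 h5 => by simp [h4, h5], trivial,
            fun a h2 h7 => by simp [h2, h7], by simp [h1], by simp [h1, h3, h4]⟩
        · exact ⟨fun x h4 h5 => by simp [h4, h5], trivial,
            fun a h2 h7 => by simp [h2, h7], by simp [h1], by simp [h1, h3, h4]⟩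
        · exact ⟨fun x h4 h5 => by simp [h4, h5], trivial,
            fun a h2 h7 => trivial, by simp [h1], by simp [h1]⟩
      · rintro M' ⟨hr, hr4', ha, h7, h2⟩
        refine ⟨hM.of_eq (fun x hx => hr x (by omega) (by omega)) (ha _ (by omega) (by omega))
          (ha _ (by omega) (by omega)), hT.of_eq (ha _ (by omega) (by omega))
          (ha _ (by omega) (by omega)) (ha _ (by omega) (by omega))
          (by rw [ha 9 (by omega) (by omega)]), by rw [hr 7 (by omega) (by omega), hr7],
          by rw [hr 8 (by omega) (by omega), hr8], by rw [hr 13 (by omega) (by omega), hr13], hr4',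
          by rw [ha 9 (by omega) (by omega), ha9], fun v hv => ?_, fun v hv => ?_⟩
        · rw [h7, h2]
          rcases Nat.lt_succ_iff_lt_or_eq.1 hv with hvi | rfl
          · rw [← (hlt v hvi).1, ← (hlt v hvi).2]
            by_cases hl : lab i = lab y
            · rw [if_pos hl, if_pos hl, Function.update_of_ne (by omega),
                Function.update_of_ne (by omega)]
              exact ⟨rfl, rfl⟩
            · rw [if_neg hl, if_neg hl]
              exact ⟨rfl, rfl⟩
          · by_cases hl : lab v = lab y
            · simp [hl]
            · simpa [hl] using hge v le_rfl
        · rw [h7, h2]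
          have := hge v (by omega)
          by_cases hl : lab i = lab y
          · rwa [if_pos hl, if_pos hl, Function.update_of_ne (by omega),
              Function.update_of_ne (by omega)]
          · rwa [if_neg hl, if_neg hl]
    · rintro M ⟨hM, hT, hr7, -, -, -, -, hlt, -⟩
      refine ⟨hM, hT, hr7, nc, hrec, .inr ⟨decide (M₂.reg 13 = 2), fun v hv => (hlt v hv).1,
        fun v hv => ?_, fun h => ?_, fun h => ?_⟩⟩
      · rw [(hlt v hv).2]
        have : M₂.reg 13 = 1 ∨ M₂.reg 13 = 2 := by omega
        rcases this with h | h <;> simp [h]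
      · have := of_decide_eq_false h
        omega
      · have := of_decide_eq_true h
        omega
  · have hgo' : M₂.reg 13 = 0 := by
      simp only [Test.holds, hM₂.r2] at hgo'
      omega
    exact Wp.of_wlp (P := .skip)
      (show _ ∧ _ from ⟨hM₂, hT₂, e7, nc, hrec, .inl ⟨a7, a2, by omega, by omega⟩⟩)

/-- The invariant `J` sees only labels and colours. It is a parameter because the two passes, with
`c = 0` and `c = 1`, need different invariants. -/
theorem mergeProg_spec {n N : ℕ} {adj : ℕ → ℕ → Prop} {src nbr par num Q col₀ : ℕ → ℕ}
    (hG : IsConn n adj) (hS : IsSearch n adj n par num Q col₀) {c : ℕ}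
    (J : ℕ → (ℕ → ℕ) → (ℕ → ℕ) → Prop) {M : Memory} (hM : Input n N src nbr M)
    (hT : Tree par num Q M) (hJ : J 0 (M.arr 7) (M.arr 2))
    (hstep : ∀ y < n, ∀ lab col, J y lab col → (lab y = 0 → J (y + 1) lab col) ∧
      (lab y ≠ 0 → ∀ nc, IsRecol n par y nc → ∀ lab' col',
        MergeStep n N src nbr c (lab y) nc lab col lab' col' → J (y + 1) lab' col')) :
    Wp (mergeProg c) (n * (n * 19 + N * 14 + 23 + 1) + 2) M (fun M => Input n N src nbr M ∧
      Tree par num Q M ∧ J n (M.arr 7) (M.arr 2)) := by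
  refine Wp.mono (Wp.straight_seq (T' := n * (n * 19 + N * 14 + 23 + 1) + 1) ?_)
    (by simp only [Program.size, ins]; omega) (fun _ h => h)
  simp only [wlp_ins_cons, wlp_ins_nil, Instr.exec]
  refine Wp.mono (Wp.seq (T' := 0) (Wp.loopUp (lo := 0) (hi := n) (T := n * 19 + N * 14 + 23)
    (fun y M => Input n N src nbr M ∧ Tree par num Q M ∧ M.reg 7 = y ∧ J y (M.arr 7) (M.arr 2))
    (Nat.zero_le n) ?_ ?_ ?_ ?_)) (by simp) (fun _ h => h)
  · refine ⟨hM.of_eq ?_ rfl rfl, hT.of_eq rfl rfl rfl rfl, by simp, hJ⟩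
    intro x hx
    interval_cases x <;> simp
  · exact fun k M h => ⟨h.2.2.1, h.1.r0⟩
  · rintro y M - hy ⟨hM, hT, hr7, hJ⟩
    refine Wp.mono (Wp.straight_seq (T' := n * 19 + N * 14 + 22) (Program.wlp_mono (Q := fun M' =>
      (∀ x, x ≠ 8 → M'.reg x = M.reg x) ∧ M'.arr = M.arr ∧ M'.reg 8 = M.arr 7 y) ?_ ?_))
      (by simp only [Program.size, ins]; omega) (fun _ h => h)
    · simp only [wlp_ins_cons, wlp_ins_nil, Instr.exec]
      exact ⟨fun x hx => by simp [hx], rfl, by simp [hr7]⟩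
    rintro M₁ ⟨h1r, h1a, h18⟩
    have hM₁ : Input n N src nbr M₁ :=
      hM.of_eq (fun x hx => h1r x (by omega)) (by rw [h1a]) (by rw [h1a])
    have hT₁ : Tree par num Q M₁ :=
      hT.of_eq (by rw [h1a]) (by rw [h1a]) (by rw [h1a]) (by rw [h1a])
    have e7 : M₁.reg 7 = y := by rw [h1r 7 (by omega), hr7]
    obtain ⟨hs0, hs1⟩ := hstep y hy _ _ hJ
    refine Wp.mono (Wp.seq (T' := 1) (Wp.mono (Wp.cond (T := n * 19 + N * 14 + 20) (T' := 0)
      (Q := fun M' => Input n N src nbr M' ∧ Tree par num Q M' ∧ M'.reg 7 = y ∧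
        J (y + 1) (M'.arr 7) (M'.arr 2)) (fun h => ?_) (fun h => ?_)) le_rfl ?_))
      (by simp) (fun _ h => h)
    · have h : M.arr 7 y ≠ 0 := by
        simp only [Test.holds, hM₁.r2, h18] at h
        omega
      refine Wp.mono (mergeBody_spec hG hS hM₁ hT₁ (by rw [h1a]) (by rw [h1a]) e7 h18 h) le_rfl ?_
      rintro M' ⟨hM', hT', h7, nc, hnc, hmerge⟩
      exact ⟨hM', hT', h7, hs1 h nc hnc _ _ hmerge⟩
    · have h : M.arr 7 y = 0 := by
        simp only [Test.holds, hM₁.r2, h18] at h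
        omega
      refine Wp.of_wlp (P := .skip) (show _ ∧ _ from ⟨hM₁, hT₁, e7, ?_⟩)
      rw [h1a]
      exact hs0 h
    · rintro M' ⟨hM', hT', h7, hJ'⟩
      refine Wp.mono (Wp.of_wlp ?_) (by simp [Program.size, ins, block]) (fun _ h => h)
      simp only [wlp_block_cons, wlp_block_nil, wlp_ins_cons, wlp_ins_nil, Instr.exec]
      refine ⟨hM'.of_eq ?_ rfl rfl, hT'.of_eq rfl rfl rfl rfl, by simp [h7], hJ'⟩
      intro x hx
      interval_cases x <;> simp
  · rintro M ⟨hM, hT, -, hJ⟩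
    exact Wp.of_wlp (P := .skip) (show _ ∧ _ from ⟨hM, hT, hJ⟩)


/-! ### The excess and its change under merging -/

/-- The set of the ordered pairs `(src i, nbr i)` with `i < N`. -/
def dartSet (N : ℕ) (src nbr : ℕ → ℕ) : Finset (ℕ × ℕ) :=
  (Finset.range N).image fun i => (src i, nbr i)

theorem IsDarts.mem_dartSet {adj : ℕ → ℕ → Prop} {N : ℕ} {src nbr : ℕ → ℕ}
    (hD : IsDarts adj N src nbr) {p : ℕ × ℕ} : p ∈ dartSet N src nbr ↔ adj p.1 p.2 := by
  simp only [dartSet, Finset.mem_image, Finset.mem_range]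
  constructor
  · rintro ⟨i, hi, rfl⟩
    exact hD.adj_of i hi
  · intro h
    obtain ⟨i, hi, h1, h2⟩ := hD.surj h
    exact ⟨i, hi, Prod.ext h1 h2⟩

theorem IsDarts.sum_dartSet {adj : ℕ → ℕ → Prop} {N : ℕ} {src nbr : ℕ → ℕ} {R : Type}
    [AddCommMonoid R] (hD : IsDarts adj N src nbr) (f : ℕ × ℕ → R) :
    ∑ i ∈ Finset.range N, f (src i, nbr i) = ∑ p ∈ dartSet N src nbr, f p := by
  rw [dartSet, Finset.sum_image]
  intro i hi j hj hij
  simp only [Prod.mk.injEq] at hij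
  exact hD.inj i (Finset.mem_range.1 hi) j (Finset.mem_range.1 hj) hij.1 hij.2

theorem sum_swap {R : Type} [AddCommMonoid R] {E : Finset (ℕ × ℕ)} (hE : ∀ p ∈ E, p.swap ∈ E)
    (f : ℕ × ℕ → R) : ∑ p ∈ E, f p.swap = ∑ p ∈ E, f p :=
  Finset.sum_bij (fun p _ => p.swap) hE (fun _ _ _ _ h => Prod.swap_injective h)
    (fun p hp => ⟨p.swap, hE p hp, Prod.swap_swap p⟩) fun _ _ => rfl

/-- The number of cut darts minus the number of uncut ones, among the darts inside the pieces. -/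
def score (E : Finset (ℕ × ℕ)) (lab col : ℕ → ℕ) : ℤ :=
  ∑ p ∈ E, if lab p.1 = lab p.2 then (if col p.1 = col p.2 then -1 else 1) else 0

/-- Only darts inside the piece of `t` and darts between it and the piece of `0` change their
contribution. The former all counted `1`, since the old colouring is proper there, so each
monochromatic one loses `2`. The latter counted `0`, and each such edge now contributes `1` or `-1`
twice. Flipping exchanges cut and uncut. -/
theorem score_merge {n N t : ℕ} {adj : ℕ → ℕ → Prop} {src nbr lab col nc lab' col' : ℕ → ℕ}
    (hG : IsConn n adj) (hD : IsDarts adj N src nbr) (ht : t ≠ 0) (hcol : ∀ v < n, col v ≤ 1)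
    (hnc : ∀ v < n, nc v ≤ 1)
    (hpiece : ∀ u v, adj u v → lab u = t → lab v = t → col u ≠ col v) (flip : Bool)
    (hlab' : ∀ v < n, lab' v = if lab v = t then 0 else lab v)
    (hcol' : ∀ v < n, col' v = if lab v = t then
      (if flip then (if nc v = 0 then 1 else 0) else nc v) else col v) :
    score (dartSet N src nbr) lab' col' = score (dartSet N src nbr) lab col +
      2 * (if flip then (uncutCount N src nbr lab col nc t : ℤ) - cutCount N src nbr lab col nc t
        else (cutCount N src nbr lab col nc t : ℤ) - uncutCount N src nbr lab col nc t) -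
      2 * monoCount N src nbr lab nc t := by
  set E := dartSet N src nbr with hEdef
  have hE : ∀ p ∈ E, p.swap ∈ E := by
    intro p hp
    rw [hEdef, hD.mem_dartSet] at hp ⊢
    exact hG.symm hp
  let s : ℤ := if flip then -1 else 1
  let g : ℕ × ℕ → ℤ := fun p =>
    s * ((if lab p.1 = t ∧ lab p.2 = 0 ∧ nc p.1 ≠ col p.2 then 1 else 0) -
      if lab p.1 = t ∧ lab p.2 = 0 ∧ nc p.1 = col p.2 then 1 else 0)
  let m : ℕ × ℕ → ℤ := fun p => if lab p.1 = t ∧ lab p.2 = t ∧ nc p.1 = nc p.2 then 1 else 0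
  have hg : ∑ p ∈ E, g p = s * ((cutCount N src nbr lab col nc t : ℤ) -
      uncutCount N src nbr lab col nc t) := by
    rw [← hD.sum_dartSet, cutCount, uncutCount]
    push_cast
    rw [← Finset.sum_sub_distrib, Finset.mul_sum]
  have hm : ∑ p ∈ E, m p = monoCount N src nbr lab nc t := by
    rw [← hD.sum_dartSet, monoCount]
    push_cast
    rfl
  -- The comparison is made dart by dart; `g p` and `g p.swap` take care of the two directions of an
  -- edge between the two pieces.
  have key : score E lab' col' = ∑ p ∈ E,
      ((if lab p.1 = lab p.2 then (if col p.1 = col p.2 then -1 else 1) else 0) + g p +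
        g p.swap - 2 * m p) := by
    refine Finset.sum_congr rfl fun p hp => ?_
    rw [hEdef, hD.mem_dartSet] at hp
    obtain ⟨u, v⟩ := p
    have hu := hG.lt hp
    have hv := hG.lt (hG.symm hp)
    have c1 := hcol u hu
    have c2 := hcol v hv
    have d1 := hnc u hu
    have d2 := hnc v hv
    have h1 := hpiece u v hp
    simp only at hu hv c1 c2 d1 d2 h1 ⊢
    simp only [g, m, s, Prod.swap_prod_mk]
    rw [hlab' u hu, hlab' v hv, hcol' u hu, hcol' v hv]
    by_cases hut : lab u = t <;> by_cases hvt : lab v = t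
    · have h2 := h1 hut hvt
      simp only [hut, hvt, ht, h2, if_true, if_false, true_and, false_and]
      cases flip <;> simp only [Bool.false_eq_true, if_true, if_false] <;> split_ifs <;>
        first | omega | contradiction
    · by_cases hv0 : lab v = 0
      · simp only [hut, hv0, ht, ht.symm, if_true, if_false, true_and, false_and]
        cases flip <;> simp only [Bool.false_eq_true, if_true, if_false] <;> split_ifs <;> omega
      · have hv0' : ¬ 0 = lab v := fun h => hv0 h.symm
        have hvt' : ¬ t = lab v := fun h => hvt h.symm
        simp only [hut, hv0, hv0', hvt, hvt', if_true, if_false, true_and, false_and]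
        simp
    · by_cases hu0 : lab u = 0
      · simp only [hvt, hu0, ht, ht.symm, if_true, if_false, true_and, false_and]
        cases flip <;> simp only [Bool.false_eq_true, if_true, if_false] <;> split_ifs <;> omega
      · have hu0' : ¬ 0 = lab u := fun h => hu0 h.symm
        have hut' : ¬ t = lab u := fun h => hut h.symm
        simp only [hvt, hu0, hut, if_true, if_false, true_and, false_and]
        simp
    · simp only [hut, hvt, if_false, false_and]
      simp
  rw [key, Finset.sum_sub_distrib, Finset.sum_add_distrib, Finset.sum_add_distrib,
    sum_swap hE g, show ∑ p ∈ E, 2 * m p = 2 * ∑ p ∈ E, m p from (Finset.mul_sum ..).symm, hg, hm,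
    score]
  simp only [s]
  cases flip
  · simp only [Bool.false_eq_true, if_false]; ring
  · simp only [if_true]; ring

theorem IsRecol.le_one {n : ℕ} {adj : ℕ → ℕ → Prop} {par num Q col nc : ℕ → ℕ} {y : ℕ}
    (hG : IsConn n adj) (hS : IsSearch n adj n par num Q col) (h : IsRecol n par y nc) :
    ∀ v < n, nc v ≤ 1 := by
  suffices ∀ k, ∀ v < n, num v ≤ k → nc v ≤ 1 from fun v hv => this _ v hv le_rfl
  intro k
  induction k with
  | zero => intro v hv hk; exact absurd (Nat.le_zero.1 hk) (hS.num_ne_zero hv)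
  | succ k ih =>
    intro v hv hk
    by_cases h0 : v = 0
    · rw [h0, h.zero]; exact zero_le_one
    · obtain ⟨h1, -, h3, -⟩ := hS.tree v hv h0 (hS.num_ne_zero hv)
      rw [h.succ v hv h0]
      have := ih _ (hG.lt h1) (by omega)
      split_ifs <;> omega


/-! ### The two merging passes -/

section
variable {n : ℕ} {adj : ℕ → ℕ → Prop} {par num Q col₀ lab₀ cut : ℕ → ℕ}

theorem IsPieces.lab_zero (hG : IsConn n adj) (hS : IsSearch n adj n par num Q col₀)
    (hP : IsPieces n adj 0 par num col₀ lab₀ cut) : lab₀ 0 = 0 := by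
  obtain ⟨j, hj⟩ := hP.anc 0 hG.pos
  rw [← hj]
  exact Function.iterate_fixed hS.par_zero j

/-- In a piece, all vertices are connected to the top `t` by the parent relation. -/
theorem IsPieces.iff_top (hG : IsConn n adj) (hS : IsSearch n adj n par num Q col₀)
    (hP : IsPieces n adj 0 par num col₀ lab₀ cut) {t : ℕ} (e : ℕ → Prop)
    (he : ∀ v < n, lab₀ v = t → v ≠ t → adj v (par v) → num (par v) < num v →
      lab₀ (par v) = t → (e v ↔ e (par v))) :
    ∀ v < n, lab₀ v = t → (e v ↔ e t) := by
  suffices ∀ k, ∀ v < n, num v ≤ k → lab₀ v = t → (e v ↔ e t) from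
    fun v hv => this _ v hv le_rfl
  intro k
  induction k with
  | zero => intro v hv hk; exact absurd (Nat.le_zero.1 hk) (hS.num_ne_zero hv)
  | succ k ih =>
    intro v hv hk hl
    by_cases hvt : v = t
    · rw [hvt]
    · have h0 : v ≠ 0 := by
        rintro rfl
        exact hvt ((hP.lab_zero hG hS).symm.trans hl)
      obtain ⟨h1, -, h3, -⟩ := hS.tree v hv h0 (hS.num_ne_zero hv)
      have h4 : lab₀ (par v) = t := by
        rw [hP.lab_par v hv (by rw [hl]; exact Ne.symm hvt), hl]
      exact (he v hv hl hvt (hG.symm h1) h3 h4).trans (ih _ (hG.lt h1) (by omega) h4)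

/-- The colouring `nc` is proper on the piece of `y` if `y` is its top. -/
theorem IsPieces.recol_ne (hG : IsConn n adj) (hS : IsSearch n adj n par num Q col₀)
    (hP : IsPieces n adj 0 par num col₀ lab₀ cut) {t : ℕ} {nc : ℕ → ℕ} (hnc : IsRecol n par t nc)
    {u v : ℕ} (huv : adj u v) (hu : lab₀ u = t) (hv : lab₀ v = t) : nc u ≠ nc v := by
  have hun := hG.lt huv
  have hvn := hG.lt (hG.symm huv)
  have h1 := hnc.le_one hG hS
  -- The monochromatic tree edge leads out of the piece at its top. Inside, `nc` and the depth
  -- parity both alternate along tree edges, so they agree everywhere or nowhere.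
  have key := hP.iff_top hG hS (t := t) (fun v => nc v = col₀ v) (by
    intro v hv hl hvt hadj hlt hl'
    have h2 := hP.col_ne v (par v) hadj (by rw [hl, hl'])
    have h0 : v ≠ 0 := by
      rintro rfl
      exact hvt ((hP.lab_zero hG hS).symm.trans hl)
    have h3 := hnc.succ v hv h0
    have h4 := h1 _ (hG.lt (hG.symm hadj))
    have h5 := hS.col_le v
    have h6 := hS.col_le (par v)
    rw [if_neg hvt] at h3
    split_ifs at h3 <;> omega)
  have h2 := key u hun hu
  have h3 := key v hvn hv
  have h4 := hP.col_ne u v huv (by rw [hu, hv])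
  have h5 := hS.col_le u
  have h6 := hS.col_le v
  have h7 := h1 u hun
  have h8 := h1 v hvn
  intro h9
  by_cases h10 : nc t = col₀ t
  · have := h2.2 h10
    have := h3.2 h10
    omega
  · have h11 : nc u ≠ col₀ u := fun h => h10 (h2.1 h)
    have h12 : nc v ≠ col₀ v := fun h => h10 (h3.1 h)
    omega

/-- `lab`, `col` arise from the pieces `lab₀`, `col₀` by merging some pieces with the piece of the
vertex `0`. -/
structure IsMerged (n : ℕ) (lab₀ col₀ lab col : ℕ → ℕ) : Prop where
  eq_or : ∀ v < n, lab v = 0 ∨ lab v = lab₀ v ∧ col v = col₀ v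
  zero : ∀ v < n, ∀ w < n, lab₀ v = lab₀ w → lab v = 0 → lab w = 0
  col_le : ∀ v < n, col v ≤ 1

/-- The strict tests of `MergeStep` turn into a gain of at least `2 - 2 * c`: a real profit of `2`
for `c = 0`, and merely no loss for `c = 1`. A piece not labelled `0` is still an original one, so
`score_merge` applies to it. -/
theorem IsMerged.step {N : ℕ} {src nbr lab col lab' col' nc : ℕ → ℕ} {c y : ℕ}
    (hG : IsConn n adj) (hD : IsDarts adj N src nbr) (hS : IsSearch n adj n par num Q col₀)
    (hP : IsPieces n adj 0 par num col₀ lab₀ cut) (h : IsMerged n lab₀ col₀ lab col)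
    (hy : y < n) (hy0 : lab y ≠ 0) (hnc : IsRecol n par y nc)
    (hstep : MergeStep n N src nbr c (lab y) nc lab col lab' col') :
    (lab' = lab ∧ col' = col ∧ cutCount N src nbr lab col nc (lab y) + c ≤
      uncutCount N src nbr lab col nc (lab y) + monoCount N src nbr lab nc (lab y) ∧
      uncutCount N src nbr lab col nc (lab y) + c ≤
      cutCount N src nbr lab col nc (lab y) + monoCount N src nbr lab nc (lab y)) ∨
    (IsMerged n lab₀ col₀ lab' col' ∧ (∀ v < n, lab v = 0 → lab' v = 0) ∧ lab' y = 0 ∧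
      score (dartSet N src nbr) lab col + 2 - 2 * c ≤ score (dartSet N src nbr) lab' col') := by
  rcases hstep with hstep | ⟨flip, hlab, hcol, hf, ht⟩
  · exact .inl hstep
  right
  have hnc1 := hnc.le_one hG hS
  have eq0 : ∀ v < n, lab v = lab y → lab v = lab₀ v ∧ col v = col₀ v := by
    intro v hv hl
    exact (h.eq_or v hv).resolve_left (by rwa [hl])
  have sc := score_merge hG hD hy0 h.col_le hnc1 (fun u v huv hu hv => by
    obtain ⟨h1, h2⟩ := eq0 u (hG.lt huv) hu
    obtain ⟨h3, h4⟩ := eq0 v (hG.lt (hG.symm huv)) hv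
    rw [h2, h4]
    exact hP.col_ne u v huv (by rw [← h1, ← h3, hu, hv])) flip hlab hcol
  refine ⟨⟨?_, ?_, ?_⟩, ?_, by rw [hlab y hy, if_pos rfl], ?_⟩
  · intro v hv
    rw [hlab v hv, hcol v hv]
    by_cases hl : lab v = lab y
    · simp [hl]
    · simpa [hl] using h.eq_or v hv
  · intro v hv w hw hvw hl
    rw [hlab v hv] at hl
    rw [hlab w hw]
    by_cases hlv : lab v = lab y
    · rcases h.eq_or w hw with h1 | h1
      · rw [h1]; simp
      · rw [if_pos]
        rw [h1.1, ← hvw, ← (eq0 v hv hlv).1, hlv]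
    · rw [if_neg hlv] at hl
      rw [h.zero v hv w hw hvw hl]; simp
  · intro v hv
    rw [hcol v hv]
    have h1 := hnc1 v hv
    have h2 := h.col_le v hv
    split_ifs <;> omega
  · intro v hv hl
    rw [hlab v hv, hl]; simp
  · rw [sc]
    cases flip
    · have := hf rfl
      simp only [Bool.false_eq_true, if_false]
      omega
    · have := ht rfl
      simp only [if_true]
      omega

/-- Recolouring at the top costs nothing inside the piece, which is why the second pass can always
merge there. -/
theorem IsMerged.monoCount_top {N : ℕ} {src nbr lab col nc : ℕ → ℕ} {t : ℕ}
    (hG : IsConn n adj) (hD : IsDarts adj N src nbr) (hS : IsSearch n adj n par num Q col₀)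
    (hP : IsPieces n adj 0 par num col₀ lab₀ cut) (h : IsMerged n lab₀ col₀ lab col) (ht : t ≠ 0)
    (hnc : IsRecol n par t nc) : monoCount N src nbr lab nc t = 0 := by
  refine Finset.sum_eq_zero fun i hi => if_neg ?_
  rintro ⟨h1, h2, h3⟩
  have hadj := hD.adj_of i (Finset.mem_range.1 hi)
  have h4 := ((h.eq_or _ (hG.lt hadj)).resolve_left (by rwa [h1])).1
  have h5 := ((h.eq_or _ (hG.lt (hG.symm hadj))).resolve_left (by rwa [h2])).1
  exact hP.recol_ne hG hS hnc hadj (by rw [← h4, h1]) (by rw [← h5, h2]) h3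

/-- No recolouring of the piece of `y` allows to merge it with profit. -/
def NoProfit (n N : ℕ) (src nbr par lab col : ℕ → ℕ) (y : ℕ) : Prop :=
  ∃ nc, IsRecol n par y nc ∧ cutCount N src nbr lab col nc (lab y) ≤
      uncutCount N src nbr lab col nc (lab y) + monoCount N src nbr lab nc (lab y) ∧
    uncutCount N src nbr lab col nc (lab y) ≤
      cutCount N src nbr lab col nc (lab y) + monoCount N src nbr lab nc (lab y)

/-- Once a merging has happened, the gain of `2` is secured, as later mergings only add to it. If
none happens, all tests were made on the original pieces and colours, so each of them witnesses
`NoProfit`. -/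
theorem mergeProg_zero_spec {N : ℕ} {src nbr : ℕ → ℕ} (hG : IsConn n adj)
    (hD : IsDarts adj N src nbr) (hS : IsSearch n adj n par num Q col₀) {M : Memory}
    (hM : Input n N src nbr M) (hT : Tree par num Q M) (h2 : M.arr 2 = col₀) (h7 : M.arr 7 = lab₀)
    (hP : IsPieces n adj 0 par num col₀ lab₀ cut) :
    Wp (mergeProg 0) (n * (n * 19 + N * 14 + 23 + 1) + 2) M (fun M => Input n N src nbr M ∧
      Tree par num Q M ∧ IsMerged n lab₀ col₀ (M.arr 7) (M.arr 2) ∧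
      (score (dartSet N src nbr) lab₀ col₀ + 2 ≤
          score (dartSet N src nbr) (M.arr 7) (M.arr 2) ∨
        M.arr 7 = lab₀ ∧ M.arr 2 = col₀ ∧
          ∀ y < n, lab₀ y ≠ 0 → NoProfit n N src nbr par lab₀ col₀ y)) := by
  refine mergeProg_spec hG hS (fun y lab col => IsMerged n lab₀ col₀ lab col ∧
      (score (dartSet N src nbr) lab₀ col₀ + 2 ≤ score (dartSet N src nbr) lab col ∨
        lab = lab₀ ∧ col = col₀ ∧
          ∀ y' < y, lab₀ y' ≠ 0 → NoProfit n N src nbr par lab₀ col₀ y')) hM hT ?_ ?_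
  · rw [h2, h7]
    refine ⟨⟨fun v _ => .inr ⟨rfl, rfl⟩, ?_, fun v _ => hS.col_le v⟩,
      .inr ⟨rfl, rfl, fun y hy => absurd hy (Nat.not_lt_zero y)⟩⟩
    intro v _ w _ hvw hv
    rw [← hvw, hv]
  · rintro y hy lab col ⟨hW, hor⟩
    constructor
    · intro h0
      refine ⟨hW, hor.imp_right ?_⟩
      rintro ⟨rfl, rfl, hall⟩
      refine ⟨rfl, rfl, fun y' hy' hl => ?_⟩
      rcases Nat.lt_succ_iff_lt_or_eq.1 hy' with h | rfl
      · exact hall y' h hl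
      · exact absurd h0 hl
    · intro h0 nc hnc lab' col' hstep
      rcases hW.step hG hD hS hP hy h0 hnc hstep with ⟨rfl, rfl, h1, h3⟩ | ⟨h1, -, -, h3⟩
      · refine ⟨hW, hor.imp_right ?_⟩
        rintro ⟨rfl, rfl, hall⟩
        refine ⟨rfl, rfl, fun y' hy' hl => ?_⟩
        rcases Nat.lt_succ_iff_lt_or_eq.1 hy' with h | rfl
        · exact hall y' h hl
        · exact ⟨nc, hnc, h1, h3⟩
      · refine ⟨h1, .inl ?_⟩
        simp only [Nat.cast_zero, mul_zero, sub_zero] at h3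
        rcases hor with h | ⟨rfl, rfl, -⟩
        · omega
        · exact h3

/-- If a piece is still unmerged at the turn of its top, then no edge inside it becomes
monochromatic, and one of the two ways of merging it does not lose. So everything ends up in the
piece of `0`. -/
theorem mergeProg_one_spec {N : ℕ} {src nbr : ℕ → ℕ} (hG : IsConn n adj)
    (hD : IsDarts adj N src nbr) (hS : IsSearch n adj n par num Q col₀) {M : Memory}
    (hM : Input n N src nbr M) (hT : Tree par num Q M)
    (hW : IsMerged n lab₀ col₀ (M.arr 7) (M.arr 2))
    (hP : IsPieces n adj 0 par num col₀ lab₀ cut) :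
    Wp (mergeProg 1) (n * (n * 19 + N * 14 + 23 + 1) + 2) M (fun M' =>
      (∀ v < n, M'.arr 7 v = 0) ∧ (∀ v < n, M'.arr 2 v ≤ 1) ∧
      score (dartSet N src nbr) (M.arr 7) (M.arr 2) ≤
          score (dartSet N src nbr) (M'.arr 7) (M'.arr 2)) := by
  refine Wp.mono (mergeProg_spec hG hS (fun y lab col => IsMerged n lab₀ col₀ lab col ∧
      score (dartSet N src nbr) (M.arr 7) (M.arr 2) ≤ score (dartSet N src nbr) lab col ∧
        ∀ y' < y, lab₀ y' = y' → lab y' = 0) hM hT ?_ ?_) le_rfl ?_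
  · exact ⟨hW, le_rfl, fun y hy => absurd hy (Nat.not_lt_zero y)⟩
  · rintro y hy lab col ⟨hW, hs, hall⟩
    constructor
    · intro h0
      refine ⟨hW, hs, fun y' hy' hl => ?_⟩
      rcases Nat.lt_succ_iff_lt_or_eq.1 hy' with h | rfl
      · exact hall y' h hl
      · exact h0
    · intro h0 nc hnc lab' col' hstep
      rcases hW.step hG hD hS hP hy h0 hnc hstep with ⟨rfl, rfl, h1, h3⟩ | ⟨h1, h2, h3, h4⟩
      · refine ⟨hW, hs, fun y' hy' hl => ?_⟩
        rcases Nat.lt_succ_iff_lt_or_eq.1 hy' with h | rfl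
        · exact hall y' h hl
        · have h5 := ((hW.eq_or y' hy).resolve_left h0).1
          rw [hl] at h5
          -- With no monochromatic edges, rejecting both ways would make each of the two counts
          -- exceed the other.
          have := hW.monoCount_top hG hD hS hP (t := lab' y') h0 (by rwa [h5])
          omega
      · refine ⟨h1, ?_, fun y' hy' hl => ?_⟩
        · simp only [Nat.cast_one, mul_one, add_sub_cancel_right] at h4
          exact hs.trans h4
        · rcases Nat.lt_succ_iff_lt_or_eq.1 hy' with h | rfl
          · exact h2 y' (by omega) (hall y' h hl)
          · exact h3
  · rintro M' ⟨-, -, hW', hs, hall⟩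
    refine ⟨fun v hv => ?_, hW'.col_le, hs⟩
    have h1 := hP.lab_lt v hv
    have h3 := hP.lab_lab v hv
    exact hW'.zero _ h1 v hv h3 (hall _ h1 h3)

end


/-! ### Counting edges inside the pieces and edges that a cut must miss -/

section
variable {n : ℕ} {adj : ℕ → ℕ → Prop} {par num Q col lab cut : ℕ → ℕ}

theorem IsPieces.par_lab_zero (hG : IsConn n adj) (hS : IsSearch n adj n par num Q col)
    (hP : IsPieces n adj 0 par num col lab cut) {v : ℕ} (hv : v < n) (h : lab v = 0) :
    lab (par v) = 0 := by
  by_cases h0 : v = 0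
  · rw [h0, hS.par_zero, hP.lab_zero hG hS]
  · rw [hP.lab_par v hv (by rw [h]; exact Ne.symm h0), h]

/-- The piece of the vertex `0` precedes the neighbouring pieces. -/
theorem IsPieces.num_lt (hG : IsConn n adj) (hS : IsSearch n adj n par num Q col)
    (hP : IsPieces n adj 0 par num col lab cut) {x w : ℕ} (hxw : adj x w) (hx : lab x ≠ 0)
    (hw : lab w = 0) : num w < num x := by
  have hxn := hG.lt hxw
  have hwn := hG.lt (hG.symm hxw)
  by_contra hlt
  have hne : num x ≠ num w := by
    intro h
    rw [hS.num_inj hxn hwn (hS.num_ne_zero hxn) h] at hx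
    exact hx hw
  obtain ⟨j, hj⟩ := hS.anc x w hxw (hS.num_ne_zero hxn) (by omega)
  -- The piece of `0` is closed under taking ancestors.
  have : ∀ j, ∀ v < n, lab v = 0 → lab (par^[j] v) = 0 := by
    intro j
    induction j with
    | zero => intro v _ h; exact h
    | succ j ih =>
      intro v hv h
      exact ih _ (hS.par_lt hG hv (hS.num_ne_zero hv)).1 (hP.par_lab_zero hG hS hv h)
  exact hx (hj ▸ this j w hwn hw)

/-- The tops of the pieces that do not contain the vertex `0`. -/
def tops (n : ℕ) (lab : ℕ → ℕ) : Finset ℕ := (Finset.range n).filter fun v => lab v = v ∧ v ≠ 0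

/-- The vertices that are not tops. -/
def nontops (n : ℕ) (lab : ℕ → ℕ) : Finset ℕ := (Finset.range n).filter fun v => lab v ≠ v

theorem IsPieces.card_tops (hG : IsConn n adj) (hS : IsSearch n adj n par num Q col)
    (hP : IsPieces n adj 0 par num col lab cut) :
    (tops n lab).card + (nontops n lab).card + 1 = n := by
  have h0 := hP.lab_zero hG hS
  have h1 : tops n lab ∪ nontops n lab = (Finset.range n).erase 0 := by
    ext v
    simp only [tops, nontops, Finset.mem_union, Finset.mem_filter, Finset.mem_range,
      Finset.mem_erase]
    by_cases hv : v = 0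
    · simp [hv, h0]
    · by_cases hl : lab v = v <;> simp [hv, hl]
  have h2 : Disjoint (tops n lab) (nontops n lab) := by
    rw [Finset.disjoint_left]
    intro v hv hv'
    exact (Finset.mem_filter.1 hv').2 (Finset.mem_filter.1 hv).2.1
  rw [← Finset.card_union_of_disjoint h2, h1, Finset.card_erase_of_mem (by simpa using hG.pos),
    Finset.card_range]
  have := hG.pos
  omega

/-- The darts of the trees that are given by the parents in a set `S`. -/
def treeDarts (par : ℕ → ℕ) (S : Finset ℕ) : Finset (ℕ × ℕ) :=
  S.image (fun v => (v, par v)) ∪ S.image fun v => (par v, v)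

theorem mem_treeDarts {S : Finset ℕ} {a b : ℕ} :
    (a, b) ∈ treeDarts par S ↔ a ∈ S ∧ b = par a ∨ b ∈ S ∧ a = par b := by
  simp only [treeDarts, Finset.mem_union, Finset.mem_image, Prod.mk.injEq]
  constructor
  · rintro (⟨v, hv, rfl, rfl⟩ | ⟨v, hv, rfl, rfl⟩)
    · exact .inl ⟨hv, rfl⟩
    · exact .inr ⟨hv, rfl⟩
  · rintro (⟨hv, rfl⟩ | ⟨hv, rfl⟩)
    · exact .inl ⟨a, hv, rfl, rfl⟩
    · exact .inr ⟨b, hv, rfl, rfl⟩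

theorem card_treeDarts_le (S : Finset ℕ) : (treeDarts par S).card ≤ 2 * S.card := by
  have h1 := Finset.card_union_le (S.image fun v => (v, par v)) (S.image fun v => (par v, v))
  have h2 := Finset.card_image_le (s := S) (f := fun v => (v, par v))
  have h3 := Finset.card_image_le (s := S) (f := fun v => (par v, v))
  rw [treeDarts]
  omega

theorem card_treeDarts (S : Finset ℕ) (hlt : ∀ v ∈ S, num (par v) < num v) :
    (treeDarts par S).card = 2 * S.card := by
  rw [treeDarts, Finset.card_union_of_disjoint, Finset.card_image_of_injective,
    Finset.card_image_of_injective, two_mul]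
  · intro v w h
    exact (Prod.mk.inj h).2
  · intro v w h
    exact (Prod.mk.inj h).1
  · rw [Finset.disjoint_left]
    rintro ⟨a, b⟩ h h'
    obtain ⟨v, hv, h1⟩ := Finset.mem_image.1 h
    obtain ⟨w, hw, h2⟩ := Finset.mem_image.1 h'
    obtain ⟨rfl, rfl⟩ := Prod.mk.inj h1
    obtain ⟨h3, h4⟩ := Prod.mk.inj h2
    have := hlt v hv
    have := hlt w hw
    rw [h3, h4] at this
    omega

variable {E : Finset (ℕ × ℕ)}

/-- The darts inside the pieces. -/
def innerDarts (E : Finset (ℕ × ℕ)) (lab : ℕ → ℕ) : Finset (ℕ × ℕ) :=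
  E.filter fun p => lab p.1 = lab p.2

theorem IsPieces.nontop_spec (hG : IsConn n adj) (hS : IsSearch n adj n par num Q col)
    (hP : IsPieces n adj 0 par num col lab cut) {v : ℕ} (hv : v < n) (hl : lab v ≠ v) :
    adj v (par v) ∧ num (par v) < num v ∧ lab (par v) = lab v := by
  have h0 : v ≠ 0 := by
    rintro rfl
    exact hl (hP.lab_zero hG hS)
  obtain ⟨h1, -, h3, -⟩ := hS.tree v hv h0 (hS.num_ne_zero hv)
  exact ⟨hG.symm h1, h3, hP.lab_par v hv hl⟩

theorem IsPieces.treeDarts_subset (hG : IsConn n adj) (hE : ∀ p, p ∈ E ↔ adj p.1 p.2)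
    (hS : IsSearch n adj n par num Q col) (hP : IsPieces n adj 0 par num col lab cut) :
    treeDarts par (nontops n lab) ⊆ innerDarts E lab := by
  rintro ⟨a, b⟩ h
  rw [innerDarts, Finset.mem_filter, hE]
  rcases mem_treeDarts.1 h with ⟨h1, rfl⟩ | ⟨h1, rfl⟩
  · obtain ⟨h2, h3⟩ := Finset.mem_filter.1 h1
    obtain ⟨h4, -, h6⟩ := hP.nontop_spec hG hS (Finset.mem_range.1 h2) h3
    exact ⟨h4, h6.symm⟩
  · obtain ⟨h2, h3⟩ := Finset.mem_filter.1 h1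
    obtain ⟨h4, -, h6⟩ := hP.nontop_spec hG hS (Finset.mem_range.1 h2) h3
    exact ⟨hG.symm h4, h6⟩

/-- The tree darts within the pieces are inner darts, two for each vertex that is not a top. Any
other inner dart comes with its reversal, so a surplus is at least `2`. -/
theorem IsPieces.card_innerDarts (hG : IsConn n adj) (hE : ∀ p, p ∈ E ↔ adj p.1 p.2)
    (hS : IsSearch n adj n par num Q col) (hP : IsPieces n adj 0 par num col lab cut) :
    2 * (nontops n lab).card ≤ (innerDarts E lab).card ∧
    (2 * (nontops n lab).card + 2 ≤ (innerDarts E lab).card ∨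
      innerDarts E lab = treeDarts par (nontops n lab)) := by
  have hsub := hP.treeDarts_subset hG hE hS
  have hcard := card_treeDarts (par := par) (num := num) (nontops n lab) (fun v hv => by
    obtain ⟨h2, h3⟩ := Finset.mem_filter.1 hv
    exact (hP.nontop_spec hG hS (Finset.mem_range.1 h2) h3).2.1)
  refine ⟨hcard ▸ Finset.card_le_card hsub, ?_⟩
  by_cases heq : innerDarts E lab = treeDarts par (nontops n lab)
  · exact .inr heq
  left
  have hnot : ¬ innerDarts E lab ⊆ treeDarts par (nontops n lab) :=
    fun h => heq (Finset.Subset.antisymm h hsub)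
  rw [Finset.not_subset] at hnot
  obtain ⟨⟨a, b⟩, h1, h2⟩ := hnot
  have h1' := Finset.mem_filter.1 h1
  have hab : adj a b := (hE _).1 h1'.1
  have h3 : (b, a) ∈ innerDarts E lab :=
    Finset.mem_filter.2 ⟨(hE _).2 (hG.symm hab), h1'.2.symm⟩
  have h4 : (b, a) ∉ treeDarts par (nontops n lab) := by
    rw [mem_treeDarts] at h2 ⊢
    exact fun h => h2 h.symm
  have hne : a ≠ b := by rintro rfl; exact hG.irrefl _ hab
  have h5 : (a, b) ∉ insert (b, a) (treeDarts par (nontops n lab)) := by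
    rw [Finset.mem_insert, not_or]
    exact ⟨fun h => hne (Prod.mk.inj h).1, h2⟩
  have h6 : insert (a, b) (insert (b, a) (treeDarts par (nontops n lab))) ⊆ innerDarts E lab :=
    Finset.insert_subset h1 (Finset.insert_subset h3 hsub)
  have h7 := Finset.card_le_card h6
  rw [Finset.card_insert_of_notMem h5, Finset.card_insert_of_notMem h4] at h7
  omega

/-- The pieces are properly coloured, so every inner dart counts `1`. -/
theorem IsPieces.score_eq (hE : ∀ p, p ∈ E ↔ adj p.1 p.2)
    (hP : IsPieces n adj 0 par num col lab cut) :
    score E lab col = (innerDarts E lab).card := by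
  rw [score, innerDarts, Finset.card_filter]
  push_cast
  refine Finset.sum_congr rfl fun p hp => ?_
  by_cases h : lab p.1 = lab p.2
  · rw [if_pos h, if_neg (hP.col_ne _ _ ((hE p).1 hp) h), if_pos h]
  · rw [if_neg h, if_neg h]

variable {σ : ℕ → ℕ}

/-- The edges that are not cut by `σ`, directed to the root of the search tree. -/
def uncutDown (E : Finset (ℕ × ℕ)) (num σ : ℕ → ℕ) : Finset (ℕ × ℕ) :=
  E.filter fun p => num p.2 < num p.1 ∧ σ p.1 = σ p.2

theorem card_uncutDown (hG : IsConn n adj) (hE : ∀ p, p ∈ E ↔ adj p.1 p.2)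
    (hS : IsSearch n adj n par num Q col) (σ : ℕ → ℕ) :
    (E.filter fun p => σ p.1 = σ p.2).card = 2 * (uncutDown E num σ).card := by
  have hswap : ∀ p ∈ E, p.swap ∈ E := fun p hp => (hE _).2 (hG.symm ((hE p).1 hp))
  rw [uncutDown, Finset.card_filter, Finset.card_filter, two_mul]
  nth_rw 2 [← sum_swap hswap]
  rw [← Finset.sum_add_distrib]
  refine Finset.sum_congr rfl fun ⟨u, v⟩ hp => ?_
  have hadj : adj u v := (hE _).1 hp
  have hu := hG.lt hadj
  have hv := hG.lt (hG.symm hadj)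
  have hne : num u ≠ num v := by
    intro h
    rw [hS.num_inj hu hv (hS.num_ne_zero hu) h] at hadj
    exact hG.irrefl _ hadj
  simp only [Prod.swap_prod_mk]
  by_cases h : σ u = σ v
  · rcases Nat.lt_or_gt_of_ne hne with h1 | h1
    · simp [h, h1, h1.le]
    · simp [h, h1, h1.le]
  · simp [h, Ne.symm h]

/-- Suppose `σ` cuts all edges going down in number from the piece of `t`. Then on the piece `σ` is
the depth parity up to a swap. The odd cycle provides `w` in the piece, adjacent to `par t` and of
parity different from `t`; so `σ` separates `t` from `w` and cannot cut both edges to `par t`. -/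
theorem IsPieces.exists_uncut (hG : IsConn n adj) (hE : ∀ p, p ∈ E ↔ adj p.1 p.2)
    (hS : IsSearch n adj n par num Q col) (hP : IsPieces n adj 0 par num col lab cut)
    (hσ : ∀ v < n, σ v ≤ 1) {t : ℕ} (ht : t ∈ tops n lab) :
    ∃ p ∈ uncutDown E num σ, lab p.1 = t := by
  by_contra! hcon
  have hcut : ∀ x w, adj x w → num w < num x → lab x = t → σ x ≠ σ w := fun x w h1 h2 h3 h4 =>
    hcon (x, w) (Finset.mem_filter.2 ⟨(hE _).2 h1, h2, h4⟩) h3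
  obtain ⟨htn, hlt, ht0⟩ := Finset.mem_filter.1 ht
  rw [Finset.mem_range] at htn
  obtain ⟨h1, h2, h3, h4⟩ := hS.tree t htn ht0 (hS.num_ne_zero htn)
  have hpar := hG.lt h1
  have hc : cut t = 1 := by
    by_contra hc
    have h5 := hP.cut_le t
    have h6 := hP.num_par t htn ht0 (Nat.pos_of_ne_zero (hS.num_ne_zero htn)) hlt (by omega)
    omega
  obtain ⟨-, -, w, hw, hadj, hcol⟩ := hP.odd t htn hc
  have hwn := hG.lt (hG.symm hadj)
  have key := hP.iff_top hG hS (t := t) (fun v => σ v = col v) (by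
    intro v hv hl _ ha hnum hl'
    have k1 := hcut v (par v) ha hnum hl
    have k2 := hP.col_ne v (par v) ha (by rw [hl, hl'])
    have k3 := hσ v hv
    have k4 := hσ _ (hG.lt (hG.symm ha))
    have k5 := hS.col_le v
    have k6 := hS.col_le (par v)
    omega) w hwn hw
  have hle := (hS.anc_le hG hwn (hw ▸ hP.anc w hwn)).2
  have k1 := hcut t (par t) (hG.symm h1) h3 hlt
  have k2 := hcut w (par t) (hG.symm hadj) (by omega) hw
  have k3 := hσ t htn
  have k4 := hσ w hwn
  have k5 := hσ _ hpar
  have k6 := hS.col_le w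
  have k7 := hS.col_le t
  have k8 := hS.col_le (par t)
  omega

/-- The map sending an uncut edge to the piece of its later discovered end hits every top. If there
are no more such edges than tops, it is a bijection onto the tops, so each piece has exactly one
uncut edge and the piece of `0` has none. -/
theorem IsPieces.card_tops_le (hG : IsConn n adj) (hE : ∀ p, p ∈ E ↔ adj p.1 p.2)
    (hS : IsSearch n adj n par num Q col) (hP : IsPieces n adj 0 par num col lab cut)
    (hσ : ∀ v < n, σ v ≤ 1) :
    (tops n lab).card ≤ (uncutDown E num σ).card ∧
    ((tops n lab).card + 1 ≤ (uncutDown E num σ).card ∨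
      (∀ p ∈ uncutDown E num σ, lab p.1 ≠ 0) ∧
      ∀ p ∈ uncutDown E num σ, ∀ p' ∈ uncutDown E num σ, lab p.1 = lab p'.1 → p = p') := by
  have hsub : tops n lab ⊆ (uncutDown E num σ).image fun p => lab p.1 := by
    intro t ht
    obtain ⟨p, hp, h⟩ := hP.exists_uncut hG hE hS hσ ht
    exact Finset.mem_image.2 ⟨p, hp, h⟩
  have h1 := Finset.card_le_card hsub
  have h2 := Finset.card_image_le (s := uncutDown E num σ) (f := fun p => lab p.1)
  refine ⟨h1.trans h2, ?_⟩
  by_cases h3 : (tops n lab).card + 1 ≤ (uncutDown E num σ).card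
  · exact .inl h3
  right
  have h4 := Finset.eq_of_subset_of_card_le hsub (by omega)
  have h5 := Finset.card_image_iff.1 (le_antisymm h2 (by omega))
  refine ⟨fun p hp h => ?_, fun p hp p' hp' h => h5 hp hp' h⟩
  have h6 : lab p.1 ∈ tops n lab := h4 ▸ Finset.mem_image_of_mem _ hp
  exact (Finset.mem_filter.1 h6).2.2 h

end


/-! ### The extremal case and the approximation inequality -/

section
variable {n N : ℕ} {adj : ℕ → ℕ → Prop} {src nbr par num Q col lab cut σ : ℕ → ℕ}

/-- The darts from the piece of `t` to the piece of `0`. -/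
def crossDarts (E : Finset (ℕ × ℕ)) (lab : ℕ → ℕ) (t : ℕ) : Finset (ℕ × ℕ) :=
  E.filter fun p => lab p.1 = t ∧ lab p.2 = 0

theorem IsDarts.cutCount_add_uncutCount (hD : IsDarts adj N src nbr) (lab col nc : ℕ → ℕ) (t : ℕ) :
    cutCount N src nbr lab col nc t + uncutCount N src nbr lab col nc t =
      (crossDarts (dartSet N src nbr) lab t).card := by
  rw [crossDarts, Finset.card_filter, ← hD.sum_dartSet fun p : ℕ × ℕ =>
    if lab p.1 = t ∧ lab p.2 = 0 then 1 else 0, cutCount, uncutCount, ← Finset.sum_add_distrib]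
  refine Finset.sum_congr rfl fun i _ => ?_
  by_cases h1 : lab (src i) = t <;> by_cases h2 : lab (nbr i) = 0 <;>
    by_cases h3 : nc (src i) = col (nbr i) <;> simp [h1, h2, h3]

theorem IsDarts.count_eq_card (hD : IsDarts adj N src nbr) (f : ℕ × ℕ → Prop) [DecidablePred f] :
    ∑ i ∈ Finset.range N, (if f (src i, nbr i) then 1 else 0) =
      ((dartSet N src nbr).filter f).card := by
  rw [Finset.card_filter, ← hD.sum_dartSet fun p : ℕ × ℕ => if f p then 1 else 0]

/-- If no recolouring of the piece of `t` is profitable, and the graph and `σ` are extremal, then at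
most two edges lead from the piece of `t` to the piece of `0`. -/
theorem IsPieces.card_crossDarts_le (hG : IsConn n adj) (hD : IsDarts adj N src nbr)
    (hS : IsSearch n adj n par num Q col) (hP : IsPieces n adj 0 par num col lab cut)
    (hσ : ∀ v < n, σ v ≤ 1)
    (hinner : innerDarts (dartSet N src nbr) lab = treeDarts par (nontops n lab))
    (hU0 : ∀ p ∈ uncutDown (dartSet N src nbr) num σ, lab p.1 ≠ 0)
    (hU : ∀ p ∈ uncutDown (dartSet N src nbr) num σ, ∀ p' ∈ uncutDown (dartSet N src nbr) num σ,
      lab p.1 = lab p'.1 → p = p')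
    (hNP : ∀ y < n, lab y ≠ 0 → NoProfit n N src nbr par lab col y) {t : ℕ}
    (ht : t ∈ tops n lab) : (crossDarts (dartSet N src nbr) lab t).card ≤ 2 := by
  set E := dartSet N src nbr with hEdef
  have hE : ∀ p, p ∈ E ↔ adj p.1 p.2 := fun p => hD.mem_dartSet
  obtain ⟨⟨a, b⟩, hab, hat⟩ := hP.exists_uncut hG hE hS hσ ht
  obtain ⟨htn, hlt, ht0⟩ := Finset.mem_filter.1 ht
  rw [Finset.mem_range] at htn
  obtain ⟨h1, h2, h3⟩ := Finset.mem_filter.1 hab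
  simp only at hat h2 h3
  have hadj : adj a b := (hE _).1 h1
  have han := hG.lt hadj
  have hbn := hG.lt (hG.symm hadj)
  -- the only edge of the piece that is not cut by `σ`
  have huniq : ∀ x w, adj x w → num w < num x → lab x = t → σ x = σ w → x = a ∧ w = b := by
    intro x w k1 k2 k3 k4
    have := hU (x, w) (Finset.mem_filter.2 ⟨(hE _).2 k1, k2, k4⟩) (a, b) hab (by simp [k3, hat])
    exact Prod.mk.inj this
  -- On the piece of `0`, where `σ` cuts all edges, `σ` is the depth parity up to a swap.
  have hR := hP.iff_top hG hS (t := 0) (fun v => col v = σ v) (by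
    intro v hv hl _ ha hnum hl'
    have k1 : σ v ≠ σ (par v) := fun h =>
      hU0 (v, par v) (Finset.mem_filter.2 ⟨(hE _).2 ha, hnum, h⟩) hl
    have k2 := hP.col_ne v (par v) ha (by rw [hl, hl'])
    have k3 := hσ v hv
    have k4 := hσ _ (hG.lt (hG.symm ha))
    have k5 := hS.col_le v
    have k6 := hS.col_le (par v)
    omega)
  have htree : ∀ x w, adj x w → lab x = lab w → num w < num x → x ≠ 0 ∧ w = par x := by
    intro x w k1 k2 k3
    have k4 : (x, w) ∈ treeDarts par (nontops n lab) :=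
      hinner ▸ Finset.mem_filter.2 ⟨(hE _).2 k1, k2⟩
    have hnt : ∀ v ∈ nontops n lab, v ≠ 0 ∧ num (par v) < num v := by
      intro v hv
      obtain ⟨k5, k6⟩ := Finset.mem_filter.1 hv
      refine ⟨?_, (hP.nontop_spec hG hS (Finset.mem_range.1 k5) k6).2.1⟩
      rintro rfl
      exact k6 (hP.lab_zero hG hS)
    rcases mem_treeDarts.1 k4 with ⟨k5, rfl⟩ | ⟨k5, rfl⟩
    · exact ⟨(hnt _ k5).1, rfl⟩
    · have := (hnt _ k5).2
      omega
  -- The recolouring has to imitate `σ`: if the uncut edge lies inside the piece, it is the tree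
  -- edge above `a`, so `y = a`; otherwise all tree edges of the piece are cut, and `y = t` puts the
  -- monochromatic edge outside.
  obtain ⟨y, hyn, hyt, hy⟩ : ∃ y < n, lab y = t ∧
      (y = if lab b = t then a else t) := by
    by_cases hb : lab b = t
    · exact ⟨a, han, hat, by rw [if_pos hb]⟩
    · exact ⟨t, htn, hlt, by rw [if_neg hb]⟩
  obtain ⟨nc, hnc, hp1, hp2⟩ := hNP y hyn (by rwa [hyt])
  rw [hyt] at hp1 hp2
  have hnc1 := hnc.le_one hG hS
  -- By the choice of `y`, the colourings `nc` and `σ` have the same monochromatic tree edges inside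
  -- the piece, so they agree on it up to a swap.
  have hPt := hP.iff_top hG hS (t := t) (fun v => nc v = σ v) (by
    intro v hv hl hvt ha hnum hl'
    have hv0 : v ≠ 0 := by
      rintro rfl
      exact hvt ((hP.lab_zero hG hS).symm.trans hl)
    have k1 := hnc.succ v hv hv0
    have k2 : σ v = σ (par v) ↔ v = y := by
      constructor
      · intro h
        obtain ⟨k3, k4⟩ := huniq v (par v) ha hnum hl h
        rw [hy, if_pos (by rw [← k4, hl'])]
        exact k3
      · intro h
        have hb : lab b = t := by
          by_contra hb
          rw [if_neg hb] at hy
          exact hvt (h.trans hy)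
        rw [if_pos hb] at hy
        obtain ⟨-, k4⟩ := htree a b hadj (by rw [hat, hb]) h2
        rw [h, hy, ← k4]
        exact h3
    have k3 := hσ v hv
    have k4 := hσ _ (hG.lt (hG.symm ha))
    have k5 := hnc1 _ (hG.lt (hG.symm ha))
    by_cases hvy : v = y
    · rw [if_pos hvy] at k1
      have := k2.2 hvy
      omega
    · rw [if_neg hvy] at k1
      have : σ v ≠ σ (par v) := fun h => hvy (k2.1 h)
      split_ifs at k1 <;> omega)
  -- `K` is the set of the darts to the piece of `0` that are not cut by `σ`
  set K := E.filter fun p => (lab p.1 = t ∧ lab p.2 = 0) ∧ σ p.1 = σ p.2 with hK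
  have hKsub : K ⊆ {(a, b)} := by
    rintro ⟨u, v⟩ hp
    obtain ⟨k1, ⟨k2, k3⟩, k4⟩ := Finset.mem_filter.1 hp
    have k5 : adj u v := (hE _).1 k1
    obtain ⟨rfl, rfl⟩ := huniq u v k5
      (hP.num_lt hG hS k5 (by simpa only [k2] using ht0) k3) k2 k4
    exact Finset.mem_singleton_self _
  -- Both `nc` on the piece of `t` and `col` on the piece of `0` are `σ` up to swaps. Depending on
  -- the parity of these swaps, the edges between the pieces that are uncut by `σ` are the uncut or
  -- the cut ones of the merging.
  have hk : cutCount N src nbr lab col nc t = K.card ∨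
      uncutCount N src nbr lab col nc t = K.card := by
    have hcc : cutCount N src nbr lab col nc t =
        (E.filter fun p => lab p.1 = t ∧ lab p.2 = 0 ∧ nc p.1 ≠ col p.2).card :=
      hD.count_eq_card fun p : ℕ × ℕ => lab p.1 = t ∧ lab p.2 = 0 ∧ nc p.1 ≠ col p.2
    have huc : uncutCount N src nbr lab col nc t =
        (E.filter fun p => lab p.1 = t ∧ lab p.2 = 0 ∧ nc p.1 = col p.2).card :=
      hD.count_eq_card fun p : ℕ × ℕ => lab p.1 = t ∧ lab p.2 = 0 ∧ nc p.1 = col p.2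
    have hval : ∀ p ∈ E, lab p.1 = t → lab p.2 = 0 →
        (nc p.1 = σ p.1 ↔ nc t = σ t) ∧ (col p.2 = σ p.2 ↔ col 0 = σ 0) ∧
        nc p.1 ≤ 1 ∧ σ p.1 ≤ 1 ∧ σ p.2 ≤ 1 ∧ col p.2 ≤ 1 := by
      intro p hp k1 k2
      have k3 := (hE p).1 hp
      have k4 := hG.lt k3
      have k5 := hG.lt (hG.symm k3)
      exact ⟨hPt _ k4 k1, hR _ k5 k2, hnc1 _ k4, hσ _ k4, hσ _ k5, hS.col_le _⟩
    rw [hcc, huc, hK]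
    by_cases hs : nc t = σ t ↔ col 0 = σ 0
    · right
      congr 1
      refine Finset.filter_congr fun p hp => ?_
      rw [and_assoc]
      refine and_congr_right fun k1 => and_congr_right fun k2 => ?_
      have := hval p hp k1 k2
      omega
    · left
      congr 1
      refine Finset.filter_congr fun p hp => ?_
      rw [and_assoc]
      refine and_congr_right fun k1 => and_congr_right fun k2 => ?_
      have := hval p hp k1 k2
      omega
  -- The single uncut edge of `σ` lies either inside the piece, giving two monochromatic darts and
  -- empty `K`, or leaves it, giving no monochromatic dart and at most one element of `K`. As one
  -- count is `K.card`, lack of profit bounds the other by `K.card` plus the monochromatic darts,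
  -- and the total by `2`.
  have hmono : 2 * K.card + monoCount N src nbr lab nc t ≤ 2 := by
    have hmc : monoCount N src nbr lab nc t =
        (E.filter fun p => lab p.1 = t ∧ lab p.2 = t ∧ nc p.1 = nc p.2).card :=
      hD.count_eq_card fun p : ℕ × ℕ => lab p.1 = t ∧ lab p.2 = t ∧ nc p.1 = nc p.2
    rw [hmc]
    by_cases hb : lab b = t
    · rw [if_pos hb] at hy
      have hK0 : K = ∅ := by
        rw [Finset.eq_empty_iff_forall_notMem]
        intro p hp
        have k1 := Finset.mem_singleton.1 (hKsub hp)
        subst k1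
        exact ht0 (hb ▸ (Finset.mem_filter.1 hp).2.1.2)
      rw [hK0, Finset.card_empty]
      have hsub : (E.filter fun p => lab p.1 = t ∧ lab p.2 = t ∧ nc p.1 = nc p.2) ⊆
          {(a, b), (b, a)} := by
        have aux : ∀ u v, adj u v → lab u = t → lab v = t → nc u = nc v → num v < num u →
            u = a ∧ v = b := by
          intro u v k1 k2 k3 k4 k5
          obtain ⟨k6, rfl⟩ := htree u v k1 (by rw [k2, k3]) k5
          have k7 := hnc.succ u (hG.lt k1) k6
          by_cases huy : u = y
          · obtain ⟨-, k8⟩ := htree a b hadj (by rw [hat, hb]) h2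
            rw [k8, huy, hy]
            exact ⟨rfl, rfl⟩
          · rw [if_neg huy] at k7
            split_ifs at k7 <;> omega
        rintro ⟨u, v⟩ hp
        obtain ⟨k1, k2, k3, k4⟩ := Finset.mem_filter.1 hp
        simp only at k2 k3 k4
        have k5 : adj u v := (hE _).1 k1
        rw [Finset.mem_insert, Finset.mem_singleton]
        rcases lt_trichotomy (num v) (num u) with k6 | k6 | k6
        · obtain ⟨rfl, rfl⟩ := aux u v k5 k2 k3 k4 k6
          exact .inl rfl
        · have := hS.num_inj (hG.lt (hG.symm k5)) (hG.lt k5)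
            (hS.num_ne_zero (hG.lt (hG.symm k5))) k6
          rw [this] at k5
          exact absurd k5 (hG.irrefl _)
        · obtain ⟨rfl, rfl⟩ := aux v u (hG.symm k5) k3 k2 k4.symm k6
          exact .inr rfl
      have := (Finset.card_le_card hsub).trans Finset.card_le_two
      omega
    · rw [if_neg hb] at hy
      have h0 : (E.filter fun p => lab p.1 = t ∧ lab p.2 = t ∧ nc p.1 = nc p.2) = ∅ := by
        rw [Finset.filter_eq_empty_iff]
        rintro p hp ⟨k1, k2, k3⟩
        exact hP.recol_ne hG hS (hy ▸ hnc) ((hE p).1 hp) k1 k2 k3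
      rw [h0, Finset.card_empty]
      have := Finset.card_le_card hKsub
      rw [Finset.card_singleton] at this
      omega
  rw [← hD.cutCount_add_uncutCount lab col nc t]
  omega

/-- Let `R` be the piece of `0`. The darts inside `R` belong to a tree, hence number at most `2 *
(R.card - 1) ≤ Δ * (R.card - 1)`; at most two darts lead from `R` to each other piece; and at most
`Δ` darts start at each vertex outside `R`. -/
theorem IsPieces.card_le (hG : IsConn n adj) (hD : IsDarts adj N src nbr)
    (hS : IsSearch n adj n par num Q col) (hP : IsPieces n adj 0 par num col lab cut)
    (hinner : innerDarts (dartSet N src nbr) lab = treeDarts par (nontops n lab)) {Δ : ℕ}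
    (hΔ : 2 ≤ Δ)
    (hdeg : ∀ v < n, ((dartSet N src nbr).filter fun p => p.1 = v).card ≤ Δ)
    (hcross : ∀ t ∈ tops n lab, (crossDarts (dartSet N src nbr) lab t).card ≤ 2) :
    (dartSet N src nbr).card ≤ Δ * (n - 1) + 2 * (tops n lab).card := by
  set E := dartSet N src nbr with hEdef
  have hE : ∀ p, p ∈ E ↔ adj p.1 p.2 := fun p => hD.mem_dartSet
  set R := (Finset.range n).filter fun v => lab v = 0 with hRdef
  have h0R : 0 ∈ R := Finset.mem_filter.2 ⟨Finset.mem_range.2 hG.pos, hP.lab_zero hG hS⟩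
  have hRn : R.card + ((Finset.range n).filter fun v => lab v ≠ 0).card = n := by
    rw [hRdef, Finset.card_filter_add_card_filter_not, Finset.card_range]
  have hsub : E ⊆ treeDarts par (R.erase 0) ∪
      ((tops n lab).biUnion fun t => (crossDarts E lab t).image Prod.swap) ∪
      ((Finset.range n).filter fun v => lab v ≠ 0).biUnion fun v => E.filter fun p => p.1 = v := by
    rintro ⟨u, v⟩ hp
    have huv : adj u v := (hE _).1 hp
    have hu := hG.lt huv
    have hv := hG.lt (hG.symm huv)
    rw [Finset.mem_union, Finset.mem_union]
    by_cases h1 : lab u = 0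
    · left
      by_cases h2 : lab v = 0
      · left
        have h3 : (u, v) ∈ treeDarts par (nontops n lab) :=
          hinner ▸ Finset.mem_filter.2 ⟨hp, by rw [h1, h2]⟩
        rw [mem_treeDarts] at h3 ⊢
        refine h3.imp (fun h => ⟨?_, h.2⟩) fun h => ⟨?_, h.2⟩
        · refine Finset.mem_erase.2 ⟨?_, Finset.mem_filter.2 ⟨Finset.mem_range.2 hu, h1⟩⟩
          exact fun h0 => (Finset.mem_filter.1 h.1).2 (by rw [h0, hP.lab_zero hG hS])
        · refine Finset.mem_erase.2 ⟨?_, Finset.mem_filter.2 ⟨Finset.mem_range.2 hv, h2⟩⟩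
          exact fun h0 => (Finset.mem_filter.1 h.1).2 (by rw [h0, hP.lab_zero hG hS])
      · right
        refine Finset.mem_biUnion.2 ⟨lab v, Finset.mem_filter.2 ⟨Finset.mem_range.2
          (hP.lab_lt v hv), hP.lab_lab v hv, h2⟩, Finset.mem_image.2 ⟨(v, u), ?_, rfl⟩⟩
        exact Finset.mem_filter.2 ⟨(hE _).2 (hG.symm huv), rfl, h1⟩
    · right
      exact Finset.mem_biUnion.2 ⟨u, Finset.mem_filter.2 ⟨Finset.mem_range.2 hu, h1⟩,
        Finset.mem_filter.2 ⟨hp, rfl⟩⟩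
  have h1 := card_treeDarts_le (par := par) (R.erase 0)
  rw [Finset.card_erase_of_mem h0R] at h1
  have h2 : ((tops n lab).biUnion fun t => (crossDarts E lab t).image Prod.swap).card ≤
      (tops n lab).card * 2 :=
    Finset.card_biUnion_le_card_mul _ _ _ fun t ht => Finset.card_image_le.trans (hcross t ht)
  have h3 : (((Finset.range n).filter fun v => lab v ≠ 0).biUnion
      fun v => E.filter fun p => p.1 = v).card ≤
      ((Finset.range n).filter fun v => lab v ≠ 0).card * Δ :=
    Finset.card_biUnion_le_card_mul _ _ _ fun v hv =>
      hdeg v (Finset.mem_range.1 (Finset.mem_filter.1 hv).1)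
  have h4 := Finset.card_le_card hsub
  have h5 := Finset.card_union_le (treeDarts par (R.erase 0) ∪
      ((tops n lab).biUnion fun t => (crossDarts E lab t).image Prod.swap))
      (((Finset.range n).filter fun v => lab v ≠ 0).biUnion fun v => E.filter fun p => p.1 = v)
  have h6 := Finset.card_union_le (treeDarts par (R.erase 0))
      ((tops n lab).biUnion fun t => (crossDarts E lab t).image Prod.swap)
  have hRpos : 0 < R.card := Finset.card_pos.2 ⟨0, h0R⟩
  have h7 : n - 1 = (R.card - 1) + ((Finset.range n).filter fun v => lab v ≠ 0).card := by omega
  have h8 : 2 * (R.card - 1) ≤ Δ * (R.card - 1) := Nat.mul_le_mul_right _ hΔ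
  have h9 := Nat.mul_comm ((Finset.range n).filter fun v => lab v ≠ 0).card Δ
  rw [h7, Nat.mul_add]
  omega

/-- The excess `D` that is achieved by the algorithm, together with the number of the edges that are
not cut by `σ`, is large compared with the cut of `σ`. -/
theorem IsPieces.approx (hG : IsConn n adj) (hD : IsDarts adj N src nbr)
    (hS : IsSearch n adj n par num Q col) (hP : IsPieces n adj 0 par num col lab cut) {Δ : ℕ}
    (hΔ : 2 ≤ Δ)
    (hdeg : ∀ v < n, ((dartSet N src nbr).filter fun p => p.1 = v).card ≤ Δ)
    (hσ : ∀ v < n, σ v ≤ 1) {D : ℤ}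
    (h : score (dartSet N src nbr) lab col + 2 ≤ D ∨ score (dartSet N src nbr) lab col ≤ D ∧
      ∀ y < n, lab y ≠ 0 → NoProfit n N src nbr par lab col y) :
    2 * (((dartSet N src nbr).filter fun p => σ p.1 ≠ σ p.2).card : ℤ) ≤
      Δ * (D + ((dartSet N src nbr).filter fun p => σ p.1 = σ p.2).card) := by
  set E := dartSet N src nbr with hEdef
  have hE : ∀ p, p ∈ E ↔ adj p.1 p.2 := fun p => hD.mem_dartSet
  have hsc := hP.score_eq hE
  rw [hsc] at h
  have hunc := card_uncutDown hG hE hS σ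
  have htot : (E.filter fun p => σ p.1 = σ p.2).card + (E.filter fun p => σ p.1 ≠ σ p.2).card =
      E.card := Finset.card_filter_add_card_filter_not _
  have htops := hP.card_tops hG hS
  obtain ⟨hi, hi'⟩ := hP.card_innerDarts hG hE hS
  obtain ⟨ht, ht'⟩ := hP.card_tops_le hG hE hS hσ
  have hEn : E.card ≤ Δ * n := by
    have hsub : E ⊆ (Finset.range n).biUnion fun v => E.filter fun p => p.1 = v := fun p hp =>
      Finset.mem_biUnion.2 ⟨p.1, Finset.mem_range.2 (hG.lt ((hE p).1 hp)),
        Finset.mem_filter.2 ⟨hp, rfl⟩⟩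
    have h1 : ((Finset.range n).biUnion fun v => E.filter fun p => p.1 = v).card ≤
        (Finset.range n).card * Δ := Finset.card_biUnion_le_card_mul _ _ _ fun v hv =>
      hdeg v (Finset.mem_range.1 hv)
    rw [Finset.card_range] at h1
    rw [Nat.mul_comm]
    exact (Finset.card_le_card hsub).trans h1
  have hΔ0 : (0 : ℤ) ≤ Δ := Int.natCast_nonneg _
  -- In any case the sum on the right is at least `2 * (n - 1)`, and `2 * n` already suffices since
  -- there are at most `Δ * n` darts. Otherwise none of the possible gains of `2` occurs, and the
  -- situation is extremal.
  by_cases hgood : 2 * (n : ℤ) ≤ D + (E.filter fun p => σ p.1 = σ p.2).card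
  · have h1 := mul_le_mul_of_nonneg_left hgood hΔ0
    have h2 : (E.card : ℤ) ≤ Δ * n := by exact_mod_cast hEn
    have h3 : ((E.filter fun p => σ p.1 ≠ σ p.2).card : ℤ) ≤ E.card := by
      exact_mod_cast Finset.card_filter_le _ _
    linarith
  have hbad : innerDarts E lab = treeDarts par (nontops n lab) := by
    refine hi'.resolve_left fun h1 => hgood ?_
    omega
  obtain ⟨hU0, hU⟩ := ht'.resolve_left fun h1 => hgood (by omega)
  have hNP := (h.resolve_left fun h1 => hgood (by omega)).2
  have h1 := hP.card_le hG hD hS hbad hΔ hdeg fun t ht =>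
    hP.card_crossDarts_le hG hD hS hσ hbad hU0 hU hNP ht
  rw [← hEdef] at h1
  have h2 : 2 * ((n - 1 : ℕ) : ℤ) ≤ D + (E.filter fun p => σ p.1 = σ p.2).card := by omega
  have h3 := mul_le_mul_of_nonneg_left h2 hΔ0
  -- The summand `2 * (tops n lab).card` in the bound for all darts is absorbed by the darts that
  -- `σ` leaves uncut.
  have h4 : (E.filter fun p => σ p.1 ≠ σ p.2).card ≤ Δ * (n - 1) := by omega
  have h5 : ((E.filter fun p => σ p.1 ≠ σ p.2).card : ℤ) ≤ Δ * ((n - 1 : ℕ) : ℤ) := by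
    exact_mod_cast h4
  linarith

end


/-! ### The complete algorithm -/

/-- Compute a cut of a graph: find a depth-first search tree, decompose it into bipartite pieces,
and merge them, first with profit and then at will. -/
def maxCutProg : Program :=
  .seq srcProg (.seq searchProg (.seq labelProg (.seq (mergeProg 0) (mergeProg 1))))

theorem score_zero {n : ℕ} {adj : ℕ → ℕ → Prop} {E : Finset (ℕ × ℕ)} {lab : ℕ → ℕ}
    (hG : IsConn n adj) (hE : ∀ p, p ∈ E ↔ adj p.1 p.2) (hlab : ∀ v < n, lab v = 0)
    (col : ℕ → ℕ) : score E lab col =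
      (E.filter fun p => col p.1 ≠ col p.2).card - (E.filter fun p => col p.1 = col p.2).card := by
  rw [score, Finset.card_filter, Finset.card_filter]
  push_cast
  rw [← Finset.sum_sub_distrib]
  refine Finset.sum_congr rfl fun p hp => ?_
  have h := (hE p).1 hp
  rw [hlab _ (hG.lt h), hlab _ (hG.lt (hG.symm h)), if_pos rfl]
  by_cases hc : col p.1 = col p.2 <;> simp [hc]

/-- The sources of the darts are known only after `srcProg` has run, so `hD` is required for every
array that `srcProg` may produce. -/
theorem maxCutProg_spec {n Δ : ℕ} {adj : ℕ → ℕ → Prop} {off nbr : ℕ → ℕ} {E : Finset (ℕ × ℕ)}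
    (hG : IsConn n adj) (hE : ∀ p, p ∈ E ↔ adj p.1 p.2) (h0 : off 0 = 0)
    (hoff : ∀ v < n, off v ≤ off (v + 1))
    (hD : ∀ src : ℕ → ℕ, (∀ v < n, ∀ i, off v ≤ i → i < off (v + 1) → src i = v) →
      IsDarts adj (off n) src nbr)
    (hΔ : 2 ≤ Δ) (hdeg : ∀ v < n, (E.filter fun p => p.1 = v).card ≤ Δ) (hn : n ≤ off n) :
    Wp maxCutProg (190 * (n * off n)) (inputMemory n off nbr) (fun M =>
      (∀ v < n, M.arr 2 v ≤ 1) ∧ ∀ σ : ℕ → ℕ, (∀ v < n, σ v ≤ 1) →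
        (Δ + 2) * (E.filter fun p => σ p.1 ≠ σ p.2).card ≤
          Δ * (2 * (E.filter fun p => M.arr 2 p.1 ≠ M.arr 2 p.2).card)) := by
  set N := off n with hN
  -- The constant is the sum of all coefficients, after `n * n`, `n` and `1` have been bounded by `n
  -- * N` and `n - 1` by `n`.
  have hT : n * (N * 3 + 5 + 1) + 2 + ((n - 1) * (N * 11 + 10 + 1) + 4 +
      (n * (2 + 1) + n * (N * 11 + n * 8 + 8 + 1) + 4 + (n * (n * 19 + N * 14 + 23 + 1) + 2 +
        (n * (n * 19 + N * 14 + 23 + 1) + 2)))) ≤ 190 * (n * N) := by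
    have h1 : 1 ≤ n := hG.pos
    have h2 : n * n ≤ n * N := Nat.mul_le_mul_left n hn
    have h3 : n * 1 ≤ n * N := Nat.mul_le_mul_left n (h1.trans hn)
    have h4 : (n - 1) * (N * 11 + 10 + 1) ≤ n * (N * 11 + 10 + 1) :=
      Nat.mul_le_mul_right _ (Nat.sub_le n 1)
    nlinarith
  refine Wp.mono (Wp.seq (Wp.mono (srcProg_spec h0 hoff) le_rfl ?_)) hT (fun _ h => h)
  rintro M₁ ⟨r0, r1, r2, r3, a1, a3, hz⟩
  have hD := hD (M₁.arr 3) a3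
  refine Wp.seq (Wp.mono (searchProg_spec hG hD ⟨r0, r1, r2, r3, a1, rfl⟩ hz) le_rfl ?_)
  rintro M₂ ⟨hM, hS, -, h8, h9⟩
  refine Wp.seq (Wp.mono
    (labelProg_spec hG hD hS hM ⟨rfl, rfl, rfl, by rw [h9]⟩ rfl h8) le_rfl ?_)
  rintro M₃ ⟨hM, hT, h2, hP⟩
  refine Wp.seq (Wp.mono (mergeProg_zero_spec hG hD hS hM hT h2 rfl hP) le_rfl ?_)
  rintro M₄ ⟨hM, hT, hW, hscore⟩
  refine Wp.mono (mergeProg_one_spec hG hD hS hM hT hW hP) le_rfl ?_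
  rintro M₅ ⟨hlab, hcol, hle⟩
  refine ⟨hcol, fun σ hσ => ?_⟩
  obtain rfl : E = dartSet N (M₁.arr 3) nbr := Finset.ext fun p => by rw [hE, hD.mem_dartSet]
  have h1 := hP.approx hG hD hS hΔ hdeg hσ
    (D := score (dartSet N (M₁.arr 3) nbr) (M₅.arr 7) (M₅.arr 2)) (by
      rcases hscore with h | ⟨h, h', hNP⟩
      · exact .inl (h.trans hle)
      · rw [h, h'] at hle
        exact .inr ⟨hle, hNP⟩)
  rw [score_zero hG hE hlab] at h1
  set E := dartSet N (M₁.arr 3) nbr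
  have h2 : (E.filter fun p => σ p.1 = σ p.2).card + (E.filter fun p => σ p.1 ≠ σ p.2).card =
      E.card := Finset.card_filter_add_card_filter_not _
  have h3 : (E.filter fun p => M₅.arr 2 p.1 = M₅.arr 2 p.2).card +
      (E.filter fun p => M₅.arr 2 p.1 ≠ M₅.arr 2 p.2).card = E.card :=
    Finset.card_filter_add_card_filter_not _
  rw [← h3] at h2
  generalize (E.filter fun p => σ p.1 = σ p.2).card = a at h1 h2
  generalize (E.filter fun p => σ p.1 ≠ σ p.2).card = b at h1 h2 ⊢
  generalize (E.filter fun p => M₅.arr 2 p.1 = M₅.arr 2 p.2).card = c at h1 h2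
  generalize (E.filter fun p => M₅.arr 2 p.1 ≠ M₅.arr 2 p.2).card = d at h1 h2 ⊢
  zify at h2 ⊢
  -- Both cuts have the same total number of darts, so the excess plus the uncut darts of `σ` turns
  -- into `2 * d - b`, which is the ratio in disguise.
  have h4 : (d - c + a : ℤ) = 2 * d - b := by linarith
  rw [h4] at h1
  linarith

/-! ### Translation to graphs on `Fin n` -/

/-- A cut edge has exactly one orientation that leaves `A`. -/
theorem cutSize_eq {V : Type*} [Fintype V] [DecidableEq V] (G : SimpleGraph V)
    [DecidableRel G.Adj] (A : Finset V) : cutSize G A = (Finset.univ.filter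
    fun q : V × V => G.Adj q.1 q.2 ∧ q.1 ∈ A ∧ q.2 ∉ A).card := by
  rw [cutSize]
  symm
  refine Finset.card_bij (fun q _ => s(q.1, q.2)) ?_ ?_ ?_
  · intro q hq
    obtain ⟨-, h1, h2, h3⟩ := Finset.mem_filter.1 hq
    exact Finset.mem_filter.2 ⟨SimpleGraph.mem_edgeFinset.2 h1, q.1, h2, q.2,
      Finset.mem_compl.2 h3, rfl⟩
  · rintro ⟨a, b⟩ hq ⟨c, d⟩ hq' h
    obtain ⟨-, -, h2, -⟩ := Finset.mem_filter.1 hq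
    obtain ⟨-, -, -, h3⟩ := Finset.mem_filter.1 hq'
    rcases Sym2.eq_iff.1 h with ⟨h4, h5⟩ | ⟨h4, -⟩
    · exact Prod.ext h4 h5
    · exact absurd (h4 ▸ h2) h3
  · intro e he
    obtain ⟨h1, u, hu, v, hv, rfl⟩ := Finset.mem_filter.1 he
    exact ⟨(u, v), Finset.mem_filter.2 ⟨Finset.mem_univ _, SimpleGraph.mem_edgeFinset.1 h1, hu,
      Finset.mem_compl.1 hv⟩, rfl⟩

section Graph
variable {n : ℕ} (G : SimpleGraph (Fin n))

/-- The adjacency relation of `G` as a relation of natural numbers. -/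
def natAdj (u v : ℕ) : Prop := ∃ (hu : u < n) (hv : v < n), G.Adj ⟨u, hu⟩ ⟨v, hv⟩

variable {G}

theorem isConn_natAdj (hG : G.Connected) : IsConn n (natAdj G) := by
  have hpos : 0 < n := by
    obtain ⟨v⟩ := hG.nonempty
    exact v.pos
  refine ⟨hpos, fun h => h.1, fun ⟨h1, h2, h3⟩ => ⟨h2, h1, h3.symm⟩,
    fun u ⟨_, _, h⟩ => G.irrefl h, fun S h0 hS v hv => ?_⟩
  have h1 : G.Reachable ⟨0, hpos⟩ ⟨v, hv⟩ := hG.preconnected _ _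
  obtain ⟨w⟩ := h1
  have key : ∀ {a b : Fin n}, G.Walk a b → S a → S b := by
    intro a b w
    induction w with
    | nil => exact id
    | cons h _ ih => exact fun ha => ih (hS _ _ ⟨Fin.is_lt _, Fin.is_lt _, h⟩ ha)
  exact key w h0

/-- The blocks of the adjacency lists partition the indices below `off n`, and `bijOn` makes each
block list the neighbours of its vertex once. -/
theorem IsAdjacencyLists.isDarts {off nbr src : ℕ → ℕ} (h : IsAdjacencyLists G off nbr)
    (hsrc : ∀ v < n, ∀ i, off v ≤ i → i < off (v + 1) → src i = v) :
    IsDarts (natAdj G) (off n) src nbr := by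
  have hmem : ∀ m ≤ n, ∀ i < off m, ∃ v < n, off v ≤ i ∧ i < off (v + 1) := by
    intro m
    induction m with
    | zero => intro _ i hi; rw [h.off_zero] at hi; exact absurd hi (Nat.not_lt_zero i)
    | succ m ih =>
      intro hm i hi
      by_cases hi' : i < off m
      · exact ih (by omega) i hi'
      · exact ⟨m, hm, not_lt.1 hi', hi⟩
  have hmono : ∀ m ≤ n, ∀ u ≤ m, off u ≤ off m := by
    intro m
    induction m with
    | zero => intro _ u hu; rw [Nat.le_zero.1 hu]
    | succ m ih =>
      intro hm u hu
      rcases Nat.lt_or_ge u (m + 1) with h1 | h1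
      · exact (ih (by omega) u (by omega)).trans (h.off_le ⟨m, hm⟩)
      · rw [le_antisymm hu h1]
  refine ⟨fun i hi => ?_, ?_, fun i hi j hj hij hn => ?_⟩
  · obtain ⟨v, hv, h1, h2⟩ := hmem n le_rfl i hi
    obtain ⟨w, hw, hwk⟩ := (h.bijOn ⟨v, hv⟩).mapsTo (Set.mem_Ico.2 ⟨h1, h2⟩)
    rw [hsrc v hv i h1 h2, ← hwk]
    exact ⟨hv, w.is_lt, hw⟩
  · rintro u v ⟨hu, hv, hadj⟩
    obtain ⟨i, ⟨h1, h2⟩, h3⟩ := (h.bijOn ⟨u, hu⟩).surjOn ⟨⟨v, hv⟩, hadj, rfl⟩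
    exact ⟨i, h2.trans_le (hmono n le_rfl _ hu), hsrc u hu i h1 h2, h3⟩
  · obtain ⟨v, hv, h1, h2⟩ := hmem n le_rfl i hi
    obtain ⟨w, hw, h3, h4⟩ := hmem n le_rfl j hj
    rw [hsrc v hv i h1 h2, hsrc w hw j h3 h4] at hij
    subst hij
    exact (h.bijOn ⟨v, hv⟩).injOn (Set.mem_Ico.2 ⟨h1, h2⟩) (Set.mem_Ico.2 ⟨h3, h4⟩) hn

variable [DecidableRel G.Adj]

variable (G) in
/-- The ordered pairs of adjacent vertices. -/
def natDarts : Finset (ℕ × ℕ) :=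
  (Finset.univ.filter fun q : Fin n × Fin n => G.Adj q.1 q.2).image fun q => (q.1.val, q.2.val)

theorem mem_natDarts {p : ℕ × ℕ} : p ∈ natDarts G ↔ natAdj G p.1 p.2 := by
  simp only [natDarts, Finset.mem_image, Finset.mem_filter, Finset.mem_univ, true_and]
  constructor
  · rintro ⟨q, hq, rfl⟩
    exact ⟨q.1.is_lt, q.2.is_lt, hq⟩
  · rintro ⟨hu, hv, h⟩
    exact ⟨(⟨p.1, hu⟩, ⟨p.2, hv⟩), h, rfl⟩

theorem card_filter_natDarts (f : ℕ × ℕ → Prop) [DecidablePred f] :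
    ((natDarts G).filter f).card = (Finset.univ.filter fun q : Fin n × Fin n =>
      G.Adj q.1 q.2 ∧ f (q.1.val, q.2.val)).card := by
  rw [natDarts, Finset.filter_image, Finset.card_image_of_injective, Finset.filter_filter]
  rintro ⟨a, b⟩ ⟨c, d⟩ h
  obtain ⟨h1, h2⟩ := Prod.mk.inj h
  exact Prod.ext (Fin.ext h1) (Fin.ext h2)

theorem card_filter_natDarts_fst (v : Fin n) :
    ((natDarts G).filter fun p => p.1 = v.val).card = G.degree v := by
  rw [card_filter_natDarts, ← SimpleGraph.card_neighborFinset_eq_degree]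
  refine Finset.card_bij' (fun q _ => q.2) (fun w _ => (v, w)) ?_ ?_ ?_ ?_
  · rintro ⟨a, b⟩ h
    obtain ⟨-, h1, h2⟩ := Finset.mem_filter.1 h
    rw [SimpleGraph.mem_neighborFinset]
    exact Fin.ext h2 ▸ h1
  · intro w hw
    rw [SimpleGraph.mem_neighborFinset] at hw
    exact Finset.mem_filter.2 ⟨Finset.mem_univ _, hw, rfl⟩
  · rintro ⟨a, b⟩ h
    obtain ⟨-, h1, h2⟩ := Finset.mem_filter.1 h
    exact Prod.ext (Fin.ext h2).symm rfl
  · intro w _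
    rfl

theorem card_natDarts_eq_sum : (natDarts G).card = ∑ v, G.degree v := by
  have h : (natDarts G).card = ∑ v ∈ Finset.range n,
      ((natDarts G).filter fun p => p.1 = v).card :=
    Finset.card_eq_sum_card_fiberwise fun p hp =>
      Finset.mem_coe.2 (Finset.mem_range.2 (mem_natDarts.1 hp).1)
  rw [h, Finset.sum_range]
  exact Finset.sum_congr rfl fun v _ => card_filter_natDarts_fst v

theorem IsDarts.eq_card {nbr src : ℕ → ℕ} {N : ℕ}
    (hD : IsDarts (natAdj G) N src nbr) : N = (natDarts G).card := by
  have h1 : natDarts G = dartSet N src nbr := Finset.ext fun p => by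
    rw [mem_natDarts, hD.mem_dartSet]
  rw [h1, dartSet, Finset.card_image_of_injOn, Finset.card_range]
  intro i hi j hj hij
  obtain ⟨h2, h3⟩ := Prod.mk.inj hij
  exact hD.inj i (Finset.mem_range.1 hi) j (Finset.mem_range.1 hj) h2 h3

theorem two_mul_cutSize (A : Finset (Fin n)) (σ : ℕ → ℕ)
    (hσ : ∀ v : Fin n, σ v = if v ∈ A then 1 else 0) :
    2 * cutSize G A = ((natDarts G).filter fun p => σ p.1 ≠ σ p.2).card := by
  rw [card_filter_natDarts, two_mul]
  have h1 : (Finset.univ.filter fun q : Fin n × Fin n => G.Adj q.1 q.2 ∧ q.1 ∈ A ∧ q.2 ∉ A).card =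
      (Finset.univ.filter fun q : Fin n × Fin n => G.Adj q.1 q.2 ∧ q.2 ∈ A ∧ q.1 ∉ A).card := by
    refine Finset.card_bij' (fun q _ => q.swap) (fun q _ => q.swap) ?_ ?_
      (fun _ _ => rfl) fun _ _ => rfl
    · intro q hq
      obtain ⟨-, h1, h2⟩ := Finset.mem_filter.1 hq
      exact Finset.mem_filter.2 ⟨Finset.mem_univ _, h1.symm, h2⟩
    · intro q hq
      obtain ⟨-, h1, h2⟩ := Finset.mem_filter.1 hq
      exact Finset.mem_filter.2 ⟨Finset.mem_univ _, h1.symm, h2⟩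
  rw [cutSize_eq]
  nth_rw 2 [h1]
  rw [← Finset.card_union_of_disjoint, ← Finset.filter_or]
  · congr 1
    refine Finset.filter_congr fun q _ => ?_
    rw [hσ, hσ]
    by_cases h2 : q.1 ∈ A <;> by_cases h3 : q.2 ∈ A <;> simp [h2, h3]
  · rw [Finset.disjoint_filter]
    exact fun q _ h2 h3 => h3.2.2 h2.2.1

end Graph

end MaxCut

theorem corollary1 :
    ∃ (P : MaxCut.Program) (C : ℕ),
      ∀ (n : ℕ) (G : SimpleGraph (Fin n)) [DecidableRel G.Adj],
        G.Connected → 2 ≤ G.maxDegree →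
        ∀ off nbr : ℕ → ℕ, MaxCut.IsAdjacencyLists G off nbr →
          ∃ (t : ℕ) (M : MaxCut.Memory) (A : Finset (Fin n)),
            MaxCut.Runs P (MaxCut.inputMemory n off nbr) t M ∧
            t ≤ C * (n * G.edgeFinset.card) ∧
            MaxCut.OutputsCut M A ∧
            (1 / 2 + 1 / (G.maxDegree : ℝ)) * (MaxCut.mc G : ℝ) ≤ (MaxCut.cutSize G A : ℝ) := by
  -- The constant is twice `190`, because the number of darts is twice the number of edges.
  refine ⟨MaxCut.maxCutProg, 380, fun n G _ hG hΔ off nbr hadj => ?_⟩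
  have hconn := MaxCut.isConn_natAdj hG
  have hoff : ∀ v < n, off v ≤ off (v + 1) := fun v hv => hadj.off_le ⟨v, hv⟩
  have hsum := SimpleGraph.sum_degrees_eq_twice_card_edges G
  -- A source function is needed to count the darts; the memory left by the first phase supplies
  -- one.
  obtain ⟨src, hsrc⟩ : ∃ src : ℕ → ℕ, ∀ v < n, ∀ i, off v ≤ i → i < off (v + 1) → src i = v := by
    obtain ⟨t, M, -, -, h⟩ := MaxCut.srcProg_spec (nbr := nbr) hadj.off_zero hoff
    exact ⟨M.arr 3, h.2.2.2.2.2.1⟩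
  have hN : off n = 2 * G.edgeFinset.card := by
    rw [(hadj.isDarts hsrc).eq_card, MaxCut.card_natDarts_eq_sum, hsum]
  have hnt : Nontrivial (Fin n) := by
    by_contra h
    rw [not_nontrivial_iff_subsingleton] at h
    have : G.maxDegree ≤ 0 := SimpleGraph.maxDegree_le_of_forall_degree_le _ _ fun v => by
      rw [Nat.le_zero, SimpleGraph.degree_eq_zero]
      intro w hw
      exact hw.ne (Subsingleton.elim _ _)
    omega
  -- In a connected graph with at least two vertices every degree is positive, so the number of
  -- darts is at least `n`.
  have hn : n ≤ off n := by
    rw [hN, ← hsum]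
    calc n = ∑ _v : Fin n, 1 := by simp
      _ ≤ ∑ v, G.degree v :=
        Finset.sum_le_sum fun v _ => hG.preconnected.degree_pos_of_nontrivial v
  obtain ⟨t, M, hrun, ht, hM, happrox⟩ := MaxCut.maxCutProg_spec (E := MaxCut.natDarts G) hconn
    (fun p => MaxCut.mem_natDarts) hadj.off_zero hoff (fun src h => hadj.isDarts h) hΔ
    (fun v hv => (MaxCut.card_filter_natDarts_fst ⟨v, hv⟩).trans_le (G.degree_le_maxDegree _)) hn
  set A : Finset (Fin n) := Finset.univ.filter fun v => M.arr 2 v = 1 with hA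
  have hout : MaxCut.OutputsCut M A := by
    intro v
    have := hM v v.is_lt
    simp only [hA, Finset.mem_filter, Finset.mem_univ, true_and]
    split_ifs <;> omega
  refine ⟨t, M, A, hrun, ht.trans_eq ?_, hout, ?_⟩
  · rw [hN]; ring
  obtain ⟨B, -, hB⟩ := Finset.exists_mem_eq_sup (Finset.univ : Finset (Finset (Fin n)))
    ⟨∅, Finset.mem_univ _⟩ (MaxCut.cutSize G)
  obtain ⟨σ, hσ⟩ : ∃ σ : ℕ → ℕ, ∀ v : Fin n, σ v = if v ∈ B then 1 else 0 :=
    ⟨fun v => if h : v < n then (if (⟨v, h⟩ : Fin n) ∈ B then 1 else 0) else 0, fun v => by simp⟩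
  have h1 := happrox σ fun v hv => by
    rw [hσ ⟨v, hv⟩]
    split_ifs <;> omega
  rw [← MaxCut.two_mul_cutSize A _ hout, ← MaxCut.two_mul_cutSize B _ hσ] at h1
  rw [MaxCut.mc, hB]
  have h2 : ((G.maxDegree : ℝ) + 2) * MaxCut.cutSize G B ≤
      2 * G.maxDegree * MaxCut.cutSize G A := by
    have : (G.maxDegree + 2) * MaxCut.cutSize G B ≤ 2 * G.maxDegree * MaxCut.cutSize G A := by
      linarith
    exact_mod_cast this
  have h3 : (0 : ℝ) < G.maxDegree := by
    have : 0 < G.maxDegree := by omega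
    exact_mod_cast this
  have h4 : (1 / 2 + 1 / (G.maxDegree : ℝ)) * (MaxCut.cutSize G B : ℝ) =
      ((G.maxDegree : ℝ) + 2) * MaxCut.cutSize G B / (2 * G.maxDegree) := by
    field_simp
  rw [h4, div_le_iff₀ (by positivity)]
  linarith
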